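/- **Setting.** Let $\Gamma$ be a countable set. For a non-zero finite-dimensional complex Hilbert space $\mathcal H$ let $\mathfrak A_\Gamma(\mathcal H)=\bigotimes_{v\in\Gamma}B(\mathcal H)$ be the quasi-local $C^*$-algebra, i.e. the $C^*$-algebraic direct limit of $\bigotimes_{v\in\Lambda}B(\mathcal H)$ over the finite subsets $\Lambda\subset\Gamma$, and let $\mathscr P_\Gamma(\mathcal H)$ be its space of pure states with the weak-$*$ topology. A linear isometry $f:\mathcal H\to\mathcal K$ sends a state $\omega$ of $\mathfrak A_\Gamma(\mathcal H)$ to the state $\mathscr P_\Gamma(f)(\omega)$ of $\mathfrak A_\Gamma(\mathcal K)$ with $\bigotimes_{v\in\Lambda}A_v\mapsto\omega\big(\bigotimes_{v\in\Lambda}f^*A_vf\big)$. The stacking $\omega_1\otimes\omega_2$ of states of $\mathfrak A_\Gamma(\mathcal H)$ and $\mathfrak A_\Gamma(\mathcal K)$ is the state of $\mathfrak A_\Gamma(\mathcal H\otimes\mathcal K)$ with $\bigotimes_{v\in\Lambda}(A_v\otimes B_v)\mapsto\omega_1(\bigotimes_{v\in\Lambda} A_v)\,\omega_2(\bigotimes_{v\in\Lambda}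 B_v)$. The completely factorized state of a family of unit vectors $(u_v)_{v\in\Gamma}$ of $\mathcal H$ is the state $\bigotimes_{v\in\Lambda}A_v\mapsto\prod_{v\in\Lambda}\langle u_v,A_vu_v\rangle$. A *quantum state type* $\mathscr Q_\Gamma$ assigns to every $\mathcal H$ a subspace $\mathscr Q_\Gamma(\mathcal H)\subseteq\mathscr P_\Gamma(\mathcal H)$ that contains all completely factorized states, such that every linear isometry $f:\mathcal H\to\mathcal K$ restricts to a closed embedding $\mathscr Q_\Gamma(f):\mathscr Q_\Gamma(\mathcal H)\to\mathscr Q_\Gamma(\mathcal K)$, and such that $\omega_1\otimes\omega_2\in\mathscr Q_\Gamma(\mathcal H\otimes\mathcal K)$ for all $\omega_1\in\mathscr Q_\Gamma(\mathcal H)$, $\omega_2\in\mathscr Q_\Gamma(\mathcal K)$. For a complex inner product space $\mathcal V$ of countably infinite algebraic dimension let $\mathscr Q_\Gamma(\mathcal V)$ be the topological direct limit of the spaces $\mathscr Q_\Gamma(W)$ over the non-zero finite-dimensional subspaces $W\subset\mathcal V$. A linear isometry $f:\mathcal K\to\mathcal V$ from a non-zero finite-dimensional $\mathcal K$ induces $\mathscr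 Q_\Gamma(f):\mathscr Q_\Gamma(\mathcal K)\to\mathscr Q_\Gamma(\mathcal V)$. The type $\mathscr Q_\Gamma$ is *invertible* if for every such $\mathcal V$, every linear isometry $u:\mathbb C\to\mathcal V$ (equivalently, unit vector) and every linear isometry $\varphi:\mathcal V\otimes\mathcal V\to\mathcal V$ with $\varphi(u\otimes u)=u$, the set $\pi_0\mathscr Q_\Gamma(\mathcal V)$ is a group under the product induced by $(\omega,\tau)\mapsto\mathscr Q_\Gamma(\varphi)(\omega\otimes\tau)$, with unit the component of the image of $\mathscr Q_\Gamma(u)$. Fix $\mathcal H$ and a unit vector $\psi\in\mathcal H$. Write $\psi_i\in\mathscr Q_\Gamma(\mathcal H^{\otimes i})$ for the completely factorized state with the vector $\psi^{\otimes i}$ at every site ($\mathcal H^{\otimes 0}=\mathbb C$), and identify $\mathcal H^{\otimes i}\otimes\mathcal H^{\otimes j}=\mathcal H^{\otimes(i+j)}$. Let $X$ be a compact Hausdorff space that is homotopy equivalent to a CW complex. For maps $f:X\to\mathscr Q_\Gamma(\mathcal H^{\otimes i})$ and $g:X\to\mathscr Q_\Gamma(\mathcal H^{\otimes j})$ let $f\otimes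 g:X\to\mathscr Q_\Gamma(\mathcal H^{\otimes(i+j)})$ be their pointwise stacking. **Proposition.** 1. If $\mathscr Q_\Gamma$ is invertible, then for every $i\ge0$ and every continuous $f:X\to\mathscr Q_\Gamma(\mathcal H^{\otimes i})$ there are $j\ge0$ and a continuous $g:X\to\mathscr Q_\Gamma(\mathcal H^{\otimes j})$ such that $f\otimes g$ is homotopic to the constant map at $\psi_{i+j}$. 2. Pointwise invertibility implies parametrized invertibility: if for every $i\ge 0$ and every $\omega\in\mathscr Q_\Gamma(\mathcal H^{\otimes i})$ there are $j\ge 0$ and $\tau\in\mathscr Q_\Gamma(\mathcal H^{\otimes j})$ with a path in $\mathscr Q_\Gamma(\mathcal H^{\otimes(i+j)})$ from $\omega\otimes\tau$ to $\psi_{i+j}$, then the conclusion of 1 holds. -/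

import Mathlib

open scoped TensorProduct ComplexOrder InnerProductSpace Classical

set_option linter.unusedSectionVars false
set_option linter.unusedSimpArgs false
set_option linter.deprecated false
noncomputable section
namespace QState

section Algebra
variable (Γ : Type*) (H : Type) [NormedAddCommGroup H] [InnerProductSpace ℂ H]
  [FiniteDimensional ℂ H]

/-! ### The quasi-local algebra

`H` is the Hilbert space of a site and `Γ` the set of sites. The algebra `⊗_{v ∈ Γ} B(H)`, the
direct limit of the C⋆-algebras `⊗_{v ∈ Λ} B(H)` over finite `Λ ⊆ Γ`, is realized as the C⋆-algebra
of operators on `ℓ²(configurations)` generated by the copies of `B(H)` acting on single sites. -/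

/-- Configurations: a basis index at every site. -/
abbrev Config : Type _ := Γ → Fin (Module.finrank ℂ H)

/-- Square summable functions of the configuration. -/
abbrev ConfigSpace : Type _ := lp (fun _ : Config Γ H => ℂ) 2

variable {H}

/-- Matrix coefficients of an operator in the standard orthonormal basis. -/
def coeff (A : H →L[ℂ] H) (i j : Fin (Module.finrank ℂ H)) : ℂ :=
  inner ℂ (stdOrthonormalBasis ℂ H i) (A (stdOrthonormalBasis ℂ H j))

lemma coeff_one (i j : Fin (Module.finrank ℂ H)) :
    coeff (1 : H →L[ℂ] H) i j = if i = j then 1 else 0 := by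
  simp [coeff, (orthonormal_iff_ite.mp (stdOrthonormalBasis ℂ H).orthonormal)]

lemma coeff_mul (A B : H →L[ℂ] H) (i j : Fin (Module.finrank ℂ H)) :
    coeff (A * B) i j = ∑ k, coeff A i k * coeff B k j := by
  unfold coeff
  have h := (stdOrthonormalBasis ℂ H).sum_repr' (B (stdOrthonormalBasis ℂ H j))
  conv_lhs => rw [ContinuousLinearMap.mul_apply, ← h]
  simp [inner_sum, inner_smul_right, mul_comm]

lemma coeff_star (A : H →L[ℂ] H) (i j : Fin (Module.finrank ℂ H)) :
    coeff (star A) i j = star (coeff A j i) := by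
  unfold coeff
  rw [ContinuousLinearMap.star_eq_adjoint, ContinuousLinearMap.adjoint_inner_right]
  simp

variable {Γ}

/-- The operator `A` acting on the variable at the site `v` only. -/
def siteFun (v : Γ) (A : H →L[ℂ] H) (ξ : Config Γ H → ℂ) : Config Γ H → ℂ :=
  fun s => ∑ j, coeff A (s v) j * ξ (Function.update s v j)

lemma memlp_update (v : Γ) (j : Fin (Module.finrank ℂ H)) (ξ : ConfigSpace Γ H) :
    Memℓp (fun s : Config Γ H => ξ (Function.update s v j)) 2 := by
  have hs : Summable fun s : Config Γ H => ‖ξ s‖ ^ 2 := by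
    have := (lp.memℓp ξ).summable (by norm_num)
    simpa using this
  apply memℓp_gen
  simp only [ENNReal.toReal_ofNat, Real.rpow_ofNat]
  let e := Equiv.funSplitAt v (Fin (Module.finrank ℂ H))
  rw [← e.symm.summable_iff]
  have h1 : Summable fun r : {w // w ≠ v} → Fin (Module.finrank ℂ H) =>
      ‖ξ (e.symm (j, r))‖ ^ 2 :=
    (e.symm.summable_iff.mpr hs).comp_injective (i := fun r => (j, r))
      (fun a b h => by simpa using h)
  have h2 : (fun s : Config Γ H => ‖ξ (Function.update s v j)‖ ^ 2) ∘ e.symm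
      = fun p => ‖ξ (e.symm (j, p.2))‖ ^ 2 := by
    funext p
    have : Function.update (e.symm p) v j = e.symm (j, p.2) := by
      funext w
      by_cases hw : w = v
      · subst hw; simp [e]
      · simp [e, hw]
    simp [this]
  rw [h2]
  rw [summable_prod_of_nonneg (by intro p; exact sq_nonneg _)]
  exact ⟨fun _ => h1, Summable.of_finite⟩

lemma memlp_site (v : Γ) (A : H →L[ℂ] H) (ξ : ConfigSpace Γ H) :
    Memℓp (siteFun v A ξ) 2 := by
  unfold siteFun
  have : (fun s : Config Γ H => ∑ j, coeff A (s v) j * ξ (Function.update s v j))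
      = ∑ j, fun s : Config Γ H => coeff A (s v) j * ξ (Function.update s v j) := by
    funext s; simp
  rw [this]
  apply Finset.sum_induction _ (fun f : Config Γ H → ℂ => Memℓp (E := fun _ => ℂ) f 2)
    (fun _ _ h1 h2 => h1.add h2) zero_memℓp
  intro j _
  have hξ := memlp_update v j ξ
  obtain ⟨C, hC⟩ : ∃ C : ℝ, ∀ i, ‖coeff A i j‖ ≤ C :=
    ⟨∑ i, ‖coeff A i j‖, fun i => Finset.single_le_sum (f := fun i => ‖coeff A i j‖)
      (fun _ _ => norm_nonneg _) (Finset.mem_univ i)⟩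
  have h1 : Summable fun s : Config Γ H => ‖ξ (Function.update s v j)‖ ^ 2 := by
    have := hξ.summable (by norm_num)
    simpa using this
  apply memℓp_gen
  simp only [ENNReal.toReal_ofNat, Real.rpow_ofNat]
  refine Summable.of_nonneg_of_le (fun _ => by positivity) (fun s => ?_) (h1.mul_left (C ^ 2))
  rw [norm_mul, mul_pow]
  gcongr
  exact hC _

def siteLin (v : Γ) (A : H →L[ℂ] H) : ConfigSpace Γ H →ₗ[ℂ] ConfigSpace Γ H where
  toFun ξ := ⟨siteFun v A ξ, memlp_site v A ξ⟩
  map_add' ξ η := by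
    ext s
    change _ = siteFun v A ξ s + siteFun v A η s
    simp [siteFun, mul_add, Finset.sum_add_distrib]
  map_smul' c ξ := by
    ext s; simp [siteFun, Finset.mul_sum, mul_left_comm]

lemma continuous_coord (s : Config Γ H) : Continuous fun ξ : ConfigSpace Γ H => ξ s := by
  have : (fun ξ : ConfigSpace Γ H => ξ s) = fun ξ => inner ℂ (lp.single 2 s (1 : ℂ)) ξ := by
    funext ξ; rw [lp.inner_single_left]; simp
  rw [this]; fun_prop

lemma continuous_siteLin (v : Γ) (A : H →L[ℂ] H) : Continuous (siteLin v A) := by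
  apply LinearMap.continuous_of_seq_closed_graph
  intro u x y hu hy
  ext s
  have h1 := ((continuous_coord s).tendsto y).comp hy
  have h2 : Filter.Tendsto (fun n => ∑ j, coeff A (s v) j * (u n) (Function.update s v j))
      Filter.atTop (nhds (∑ j, coeff A (s v) j * x (Function.update s v j))) :=
    tendsto_finsetSum _ fun j _ =>
      (((continuous_coord (Function.update s v j)).tendsto x).comp hu).const_mul _
  exact tendsto_nhds_unique h1 h2

/-- The operator `A` placed at the site `v`, as a bounded operator. -/
def siteOp (v : Γ) (A : H →L[ℂ] H) : ConfigSpace Γ H →L[ℂ] ConfigSpace Γ H :=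
  ⟨siteLin v A, continuous_siteLin v A⟩

lemma siteOp_apply (v : Γ) (A : H →L[ℂ] H) (ξ : ConfigSpace Γ H) (s : Config Γ H) :
    siteOp v A ξ s = ∑ j, coeff A (s v) j * ξ (Function.update s v j) := rfl

lemma siteOp_one (v : Γ) : siteOp v (1 : H →L[ℂ] H) = 1 := by
  ext ξ s
  simp [siteOp_apply, coeff_one]

lemma siteOp_mul (v : Γ) (A B : H →L[ℂ] H) : siteOp v (A * B) = siteOp v A * siteOp v B := by
  ext ξ s
  simp only [siteOp_apply, ContinuousLinearMap.mul_apply, coeff_mul, Finset.sum_mul,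
    Finset.mul_sum, Function.update_self, Function.update_idem]
  rw [Finset.sum_comm]
  simp [mul_assoc]

lemma siteOp_add (v : Γ) (A B : H →L[ℂ] H) : siteOp v (A + B) = siteOp v A + siteOp v B := by
  ext ξ s
  simp [siteOp_apply, coeff, inner_add_right, add_mul, Finset.sum_add_distrib]

lemma siteOp_smul (v : Γ) (c : ℂ) (A : H →L[ℂ] H) : siteOp v (c • A) = c • siteOp v A := by
  ext ξ s
  simp [siteOp_apply, coeff, inner_smul_right, Finset.mul_sum, mul_assoc]

lemma siteOp_single (v : Γ) (A : H →L[ℂ] H) (s : Config Γ H) :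
    siteOp v A (lp.single 2 s (1 : ℂ))
      = ∑ j, coeff A j (s v) • lp.single 2 (Function.update s v j) (1 : ℂ) := by
  ext t
  rw [siteOp_apply]
  simp only [lp.single_apply]
  rw [show (∑ j, coeff A j (s v) • (lp.single 2 (Function.update s v j) (1 : ℂ) :
      ConfigSpace Γ H)) t = ∑ j, coeff A j (s v) * (Pi.single (Function.update s v j) (1 : ℂ) :
      Config Γ H → ℂ) t from by
    rw [lp.coeFn_sum]; simp [lp.coeFn_single]]
  simp only [Pi.single_apply, mul_ite, mul_one, mul_zero]
  by_cases h : ∀ w, w ≠ v → t w = s w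
  · rw [Finset.sum_eq_single (s v), Finset.sum_eq_single (t v)]
    · have h1 : Function.update t v (s v) = s := by
        funext w; by_cases hw : w = v
        · subst hw; simp
        · simp [hw, h w hw]
      have h2 : t = Function.update s v (t v) := by
        funext w; by_cases hw : w = v
        · subst hw; simp
        · simp [hw, h w hw]
      rw [if_pos h1, if_pos h2]
    · intro j _ hj; rw [if_neg]; intro h'; apply hj; rw [h']; simp
    · simp
    · intro j _ hj; rw [if_neg]; intro h'; apply hj; rw [← h']; simp
    · simp
  · push Not at h
    obtain ⟨w, hw, hne⟩ := h
    rw [Finset.sum_eq_zero, Finset.sum_eq_zero]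
    · intro j _; rw [if_neg]; intro h'; apply hne; rw [h']; simp [hw]
    · intro j _; rw [if_neg]; intro h'; apply hne; rw [← h']; simp [hw]

lemma siteOp_star (v : Γ) (A : H →L[ℂ] H) : siteOp v (star A) = star (siteOp v A) := by
  ext ξ s
  have h1 : (star (siteOp v A) ξ : ConfigSpace Γ H) s
      = inner ℂ (siteOp v A (lp.single 2 s (1 : ℂ))) ξ := by
    rw [← ContinuousLinearMap.adjoint_inner_right, lp.inner_single_left,
      ContinuousLinearMap.star_eq_adjoint]
    simp
  rw [h1, siteOp_single, siteOp_apply, sum_inner]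
  refine Finset.sum_congr rfl fun j _ => ?_
  rw [inner_smul_left, lp.inner_single_left, coeff_star]
  simp

lemma siteOp_commute {v w : Γ} (h : v ≠ w) (A B : H →L[ℂ] H) :
    Commute (siteOp v A) (siteOp w B) := by
  ext ξ s
  simp only [siteOp_apply, ContinuousLinearMap.mul_apply, Function.update_of_ne h.symm,
    Function.update_of_ne h, Finset.mul_sum]
  rw [Finset.sum_comm]
  refine Finset.sum_congr rfl fun j _ => Finset.sum_congr rfl fun k _ => ?_
  rw [Function.update_comm h]
  ring

variable (Γ H)
/-- The quasi-local algebra `⊗_{v ∈ Γ} B(H)`: the closed star-subalgebra generated by the operators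
placed at single sites. -/
def quasiLocal : StarSubalgebra ℂ (ConfigSpace Γ H →L[ℂ] ConfigSpace Γ H) :=
  (StarAlgebra.adjoin ℂ {T | ∃ (v : Γ) (A : H →L[ℂ] H), T = siteOp v A}).topologicalClosure
variable {Γ H}

/-- The rank one operator `|x⟩⟨y|`. -/
def unitOp (x y : H) : H →L[ℂ] H := InnerProductSpace.rankOne ℂ x y

lemma siteOp_mem (v : Γ) (A : H →L[ℂ] H) : siteOp v A ∈ quasiLocal Γ H :=
  StarSubalgebra.le_topologicalClosure _ (StarAlgebra.subset_adjoin _ _ ⟨v, A, rfl⟩)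

/-- The operator `A` placed at the site `v`, as an element of the quasi-local algebra. -/
def siteElem (v : Γ) (A : H →L[ℂ] H) : quasiLocal Γ H := ⟨siteOp v A, siteOp_mem v A⟩

lemma siteElem_commute {v w : Γ} (h : v ≠ w) (A B : H →L[ℂ] H) :
    Commute (siteElem v A) (siteElem w B) := Subtype.ext (siteOp_commute h A B)

lemma siteElem_one (v : Γ) : siteElem v (1 : H →L[ℂ] H) = 1 := Subtype.ext (siteOp_one v)
lemma siteElem_mul (v : Γ) (A B : H →L[ℂ] H) :
    siteElem v (A * B) = siteElem v A * siteElem v B := Subtype.ext (siteOp_mul v A B)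
lemma siteElem_add (v : Γ) (A B : H →L[ℂ] H) :
    siteElem v (A + B) = siteElem v A + siteElem v B := Subtype.ext (siteOp_add v A B)
lemma siteElem_smul (v : Γ) (c : ℂ) (A : H →L[ℂ] H) :
    siteElem v (c • A) = c • siteElem v A := Subtype.ext (siteOp_smul v c A)
lemma siteElem_star (v : Γ) (A : H →L[ℂ] H) :
    siteElem v (star A) = star (siteElem v A) := Subtype.ext (siteOp_star v A)

lemma pairwise_commute (Λ : Finset Γ) (A : Γ → H →L[ℂ] H) :
    (Λ : Set Γ).Pairwise (Function.onFun Commute fun v => siteElem v (A v)) :=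
  fun _ _ _ _ h => siteElem_commute h _ _

/-- The elementary tensor `⊗_{v ∈ Λ} A v`, as an element of the quasi-local algebra. -/
def elem (Λ : Finset Γ) (A : Γ → H →L[ℂ] H) : quasiLocal Γ H :=
  Λ.noncommProd (fun v => siteElem v (A v)) (pairwise_commute Λ A)

lemma elem_empty (A : Γ → H →L[ℂ] H) : elem ∅ A = 1 := rfl

lemma elem_insert {Λ : Finset Γ} {v : Γ} (h : v ∉ Λ) (A : Γ → H →L[ℂ] H) :
    elem (insert v Λ) A = siteElem v (A v) * elem Λ A :=
  Finset.noncommProd_insert_of_notMem _ _ _ _ h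

lemma elem_congr {Λ : Finset Γ} {A B : Γ → H →L[ℂ] H} (h : ∀ v ∈ Λ, A v = B v) :
    elem Λ A = elem Λ B :=
  Finset.noncommProd_congr rfl (fun v hv => by rw [h v hv]) _

lemma commute_elem {Λ : Finset Γ} {v : Γ} (h : v ∉ Λ) (T : H →L[ℂ] H) (A : Γ → H →L[ℂ] H) :
    Commute (siteElem v T) (elem Λ A) :=
  Finset.noncommProd_commute _ _ _ _ fun w hw =>
    siteElem_commute (by rintro rfl; exact h hw) _ _

lemma elem_mul (Λ : Finset Γ) (A B : Γ → H →L[ℂ] H) :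
    elem Λ (fun v => A v * B v) = elem Λ A * elem Λ B := by
  induction Λ using Finset.induction_on with
  | empty => simp [elem_empty]
  | insert v Λ h ih =>
    rw [elem_insert h, elem_insert h, elem_insert h, ih, siteElem_mul]
    have := (commute_elem h (B v) A).eq
    rw [mul_assoc, mul_assoc, ← mul_assoc (siteElem v (B v)), this, mul_assoc]

lemma elem_star (Λ : Finset Γ) (A : Γ → H →L[ℂ] H) :
    elem Λ (fun v => star (A v)) = star (elem Λ A) := by
  induction Λ using Finset.induction_on with
  | empty => simp [elem_empty]
  | insert v Λ h ih =>
    rw [elem_insert h, elem_insert h, ih, siteElem_star, star_mul]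
    exact (commute_elem h (A v) A).star_star.eq

lemma elem_subset {Λ Λ' : Finset Γ} (h : Λ ⊆ Λ') {A : Γ → H →L[ℂ] H}
    (hA : ∀ v ∉ Λ, A v = 1) : elem Λ' A = elem Λ A := by
  obtain ⟨Δ, rfl, hd⟩ : ∃ Δ, Λ' = Δ ∪ Λ ∧ Disjoint Δ Λ :=
    ⟨Λ' \ Λ, (Finset.sdiff_union_of_subset h).symm, Finset.sdiff_disjoint⟩
  clear h
  induction Δ using Finset.induction_on with
  | empty => simp
  | insert v Δ hv ih =>
    rw [Finset.disjoint_insert_left] at hd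
    rw [Finset.insert_union, elem_insert (by simp [hv, hd.1]), hA v hd.1, siteElem_one, one_mul,
      ih hd.2]

lemma elem_erase {Λ : Finset Γ} {v : Γ} (h : v ∈ Λ) (A : Γ → H →L[ℂ] H) :
    elem Λ A = siteElem v (A v) * elem (Λ.erase v) A := by
  rw [← elem_insert (by simp), Finset.insert_erase h]

/-- Extend a family of operators over a finite set of sites by the identity. -/
def extOne {Λ : Finset Γ} (B : Λ → H →L[ℂ] H) : Γ → H →L[ℂ] H :=
  fun v => if h : v ∈ Λ then B ⟨v, h⟩ else 1

lemma elem_extOne_update {Λ : Finset Γ} [DecidableEq Λ] (B : Λ → H →L[ℂ] H) (v : Λ)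
    (z : H →L[ℂ] H) :
    elem Λ (extOne (Function.update B v z))
      = siteElem v.1 z * elem (Λ.erase v.1) (extOne B) := by
  rw [elem_erase v.2]
  congr 1
  · simp [extOne]
  · apply elem_congr
    intro w hw
    have hne : w ≠ v.1 := (Finset.mem_erase.mp hw).1
    have hw' : w ∈ Λ := (Finset.mem_erase.mp hw).2
    have : (⟨w, hw'⟩ : Λ) ≠ v := fun h => hne (congrArg Subtype.val h)
    simp [extOne, hw', Function.update_of_ne this]

/-- Elementary tensors depend multilinearly on their factors. -/
def elemM (Λ : Finset Γ) :
    MultilinearMap ℂ (fun _ : Λ => H →L[ℂ] H) (quasiLocal Γ H) where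
  toFun B := elem Λ (extOne B)
  map_update_add' B v x y := by
    rw [elem_extOne_update, elem_extOne_update, elem_extOne_update, siteElem_add, add_mul]
  map_update_smul' B v c x := by
    rw [elem_extOne_update, elem_extOne_update, siteElem_smul, smul_mul_assoc]

lemma elemM_apply (Λ : Finset Γ) (A : Γ → H →L[ℂ] H) :
    elemM Λ (fun v => A v.1) = elem Λ A :=
  elem_congr fun v hv => by simp [extOne, hv]

lemma elem_expand {ι : Type} [Fintype ι] (Λ : Finset Γ) (c : Γ → ι → ℂ)
    (B : Γ → ι → H →L[ℂ] H) :
    elem Λ (fun v => ∑ i, c v i • B v i)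
      = ∑ s : Λ → ι, (∏ v, c v.1 (s v)) • elemM Λ (fun v => B v.1 (s v)) := by
  rw [← elemM_apply, MultilinearMap.map_sum]
  refine Finset.sum_congr rfl fun s _ => ?_
  rw [MultilinearMap.map_smul_univ]

lemma elemM_mul (Λ : Finset Γ) (A B : Λ → H →L[ℂ] H) :
    elemM Λ (fun v => A v * B v) = elemM Λ A * elemM Λ B := by
  change elem Λ _ = elem Λ _ * elem Λ _
  rw [← elem_mul]
  exact elem_congr fun v hv => by simp [extOne, hv]

lemma elemM_star (Λ : Finset Γ) (A : Λ → H →L[ℂ] H) :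
    elemM Λ (fun v => star (A v)) = star (elemM Λ A) := by
  change elem Λ _ = star (elem Λ _)
  rw [← elem_star]
  exact elem_congr fun v hv => by simp [extOne, hv]

lemma rankOne_decomp {ι : Type} [Fintype ι] (b : OrthonormalBasis ι ℂ H) (A : H →L[ℂ] H) :
    A = ∑ p : ι × ι, inner ℂ (b p.1) (A (b p.2)) • unitOp (b p.1) (b p.2) := by
  apply ContinuousLinearMap.ext
  intro x
  rw [Fintype.sum_prod_type, ContinuousLinearMap.sum_apply]
  have h1 := b.sum_repr' (A x)
  have h2 := b.sum_repr' x
  conv_lhs => rw [← h1]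
  refine Finset.sum_congr rfl fun i _ => ?_
  rw [ContinuousLinearMap.sum_apply]
  conv_lhs => rw [← h2]
  simp only [map_sum, inner_sum, map_smul, inner_smul_right, Finset.sum_smul, unitOp,
    ContinuousLinearMap.smul_apply, InnerProductSpace.rankOne_apply, smul_smul]
  exact Finset.sum_congr rfl fun j _ => by rw [mul_comm]

lemma unitOp_mul (x y z w : H) : unitOp x y * unitOp z w = inner ℂ y z • unitOp x w := by
  ext t
  simp [unitOp, smul_smul, mul_comm]

lemma unitOp_star (x y : H) : star (unitOp x y) = unitOp y x := by
  rw [unitOp, ContinuousLinearMap.star_eq_adjoint, InnerProductSpace.adjoint_rankOne]; rfl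

variable (Γ H)
/-- States: positive functionals of value one at the unit. -/
def states : Set (WeakDual ℂ (quasiLocal Γ H)) :=
  {φ | (∀ a, 0 ≤ φ (star a * a)) ∧ φ 1 = 1}

/-- The space of states, with the weak-star topology. -/
abbrev State := {φ : WeakDual ℂ (quasiLocal Γ H) // φ ∈ states Γ H}
variable {Γ H}

lemma State.one (ω : State Γ H) : ω.1 1 = 1 := ω.2.2

/-- Matrix elements of elementary tensors between configurations. -/
lemma elem_entry (Λ : Finset Γ) (A : Γ → H →L[ℂ] H) (x y : Config Γ H) :
    ((elem Λ A : quasiLocal Γ H) : ConfigSpace Γ H →L[ℂ] ConfigSpace Γ H)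
      (lp.single 2 x (1 : ℂ)) y
      = if ∀ v ∉ Λ, y v = x v then ∏ v ∈ Λ, coeff (A v) (y v) (x v) else 0 := by
  induction Λ using Finset.induction_on generalizing y with
  | empty =>
    simp only [elem_empty, OneMemClass.coe_one, ContinuousLinearMap.one_apply, lp.single_apply,
      Pi.single_apply, Finset.notMem_empty, not_false_eq_true, true_imp_iff, Finset.prod_empty]
    congr 1
    rw [← funext_iff]
  | insert v Λ h ih =>
    rw [elem_insert h]
    change siteOp v (A v) ((elem Λ A : quasiLocal Γ H).1 (lp.single 2 x (1 : ℂ))) y = _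
    rw [siteOp_apply, Finset.sum_eq_single (x v)]
    · rw [ih, Finset.prod_insert h]
      have h1 : (∀ w ∉ Λ, Function.update y v (x v) w = x w)
          ↔ ∀ w ∉ insert v Λ, y w = x w := by
        constructor
        · intro hh w hw
          rw [Finset.mem_insert, not_or] at hw
          simpa [hw.1] using hh w hw.2
        · intro hh w hw
          by_cases hwv : w = v
          · subst hwv; simp
          · simpa [hwv] using hh w (by simp [hw, hwv])
      have h2 : ∏ w ∈ Λ, coeff (A w) (Function.update y v (x v) w) (x w)
          = ∏ w ∈ Λ, coeff (A w) (y w) (x w) :=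
        Finset.prod_congr rfl fun w hw => by
          rw [Function.update_of_ne]; rintro rfl; exact h hw
      simp only [h1, h2, mul_ite, mul_zero]
    · intro j _ hj
      rw [ih, if_neg, mul_zero]
      intro hh; exact hj (by simpa using hh v h)
    · simp

/-- A configuration given on `Λ`, continued by a reference configuration. -/
def patch (r : Config Γ H) (Λ : Finset Γ) (s : Λ → Fin (Module.finrank ℂ H)) : Config Γ H :=
  fun v => if h : v ∈ Λ then s ⟨v, h⟩ else r v

/-- The product vector `⊗_{v ∈ Λ} x v`, continued by a reference configuration. -/
def prodVec (r : Config Γ H) (Λ : Finset Γ) (x : Λ → H) : ConfigSpace Γ H :=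
  ∑ s : Λ → Fin (Module.finrank ℂ H),
    (∏ v, inner ℂ (stdOrthonormalBasis ℂ H (s v)) (x v)) • lp.single 2 (patch r Λ s) (1 : ℂ)

lemma inner_elem_eq (A : H →L[ℂ] H) (x y : H) :
    inner ℂ x (A y) = ∑ i, ∑ j, star (inner ℂ (stdOrthonormalBasis ℂ H i) x) *
      inner ℂ (stdOrthonormalBasis ℂ H j) y * coeff A i j := by
  conv_lhs => rw [← (stdOrthonormalBasis ℂ H).sum_repr' x, ← (stdOrthonormalBasis ℂ H).sum_repr' y]
  simp only [map_sum, sum_inner, inner_sum, inner_smul_left, inner_smul_right, map_smul, coeff,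
    starRingEnd_apply, Finset.mul_sum]
  rw [Finset.sum_comm]
  exact Finset.sum_congr rfl fun _ _ => Finset.sum_congr rfl fun _ _ => by ring

lemma inner_prodVec (r : Config Γ H) (Λ : Finset Γ) (x y : Λ → H) (A : Γ → H →L[ℂ] H) :
    inner ℂ (prodVec r Λ x) ((elem Λ A : quasiLocal Γ H).1 (prodVec r Λ y))
      = ∏ v, inner ℂ (x v) (A v.1 (y v)) := by
  have h : ∀ s t : Λ → Fin (Module.finrank ℂ H),
      inner ℂ (lp.single 2 (patch r Λ s) (1 : ℂ) : ConfigSpace Γ H)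
        ((elem Λ A : quasiLocal Γ H).1 (lp.single 2 (patch r Λ t) (1 : ℂ)))
      = ∏ v, coeff (A v.1) (s v) (t v) := by
    intro s t
    rw [lp.inner_single_left, elem_entry, if_pos]
    · rw [← Finset.prod_coe_sort]
      simp [patch]
    · intro v hv; simp [patch, hv]
  simp only [prodVec, map_sum, sum_inner, inner_sum, inner_smul_left, inner_smul_right, map_smul, h]
  simp only [inner_elem_eq, Finset.prod_univ_sum, Fintype.piFinset_univ, Finset.prod_mul_distrib]
  simp only [Finset.prod_mul_distrib, Finset.sum_mul, Finset.mul_sum, map_prod]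
  rw [Finset.sum_comm]
  refine Finset.sum_congr rfl fun s _ => Finset.sum_congr rfl fun t _ => ?_
  simp only [starRingEnd_apply]
  ring

open scoped MatrixOrder Matrix.Norms.L2Operator in
lemma exists_gram {n : Type*} [Fintype n] {M : Matrix n n ℂ} (hM : M.PosSemidef) :
    ∃ B : Matrix n n ℂ, M = B.conjTranspose * B :=
  CStarAlgebra.nonneg_iff_eq_star_mul_self.mp hM.nonneg

lemma exists_local_state [Nontrivial H] {R : Type} [Fintype R] (Λ : Finset Γ)
    (M : Matrix (Λ → R) (Λ → R) ℂ) (hM : M.PosSemidef) (x : Γ → R → H)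
    (h1 : ∑ p, ∑ q, M p q * ∏ v, inner ℂ (x v.1 (p v)) (x v.1 (q v)) = 1) :
    ∃ θ : State Γ H, (∀ a, ‖θ.1 a‖ ≤ ‖a‖) ∧ ∀ A : Γ → H →L[ℂ] H, θ.1 (elem Λ A)
      = ∑ p, ∑ q, M p q * ∏ v, inner ℂ (x v.1 (p v)) (A v.1 (x v.1 (q v))) := by
  obtain ⟨B, rfl⟩ := exists_gram hM
  have : Nonempty (Fin (Module.finrank ℂ H)) := ⟨⟨0, Module.finrank_pos⟩⟩
  let r : Config Γ H := fun _ => Classical.arbitrary _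
  let ξ : (Λ → R) → ConfigSpace Γ H := fun k =>
    ∑ p, B k p • prodVec r Λ (fun v => x v.1 (p v))
  let L : (ConfigSpace Γ H →L[ℂ] ConfigSpace Γ H) →L[ℂ] ℂ :=
    ∑ k, (innerSL ℂ (ξ k)).comp (ContinuousLinearMap.apply ℂ _ (ξ k))
  have hL : ∀ T, L T = ∑ k, inner ℂ (ξ k) (T (ξ k)) := by
    intro T; simp [L, ContinuousLinearMap.sum_apply]
  have hval : ∀ A : Γ → H →L[ℂ] H, L (elem Λ A : quasiLocal Γ H).1
      = ∑ p, ∑ q, (B.conjTranspose * B) p q *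
        ∏ v, inner ℂ (x v.1 (p v)) (A v.1 (x v.1 (q v))) := by
    intro A
    rw [hL]
    simp only [ξ, map_sum, sum_inner, inner_sum, inner_smul_left, inner_smul_right, map_smul,
      inner_prodVec, Matrix.mul_apply, Finset.sum_mul, Finset.mul_sum,
      Matrix.conjTranspose_apply]
    rw [Finset.sum_comm]
    conv_rhs => rw [Finset.sum_comm]
    refine Finset.sum_congr rfl fun p _ => ?_
    rw [Finset.sum_comm]
    refine Finset.sum_congr rfl fun q _ => Finset.sum_congr rfl fun k _ => ?_
    simp only [starRingEnd_apply]; ring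
  have hone : L 1 = 1 := by
    have := hval (fun _ => 1)
    rw [show (elem Λ fun _ => (1 : H →L[ℂ] H)) = (1 : quasiLocal Γ H) from by
      rw [elem_subset (Finset.empty_subset Λ) (by simp), elem_empty]] at this
    rw [← h1]
    exact this
  have hnorm : ∑ k, ‖ξ k‖ ^ 2 = 1 := by
    rw [hL] at hone
    simp only [ContinuousLinearMap.one_apply, inner_self_eq_norm_sq_to_K] at hone
    apply Complex.ofReal_injective
    push_cast
    exact hone
  refine ⟨⟨StrongDual.toWeakDual (L.comp (quasiLocal Γ H).toSubalgebra.toSubmodule.subtypeL),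
    ?_, ?_⟩, ?_, ?_⟩
  · intro a
    change 0 ≤ L (star a.1 * a.1)
    rw [hL]
    refine Finset.sum_nonneg fun k _ => ?_
    rw [ContinuousLinearMap.mul_apply, ContinuousLinearMap.star_eq_adjoint,
      ContinuousLinearMap.adjoint_inner_right]
    simp [inner_self_eq_norm_sq_to_K]
  · exact hone
  · intro a
    change ‖L a.1‖ ≤ ‖a.1‖
    rw [hL]
    calc _ ≤ ∑ k, ‖a.1‖ * ‖ξ k‖ ^ 2 := by
          refine norm_sum_le_of_le _ fun k _ => ?_
          refine (norm_inner_le_norm _ _).trans ?_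
          have := a.1.le_opNorm (ξ k)
          nlinarith [norm_nonneg (ξ k)]
      _ = ‖a.1‖ := by rw [← Finset.mul_sum, hnorm, mul_one]
  · exact hval

lemma State.map_star (ω : State Γ H) (a : quasiLocal Γ H) : ω.1 (star a) = star (ω.1 a) := by
  have h0 := (Complex.nonneg_iff.mp (ω.2.1 a)).2
  have h1 := (Complex.nonneg_iff.mp (ω.2.1 (a + 1))).2
  have h2 := (Complex.nonneg_iff.mp (ω.2.1 (a + Complex.I • 1))).2
  simp only [star_add, star_one, star_smul, mul_add, add_mul, one_mul, mul_one, map_add, ω.one,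
    smul_mul_assoc, mul_smul_comm, map_smul, smul_eq_mul, Complex.add_im] at h1 h2
  apply Complex.ext
  · simp at h2 ⊢; linarith
  · simp at h1 ⊢; linarith

/-- Cut a family off outside `Λ`, replacing its members there by the identity. -/
def cut (Λ : Finset Γ) (A : Γ → H →L[ℂ] H) : Γ → H →L[ℂ] H := fun v => if v ∈ Λ then A v else 1

lemma elem_cut {Λ Λ' : Finset Γ} (h : Λ ⊆ Λ') (A : Γ → H →L[ℂ] H) :
    elem Λ' (cut Λ A) = elem Λ A := by
  rw [elem_subset h (fun v hv => by simp [cut, hv])]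
  exact elem_congr fun v hv => by simp [cut, hv]

/-- Local states with compatible expectation values come from a global state. -/
lemma exists_state {ι : Type*} (A : ι → Finset Γ → Γ → H →L[ℂ] H) (c : ι → Finset Γ → ℂ)
    (h : ∀ Λ, ∃ θ : State Γ H, (∀ a, ‖θ.1 a‖ ≤ ‖a‖) ∧
      ∀ i, ∀ Δ ⊆ Λ, θ.1 (elem Δ (A i Δ)) = c i Δ) :
    ∃ ω : State Γ H, ∀ i Λ, ω.1 (elem Λ (A i Λ)) = c i Λ := by
  choose θ hθ1 hθ2 using h
  let K : Set (WeakDual ℂ (quasiLocal Γ H)) :=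
    WeakDual.toStrongDual ⁻¹' Metric.closedBall 0 1
  have hK : IsCompact K := WeakDual.isCompact_closedBall 0 1
  have hmem : ∀ Λ, (θ Λ).1 ∈ K := by
    intro Λ
    have : ‖WeakDual.toStrongDual (θ Λ).1‖ ≤ 1 := by
      refine ContinuousLinearMap.opNorm_le_bound _ zero_le_one fun a => ?_
      rw [one_mul]; exact hθ1 Λ a
    rw [Set.mem_preimage, Metric.mem_closedBall]
    refine le_of_eq_of_le ?_ this
    exact dist_zero_right (E := StrongDual ℂ (quasiLocal Γ H)) _
  obtain ⟨φ, -, hφ⟩ := hK.exists_mapClusterPt (f := Filter.atTop)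
    (u := fun Λ : Finset Γ => (θ Λ).1) (Filter.tendsto_principal.mpr (.of_forall hmem))
  have hcl : ∀ S : Set (WeakDual ℂ (quasiLocal Γ H)), IsClosed S →
      (∀ᶠ Λ in Filter.atTop, (θ Λ).1 ∈ S) → φ ∈ S := by
    intro S hS hev
    exact isClosed_iff_clusterPt.mp hS φ
      (ClusterPt.mono hφ (Filter.le_principal_iff.mpr hev))
  have hev : ∀ a, Continuous fun χ : WeakDual ℂ (quasiLocal Γ H) => χ a :=
    fun a => WeakDual.eval_continuous a
  refine ⟨⟨φ, fun a => ?_, ?_⟩, fun i Λ => ?_⟩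
  · exact hcl {χ | 0 ≤ χ (star a * a)} (isClosed_Ici.preimage (hev _))
      (.of_forall fun Λ => (θ Λ).2.1 a)
  · exact hcl {χ | χ 1 = 1} (isClosed_singleton.preimage (hev _))
      (.of_forall fun Λ => (θ Λ).2.2)
  · refine hcl {χ | χ (elem Λ (A i Λ)) = c i Λ} (isClosed_singleton.preimage (hev _)) ?_
    filter_upwards [Filter.eventually_ge_atTop Λ] with Λ' hΛ
    exact hθ2 Λ' i Λ hΛ

/-- The density matrix of the restriction of a state to `Λ`, in an orthonormal basis. -/
def density {R : Type} [Fintype R] (b : OrthonormalBasis R ℂ H) (ω : State Γ H) (Λ : Finset Γ) :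
    Matrix (Λ → R) (Λ → R) ℂ :=
  fun p q => ω.1 (elemM Λ fun v => unitOp (b (p v)) (b (q v)))

lemma density_posSemidef [Nontrivial H] {R : Type} [Fintype R] (b : OrthonormalBasis R ℂ H)
    (ω : State Γ H) (Λ : Finset Γ) : (density b ω Λ).PosSemidef := by
  obtain ⟨g, hg⟩ := exists_norm_eq H zero_le_one
  let F : (Λ → R) → quasiLocal Γ H := fun p => elemM Λ fun v => unitOp g (b (p v))
  have hF : ∀ p q, density b ω Λ p q = ω.1 (star (F p) * F q) := by
    intro p q
    simp only [F, density, ← elemM_star, ← elemM_mul, unitOp_star, unitOp_mul]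
    simp [inner_self_eq_norm_sq_to_K, hg]
  have hpos : ∀ z : (Λ → R) → ℂ,
      0 ≤ star z ⬝ᵥ (density b ω Λ).mulVec z := by
    intro z
    have := ω.2.1 (∑ p, z p • F p)
    refine this.trans_eq ?_
    simp only [star_sum, star_smul, Finset.sum_mul, Finset.mul_sum, map_sum, smul_mul_smul_comm,
      map_smul, smul_eq_mul, dotProduct, Matrix.mulVec, Pi.star_apply, hF]
    rw [Finset.sum_comm]
    exact Finset.sum_congr rfl fun _ _ => Finset.sum_congr rfl fun _ _ => by ring
  refine Matrix.posSemidef_iff_dotProduct_mulVec.mpr ⟨?_, hpos⟩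
  ext p q
  rw [Matrix.conjTranspose_apply, hF, hF, ← State.map_star, star_mul, star_star]

lemma state_expand {R : Type} [Fintype R] (b : OrthonormalBasis R ℂ H)
    (ω : State Γ H) (Λ : Finset Γ) (A : Γ → H →L[ℂ] H) :
    ω.1 (elem Λ A) = ∑ p, ∑ q, density b ω Λ p q * ∏ v, inner ℂ (b (p v)) (A v.1 (b (q v))) := by
  conv_lhs => rw [funext fun v => rankOne_decomp b (A v)]
  rw [elem_expand, map_sum, ← Equiv.sum_comp (Equiv.arrowProdEquivProdArrow _ _ _).symm, Fintype.sum_prod_type]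
  refine Finset.sum_congr rfl fun p _ => Finset.sum_congr rfl fun q _ => ?_
  rw [map_smul, smul_eq_mul, mul_comm]
  rfl

lemma exists_push {K : Type} [NormedAddCommGroup K] [InnerProductSpace ℂ K]
    [FiniteDimensional ℂ K] [Nontrivial H] [Nontrivial K] (f : Γ → H →ₗᵢ[ℂ] K) (ω : State Γ H) :
    ∃ τ : State Γ K, ∀ (A : Γ → K →L[ℂ] K) Λ, τ.1 (elem Λ A)
      = ω.1 (elem Λ fun v => (f v).toContinuousLinearMap.adjoint ∘L A v ∘L
          (f v).toContinuousLinearMap) := by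
  refine exists_state (ι := Γ → K →L[ℂ] K) (fun A _ => A) _ fun Λ => ?_
  have hone : ∀ v, (f v).toContinuousLinearMap.adjoint ∘L (1 : K →L[ℂ] K) ∘L
          (f v).toContinuousLinearMap = 1 := by
    intro v
    ext x
    apply ext_inner_left ℂ
    intro y
    simp [ContinuousLinearMap.adjoint_inner_right]
  have hexp := fun B : Γ → K →L[ℂ] K => state_expand (stdOrthonormalBasis ℂ H) ω Λ (fun v =>
    (f v).toContinuousLinearMap.adjoint ∘L B v ∘L (f v).toContinuousLinearMap)
  simp only [ContinuousLinearMap.comp_apply, ContinuousLinearMap.adjoint_inner_right] at hexp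
  have h1 : ω.1 (elem Λ fun v => (f v).toContinuousLinearMap.adjoint ∘L (1 : K →L[ℂ] K) ∘L
          (f v).toContinuousLinearMap) = 1 := by
    simp only [hone]
    rw [elem_subset (Finset.empty_subset Λ) (by simp), elem_empty, State.one]
  obtain ⟨θ, hθ1, hθ2⟩ := exists_local_state Λ _ (density_posSemidef (stdOrthonormalBasis ℂ H) ω Λ)
    (fun v p => f v (stdOrthonormalBasis ℂ H p)) (by
      rw [← h1, hexp fun _ => 1]; rfl)
  refine ⟨θ, hθ1, fun A Δ hΔ => ?_⟩
  rw [← elem_cut hΔ, hθ2]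
  refine (hexp (cut Δ A)).symm.trans ?_
  rw [elem_subset hΔ (fun v hv => by simp only [cut, if_neg hv]; exact hone v)]
  congr 1
  exact elem_congr fun v hv => by simp [cut, hv]

section Tensor
variable {K : Type} [NormedAddCommGroup K] [InnerProductSpace ℂ K] [FiniteDimensional ℂ K]

lemma mapL_unitOp (x y : H) (z w : K) :
    TensorProduct.mapL (unitOp x y) (unitOp z w) = unitOp (x ⊗ₜ[ℂ] z) (y ⊗ₜ[ℂ] w) := by
  apply ContinuousLinearMap.coe_injective
  apply TensorProduct.ext'
  intro a b
  simp [unitOp, TensorProduct.smul_tmul', smul_smul, mul_comm]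

lemma mapL_one : TensorProduct.mapL (1 : H →L[ℂ] H) (1 : K →L[ℂ] K) = 1 := by
  apply ContinuousLinearMap.coe_injective
  apply TensorProduct.ext'
  intro a b
  simp

/-- The product of two local density matrices. -/
def prodDensity {R S : Type} [Fintype R] [Fintype S] (b₁ : OrthonormalBasis R ℂ H)
    (b₂ : OrthonormalBasis S ℂ K) (ω₁ : State Γ H) (ω₂ : State Γ K) (Λ : Finset Γ) :
    Matrix (Λ → R × S) (Λ → R × S) ℂ :=
  ((density b₁ ω₁ Λ).submatrix (fun p v => (p v).1) (fun p v => (p v).1)).hadamard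
    ((density b₂ ω₂ Λ).submatrix (fun p v => (p v).2) (fun p v => (p v).2))

lemma prodDensity_posSemidef [Nontrivial H] [Nontrivial K]
    {R S : Type} [Fintype R] [Fintype S] (b₁ : OrthonormalBasis R ℂ H)
    (b₂ : OrthonormalBasis S ℂ K) (ω₁ : State Γ H) (ω₂ : State Γ K) (Λ : Finset Γ) :
    (prodDensity b₁ b₂ ω₁ ω₂ Λ).PosSemidef :=
  ((density_posSemidef b₁ ω₁ Λ).submatrix _).hadamard ((density_posSemidef b₂ ω₂ Λ).submatrix _)

lemma prodDensity_sum {R S : Type} [Fintype R] [Fintype S] (b₁ : OrthonormalBasis R ℂ H)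
    (b₂ : OrthonormalBasis S ℂ K) (ω₁ : State Γ H) (ω₂ : State Γ K) (Λ : Finset Γ)
    (A : Γ → H →L[ℂ] H) (B : Γ → K →L[ℂ] K) :
    ∑ p, ∑ q, prodDensity b₁ b₂ ω₁ ω₂ Λ p q *
      ∏ v, inner ℂ (b₁ (p v).1 ⊗ₜ[ℂ] b₂ (p v).2)
        (TensorProduct.mapL (A v.1) (B v.1) (b₁ (q v).1 ⊗ₜ[ℂ] b₂ (q v).2))
      = ω₁.1 (elem Λ A) * ω₂.1 (elem Λ B) := by
  rw [state_expand b₁, state_expand b₂]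
  rw [← Equiv.sum_comp (Equiv.arrowProdEquivProdArrow Λ (fun _ => R) (fun _ => S)).symm,
    Fintype.sum_prod_type, Finset.sum_mul_sum]
  refine Finset.sum_congr rfl fun p _ => Finset.sum_congr rfl fun p' _ => ?_
  rw [← Equiv.sum_comp (Equiv.arrowProdEquivProdArrow Λ (fun _ => R) (fun _ => S)).symm,
    Fintype.sum_prod_type, Finset.sum_mul_sum]
  refine Finset.sum_congr rfl fun q _ => Finset.sum_congr rfl fun q' _ => ?_
  simp only [TensorProduct.mapL_apply, TensorProduct.map_tmul, TensorProduct.inner_tmul,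
    Finset.prod_mul_distrib, prodDensity, Matrix.hadamard_apply, Matrix.submatrix_apply]
  exact mul_mul_mul_comm _ _ _ _

lemma exists_tens [Nontrivial H] [Nontrivial K] [Nontrivial (H ⊗[ℂ] K)]
    (ω₁ : State Γ H) (ω₂ : State Γ K) :
    ∃ τ : State Γ (H ⊗[ℂ] K), ∀ (A : (Γ → H →L[ℂ] H) × (Γ → K →L[ℂ] K)) Λ,
      τ.1 (elem Λ fun v => TensorProduct.mapL (A.1 v) (A.2 v))
        = ω₁.1 (elem Λ A.1) * ω₂.1 (elem Λ A.2) := by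
  refine exists_state (ι := (Γ → H →L[ℂ] H) × (Γ → K →L[ℂ] K))
    (fun A _ v => TensorProduct.mapL (A.1 v) (A.2 v))
    (fun A Λ => ω₁.1 (elem Λ A.1) * ω₂.1 (elem Λ A.2)) fun Λ => ?_
  let b₁ := stdOrthonormalBasis ℂ H
  let b₂ := stdOrthonormalBasis ℂ K
  have hval := prodDensity_sum b₁ b₂ ω₁ ω₂ Λ
  obtain ⟨θ, hθ1, hθ2⟩ := exists_local_state Λ _ (prodDensity_posSemidef b₁ b₂ ω₁ ω₂ Λ)
    (fun _ p => b₁ p.1 ⊗ₜ[ℂ] b₂ p.2) (by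
    have := hval (fun _ => 1) (fun _ => 1)
    rw [elem_subset (Finset.empty_subset Λ) (by simp), elem_subset (Finset.empty_subset Λ) (by simp),
      elem_empty, elem_empty, State.one, State.one, mul_one] at this
    rw [← this]
    simp only [mapL_one, ContinuousLinearMap.one_apply])
  refine ⟨θ, hθ1, fun A Δ hΔ => ?_⟩
  rw [← elem_cut hΔ, hθ2, ← elem_cut hΔ A.1, ← elem_cut hΔ A.2, ← hval (cut Δ A.1) (cut Δ A.2)]
  refine Finset.sum_congr rfl fun p _ => Finset.sum_congr rfl fun q _ => ?_
  congr 1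
  refine Finset.prod_congr rfl fun v _ => ?_
  congr 2
  by_cases hv : v.1 ∈ Δ <;> simp only [cut, hv, if_true, if_false, mapL_one]
end Tensor

lemma exists_sq_defect_aux {A : Type*} [CStarAlgebra A] (a : A) :
    ∃ b : A, star b * b = ((‖a‖ ^ 2 : ℝ) : ℂ) • 1 - star a * a := by
  let _ : PartialOrder A := CStarAlgebra.spectralOrder _
  have _ : StarOrderedRing A := CStarAlgebra.spectralOrderedRing _
  have h := CStarAlgebra.star_mul_le_algebraMap_norm_sq (a := a)
  obtain ⟨b, hb⟩ := CStarAlgebra.nonneg_iff_eq_star_mul_self.mp (sub_nonneg.mpr h)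
  refine ⟨b, hb.symm.trans ?_⟩
  rw [Algebra.algebraMap_eq_smul_one]
  rfl

lemma exists_sq_defect (a : quasiLocal Γ H) :
    ∃ b : quasiLocal Γ H, star b * b = ((‖a‖ ^ 2 : ℝ) : ℂ) • 1 - star a * a :=
  let _ : CStarAlgebra (quasiLocal Γ H) := StarSubalgebra.cstarAlgebra (quasiLocal Γ H)
      (h_closed := StarSubalgebra.isClosed_topologicalClosure _)
  exists_sq_defect_aux a

lemma State.norm_le (ω : State Γ H) (a : quasiLocal Γ H) : ‖ω.1 a‖ ≤ ‖a‖ := by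
  obtain ⟨b, hb⟩ := exists_sq_defect a
  have h1 := (Complex.nonneg_iff.mp (ω.2.1 b)).1
  rw [hb, map_sub, map_smul, ω.one] at h1
  have h2 := (Complex.nonneg_iff.mp (ω.2.1 (a - ω.1 a • 1))).1
  simp only [star_sub, star_one, star_smul, mul_sub, sub_mul, one_mul, mul_one, map_sub, ω.one,
    smul_mul_assoc, mul_smul_comm, map_smul, smul_eq_mul, ω.map_star] at h2
  have h3 : ‖ω.1 a‖ ^ 2 ≤ ‖a‖ ^ 2 := by
    rw [← Complex.normSq_eq_norm_sq, Complex.normSq_apply]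
    simp at h1 h2
    have h4 : ‖a.1‖ = ‖a‖ := rfl
    rw [h4, ← Complex.ofReal_pow, Complex.ofReal_re] at h1
    linarith
  exact le_of_sq_le_sq h3 (norm_nonneg _)

lemma elem_mem_span (a : quasiLocal Γ H) :
    a ∈ (Submodule.span ℂ {T : quasiLocal Γ H | ∃ Λ A, T = elem Λ A}).topologicalClosure := by
  let S : Submodule ℂ (quasiLocal Γ H) := Submodule.span ℂ {T | ∃ Λ A, T = elem Λ A}
  have hmul : ∀ a ∈ S, ∀ b ∈ S, a * b ∈ S := by
    intro a ha b hb
    have hab := Submodule.mul_mem_mul ha hb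
    rw [Submodule.span_mul_span] at hab
    refine Submodule.span_le.mpr ?_ hab
    rintro _ ⟨_, ⟨Λ, A, rfl⟩, _, ⟨Λ', A', rfl⟩, rfl⟩
    refine Submodule.subset_span ⟨Λ ∪ Λ', fun v => cut Λ A v * cut Λ' A' v, ?_⟩
    rw [elem_mul, elem_cut Finset.subset_union_left, elem_cut Finset.subset_union_right]
  have hstar : ∀ a ∈ S, star a ∈ S := by
    intro a ha
    refine Submodule.span_induction (p := fun a _ => star a ∈ S) ?_ ?_ ?_ ?_ ha
    · rintro _ ⟨Λ, A, rfl⟩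
      exact Submodule.subset_span ⟨Λ, _, (elem_star Λ A).symm⟩
    · simp
    · intro x y _ _ hx hy; rw [star_add]; exact S.add_mem hx hy
    · intro c x _ hx; rw [star_smul]; exact S.smul_mem _ hx
  have hadj : ∀ T, T ∈ StarAlgebra.adjoin ℂ {T | ∃ (v : Γ) (A : H →L[ℂ] H), T = siteOp v A} →
      ∃ a ∈ S, a.1 = T := by
    intro T hT
    induction hT using StarAlgebra.adjoin_induction with
    | mem T h =>
      obtain ⟨v, A, rfl⟩ := h
      refine ⟨elem {v} (fun _ => A), Submodule.subset_span ⟨_, _, rfl⟩, ?_⟩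
      simp [elem, siteElem]
    | algebraMap c =>
      refine ⟨algebraMap ℂ _ c, ?_, rfl⟩
      rw [Algebra.algebraMap_eq_smul_one]
      exact S.smul_mem _ (Submodule.subset_span ⟨∅, fun _ => 1, rfl⟩)
    | add x y _ _ hx hy =>
      obtain ⟨a, ha, rfl⟩ := hx
      obtain ⟨b, hb, rfl⟩ := hy
      exact ⟨a + b, S.add_mem ha hb, rfl⟩
    | mul x y _ _ hx hy =>
      obtain ⟨a, ha, rfl⟩ := hx
      obtain ⟨b, hb, rfl⟩ := hy
      exact ⟨a * b, hmul a ha b hb, rfl⟩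
    | star x _ hx =>
      obtain ⟨a, ha, rfl⟩ := hx
      exact ⟨star a, hstar a ha, rfl⟩
  have ha := a.2
  change a ∈ closure (S : Set (quasiLocal Γ H))
  rw [Topology.IsInducing.subtypeVal.closure_eq_preimage_closure_image]
  refine closure_mono ?_ (show a.1 ∈ closure _ from ha)
  intro T hT
  obtain ⟨b, hb, rfl⟩ := hadj T hT
  exact ⟨b, hb, rfl⟩

/-- A state is determined by its values on elementary tensors. -/
lemma State.ext_elem {ω τ : State Γ H}
    (h : ∀ (A : Γ → H →L[ℂ] H) Λ, ω.1 (elem Λ A) = τ.1 (elem Λ A)) : ω = τ := by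
  apply Subtype.ext
  refine ContinuousLinearMap.ext fun a => ?_
  refine closure_minimal (t := {a | ω.1 a = τ.1 a}) ?_
    (isClosed_eq (map_continuous ω.1) (map_continuous τ.1)) (elem_mem_span a)
  intro b hb
  refine Submodule.span_induction (p := fun b _ => ω.1 b = τ.1 b) ?_ ?_ ?_ ?_ hb
  · rintro _ ⟨Λ, A, rfl⟩; exact h A Λ
  · simp
  · intro x y _ _ hx hy; rw [map_add, map_add, hx, hy]
  · intro c x _ hx; rw [map_smul, map_smul, hx]

/-- A map into the state space is continuous if its values on elementary tensors are. -/
lemma State.continuous_of_elem {X : Type*} [TopologicalSpace X] {F : X → State Γ H}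
    (h : ∀ (A : Γ → H →L[ℂ] H) Λ, Continuous fun x => (F x).1 (elem Λ A)) : Continuous F := by
  refine Continuous.subtype_mk (WeakDual.continuous_of_continuous_eval fun a => ?_) _
  have hS : ∀ b ∈ Submodule.span ℂ {T : quasiLocal Γ H | ∃ Λ A, T = elem Λ A},
      Continuous fun x => (F x).1 b := by
    intro b hb
    refine Submodule.span_induction (p := fun b _ => Continuous fun x => (F x).1 b) ?_ ?_ ?_ ?_ hb
    · rintro _ ⟨Λ, A, rfl⟩; exact h A Λ
    · simpa using continuous_const
    · intro x y _ _ hx hy; simp only [map_add]; exact hx.add hy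
    · intro c x _ hx; simp only [map_smul, smul_eq_mul]; exact hx.const_mul c
  rw [Metric.continuous_iff']
  intro x ε hε
  obtain ⟨b, hb, hab⟩ := Metric.mem_closure_iff.mp (elem_mem_span a) (ε / 3) (by positivity)
  filter_upwards [Metric.continuous_iff'.mp (hS b hb) x (ε / 3) (by positivity)] with y hy
  have hz : ∀ z, dist ((F z).1 a) ((F z).1 b) < ε / 3 := by
    intro z
    rw [dist_eq_norm, ← map_sub]
    exact ((F z).norm_le _).trans_lt (by rwa [← dist_eq_norm])
  have h1 := hz x
  have h2 := hz y
  rw [dist_comm] at h1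
  have h3 := dist_triangle4 ((F y).1 a) ((F y).1 b) ((F x).1 b) ((F x).1 a)
  linarith

/-- Product states: `ω (⊗ A v) = ∏ ⟨u v, A v (u v)⟩` for unit vectors `u v`. -/
lemma exists_factorized [Nontrivial H] (u : Γ → H) (hu : ∀ v, ‖u v‖ = 1) :
    ∃ ω : State Γ H, ∀ (A : Γ → H →L[ℂ] H) Λ,
      ω.1 (elem Λ A) = ∏ v ∈ Λ, inner ℂ (u v) (A v (u v)) := by
  refine exists_state (ι := Γ → H →L[ℂ] H) (fun A _ => A)
    (fun A Λ => ∏ v ∈ Λ, inner ℂ (u v) (A v (u v))) fun Λ => ?_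
  obtain ⟨θ, hθ1, hθ2⟩ := exists_local_state (R := Unit) Λ 1 Matrix.PosSemidef.one
    (fun v _ => u v) (by simp [inner_self_eq_norm_sq_to_K, hu])
  refine ⟨θ, hθ1, fun A Δ hΔ => ?_⟩
  rw [← elem_cut hΔ, hθ2, Fintype.sum_unique, Fintype.sum_unique, Matrix.one_apply_eq, one_mul,
    Finset.prod_coe_sort Λ (fun v => inner ℂ (u v) (cut Δ A v (u v))), ← Finset.prod_subset hΔ]
  · exact Finset.prod_congr rfl fun v hv => by simp [cut, hv]
  · intro v _ hv; simp [cut, hv, inner_self_eq_norm_sq_to_K, hu]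

/-- The completely factorized pure state `⊗ u v`: the state with
`ω (⊗ A v) = ∏ ⟨u v, A v (u v)⟩`. -/
def factorized [Nontrivial H] (u : Γ → H) (hu : ∀ v, ‖u v‖ = 1) : State Γ H :=
  Classical.choose (exists_factorized u hu)

lemma factorized_elem [Nontrivial H] (u : Γ → H) (hu : ∀ v, ‖u v‖ = 1)
    (A : Γ → H →L[ℂ] H) (Λ : Finset Γ) :
    (factorized u hu).1 (elem Λ A) = ∏ v ∈ Λ, inner ℂ (u v) (A v (u v)) :=
  Classical.choose_spec (exists_factorized u hu) A Λ

section Functoriality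
variable {K : Type} [NormedAddCommGroup K] [InnerProductSpace ℂ K] [FiniteDimensional ℂ K]
  [Nontrivial H] [Nontrivial K]

/-- The action of an isometry `f` on states: `ω` goes to the state
`⊗ A v ↦ ω (⊗ f† (A v) f)`. -/
def push (f : H →ₗᵢ[ℂ] K) (ω : State Γ H) : State Γ K :=
  Classical.choose (exists_push (fun _ => f) ω)

lemma push_elem (f : H →ₗᵢ[ℂ] K) (ω : State Γ H) (A : Γ → K →L[ℂ] K) (Λ : Finset Γ) :
    (push f ω).1 (elem Λ A) = ω.1 (elem Λ fun v => f.toContinuousLinearMap.adjoint ∘L A v ∘L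
      f.toContinuousLinearMap) :=
  Classical.choose_spec (exists_push (fun _ => f) ω) A Λ

lemma continuous_push (f : H →ₗᵢ[ℂ] K) : Continuous (push (Γ := Γ) f) := by
  refine State.continuous_of_elem fun A Λ => ?_
  simp only [push_elem]
  exact (WeakDual.eval_continuous _).comp continuous_subtype_val

instance : Nontrivial (H ⊗[ℂ] K) := by
  obtain ⟨x, hx⟩ := exists_ne (0 : H)
  obtain ⟨y, hy⟩ := exists_ne (0 : K)
  refine ⟨x ⊗ₜ[ℂ] y, 0, fun h => ?_⟩
  have h1 := TensorProduct.norm_tmul (𝕜 := ℂ) x y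
  rw [h, norm_zero, zero_eq_mul, norm_eq_zero, norm_eq_zero] at h1
  tauto

/-- Stacking: the state `ω₁ ⊗ ω₂` of the system with site space `H ⊗ K`, with
`(ω₁ ⊗ ω₂) (⊗ (A v ⊗ B v)) = ω₁ (⊗ A v) * ω₂ (⊗ B v)`. -/
def tens (ω₁ : State Γ H) (ω₂ : State Γ K) : State Γ (H ⊗[ℂ] K) :=
  Classical.choose (exists_tens ω₁ ω₂)

lemma tens_elem (ω₁ : State Γ H) (ω₂ : State Γ K) (A : Γ → H →L[ℂ] H) (B : Γ → K →L[ℂ] K)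
    (Λ : Finset Γ) :
    (tens ω₁ ω₂).1 (elem Λ fun v => TensorProduct.mapL (A v) (B v))
      = ω₁.1 (elem Λ A) * ω₂.1 (elem Λ B) :=
  Classical.choose_spec (exists_tens ω₁ ω₂) (A, B) Λ

variable (H K) in
abbrev TensorIndex : Type :=
  (Fin (Module.finrank ℂ H) × Fin (Module.finrank ℂ K)) ×
    (Fin (Module.finrank ℂ H) × Fin (Module.finrank ℂ K))

/-- Elementary tensors over `H ⊗ K` are sums of products of elementary tensors. -/
lemma elem_tensor_expand (Λ : Finset Γ) (C : Γ → (H ⊗[ℂ] K) →L[ℂ] (H ⊗[ℂ] K)) :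
    ∃ (c : (Λ → TensorIndex H K) → ℂ) (A : (Λ → TensorIndex H K) → Γ → H →L[ℂ] H)
      (B : (Λ → TensorIndex H K) → Γ → K →L[ℂ] K),
      elem Λ C = ∑ i, c i • elem Λ fun v => TensorProduct.mapL (A i v) (B i v) := by
  let b₁ := stdOrthonormalBasis ℂ H
  let b₂ := stdOrthonormalBasis ℂ K
  let b := b₁.tensorProduct b₂
  refine ⟨fun s => ∏ v, inner ℂ (b (s v).1) (C v.1 (b (s v).2)),
    fun s => extOne fun v => unitOp (b₁ (s v).1.1) (b₁ (s v).2.1),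
    fun s => extOne fun v => unitOp (b₂ (s v).1.2) (b₂ (s v).2.2), ?_⟩
  conv_lhs => rw [funext fun v => rankOne_decomp b (C v)]
  rw [elem_expand]
  refine Finset.sum_congr rfl fun s _ => ?_
  congr 1
  refine elem_congr fun v hv => ?_
  simp only [extOne, hv, dif_pos, mapL_unitOp, b, OrthonormalBasis.tensorProduct_apply']

/-- The state `tens ω₁ ω₂` is the only one with the property that defines it. -/
lemma tens_unique (ω₁ : State Γ H) (ω₂ : State Γ K) (τ : State Γ (H ⊗[ℂ] K))
    (h : ∀ (A : Γ → H →L[ℂ] H) (B : Γ → K →L[ℂ] K) Λ,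
      τ.1 (elem Λ fun v => TensorProduct.mapL (A v) (B v)) = ω₁.1 (elem Λ A) * ω₂.1 (elem Λ B)) :
    τ = tens ω₁ ω₂ := by
  refine State.ext_elem fun C Λ => ?_
  obtain ⟨c, A, B, hC⟩ := elem_tensor_expand Λ C
  rw [hC, map_sum, map_sum]
  exact Finset.sum_congr rfl fun i _ => by rw [map_smul, map_smul, h, tens_elem]

lemma continuous_tens : Continuous fun p : State Γ H × State Γ K => tens p.1 p.2 := by
  refine State.continuous_of_elem fun C Λ => ?_
  obtain ⟨c, A, B, hC⟩ := elem_tensor_expand Λ C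
  simp only [hC, map_sum, map_smul, tens_elem, smul_eq_mul]
  refine continuous_finsetSum _ fun i _ => ?_
  have h₁ : Continuous fun p : State Γ H × State Γ K => p.1.1 (elem Λ (A i)) :=
    (WeakDual.eval_continuous _).comp (continuous_subtype_val.comp continuous_fst)
  have h₂ : Continuous fun p : State Γ H × State Γ K => p.2.1 (elem Λ (B i)) :=
    (WeakDual.eval_continuous _).comp (continuous_subtype_val.comp continuous_snd)
  exact continuous_const.mul (h₁.mul h₂)

end Functoriality
end Algebra

/-! ### Site Hilbert spaces -/

/-- Non-zero finite-dimensional complex Hilbert spaces. -/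
structure FinHilb where
  carrier : Type
  [normed : NormedAddCommGroup carrier]
  [inner : InnerProductSpace ℂ carrier]
  [finite : FiniteDimensional ℂ carrier]
  [nontrivial : Nontrivial carrier]

namespace FinHilb

instance : CoeSort FinHilb Type := ⟨carrier⟩
instance (H : FinHilb) : NormedAddCommGroup H := H.normed
instance (H : FinHilb) : InnerProductSpace ℂ H := H.inner
instance (H : FinHilb) : FiniteDimensional ℂ H := H.finite
instance (H : FinHilb) : Nontrivial H := H.nontrivial

/-- The monoidal unit `ℂ`. -/
abbrev unit : FinHilb := ⟨ℂ⟩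

abbrev tensor (H K : FinHilb) : FinHilb := ⟨H ⊗[ℂ] K⟩

/-- Tensor powers `H^{⊗ n}`. -/
def pow (H : FinHilb) : ℕ → FinHilb
  | 0 => unit
  | n + 1 => tensor (pow H n) H

/-- The associativity isomorphism `H^{⊗ i} ⊗ H^{⊗ j} ≅ H^{⊗ (i + j)}`. -/
def powIso (H : FinHilb) (i : ℕ) : ∀ j : ℕ, (H.pow i ⊗[ℂ] H.pow j) ≃ₗᵢ[ℂ] H.pow (i + j)
  | 0 => (TensorProduct.commIsometry ℂ (H.pow i) ℂ).trans (TensorProduct.lidIsometry ℂ (H.pow i))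
  | j + 1 => (TensorProduct.assocIsometry ℂ (H.pow i) (H.pow j) H).symm.trans
      (TensorProduct.congrIsometry (powIso H i j) (LinearIsometryEquiv.refl ℂ H))

/-- Tensor powers `ψ ⊗ ⋯ ⊗ ψ` of a vector. -/
def vecPow {H : FinHilb} (ψ : H) : ∀ n : ℕ, H.pow n
  | 0 => (1 : ℂ)
  | n + 1 => vecPow ψ n ⊗ₜ[ℂ] ψ

lemma norm_vecPow {H : FinHilb} {ψ : H} (hψ : ‖ψ‖ = 1) : ∀ n, ‖vecPow ψ n‖ = 1
  | 0 => norm_one (α := ℂ)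
  | n + 1 => (TensorProduct.norm_tmul (𝕜 := ℂ) (vecPow ψ n) ψ).trans (by
      rw [norm_vecPow hψ n, hψ, one_mul])

end FinHilb

/-! ### Quantum state types -/

/-- A quantum state type on the lattice `Γ`. -/
structure QuantumStateType (Γ : Type*) where
  /-- The states of this type of the system with site space `H`. -/
  states : ∀ H : FinHilb, Set (State Γ H)
  /-- The states are pure, that is, extreme points of the convex set of all states. -/
  pure : ∀ (H : FinHilb), ∀ ω ∈ states H, ω.1 ∈ Set.extremePoints ℝ (QState.states Γ H)
  /-- All completely factorized pure states belong to the type. -/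
  factorized_mem : ∀ (H : FinHilb) (u : Γ → H) (hu : ∀ v, ‖u v‖ = 1), factorized u hu ∈ states H
  /-- The type is a functor: isometries act on it as on all states. -/
  push_mem : ∀ {H K : FinHilb} (f : H →ₗᵢ[ℂ] K), ∀ ω ∈ states H, push f ω ∈ states K
  isClosedEmbedding : ∀ {H K : FinHilb} (f : H →ₗᵢ[ℂ] K), Topology.IsClosedEmbedding
    fun ω : states H => (⟨push f ω.1, push_mem f ω.1 ω.2⟩ : states K)
  /-- The type is closed under stacking. -/
  tens_mem : ∀ {H K : FinHilb}, ∀ ω₁ ∈ states H, ∀ ω₂ ∈ states K,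
    tens ω₁ ω₂ ∈ states (H.tensor K)

namespace QuantumStateType
variable {Γ : Type*} (Q : QuantumStateType Γ)

/-- The topological space `𝒬(H)`. -/
abbrev obj (H : FinHilb) : Type _ := Q.states H

/-- The continuous map `𝒬(f)`. -/
def map {H K : FinHilb} (f : H →ₗᵢ[ℂ] K) : C(Q.obj H, Q.obj K) :=
  ⟨fun ω => ⟨push f ω.1, Q.push_mem f ω.1 ω.2⟩, (Q.isClosedEmbedding f).continuous⟩

/-- The stacking map `𝒬(H) × 𝒬(K) → 𝒬(H ⊗ K)`. -/
def stack {H K : FinHilb} : C(Q.obj H × Q.obj K, Q.obj (H.tensor K)) :=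
  ⟨fun p => ⟨tens p.1.1 p.2.1, Q.tens_mem _ p.1.2 _ p.2.2⟩,
    (continuous_tens.comp (continuous_subtype_val.prodMap continuous_subtype_val)).subtype_mk _⟩

/-- The product state with the unit vector `u` at every site. -/
def product {H : FinHilb} (u : H) (hu : ‖u‖ = 1) : Q.obj H :=
  ⟨factorized (fun _ => u) (fun _ => hu), Q.factorized_mem H _ _⟩

/-- Stacking on tensor powers, `𝒬(H^{⊗ i}) × 𝒬(H^{⊗ j}) → 𝒬(H^{⊗ (i + j)})`. -/
def stackPow (H : FinHilb) (i j : ℕ) :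
    C(Q.obj (H.pow i) × Q.obj (H.pow j), Q.obj (H.pow (i + j))) :=
  (Q.map (K := H.pow (i + j)) (H := (H.pow i).tensor (H.pow j))
    (H.powIso i j).toLinearIsometry).comp Q.stack

/-- The trivial state `ψ_i` of `H^{⊗ i}`: the product state with `ψ ⊗ ⋯ ⊗ ψ` at every site. -/
def trivialState {H : FinHilb} (ψ : H) (hψ : ‖ψ‖ = 1) (i : ℕ) : Q.obj (H.pow i) :=
  Q.product (FinHilb.vecPow ψ i) (FinHilb.norm_vecPow hψ i)

/-! ### Extension to inner product spaces of countable dimension -/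

section Colim
variable (V : Type) [NormedAddCommGroup V] [InnerProductSpace ℂ V]

/-- The non-zero finite-dimensional subspaces of `V`. -/
structure FinSub where
  space : Submodule ℂ V
  [finite : FiniteDimensional ℂ space]
  [nontrivial : Nontrivial space]

variable {V} in
def FinSub.hilb (W : FinSub V) : FinHilb :=
  have := W.finite
  have := W.nontrivial
  ⟨W.space⟩

variable {V} in
def FinSub.incl {W W' : FinSub V} (h : W.space ≤ W'.space) : W.hilb →ₗᵢ[ℂ] W'.hilb :=
  ⟨Submodule.inclusion h, fun _ => rfl⟩

/-- `𝒬(V)`, the topological direct limit of the spaces `𝒬(W)` over the non-zero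
finite-dimensional subspaces `W` of `V`. -/
def colim : Type _ :=
  Quot fun p q : Σ W : FinSub V, Q.obj W.hilb =>
    ∃ h : p.1.space ≤ q.1.space, Q.map (FinSub.incl h) p.2 = q.2

instance : TopologicalSpace (Q.colim V) :=
  inferInstanceAs (TopologicalSpace (Quot _))

variable {V}

/-- The range of an isometry out of a site Hilbert space. -/
def FinSub.range {H : FinHilb} (f : H →ₗᵢ[ℂ] V) : FinSub V where
  space := LinearMap.range f.toLinearMap
  nontrivial := f.equivRange.toLinearEquiv.symm.toEquiv.nontrivial

/-- The map `𝒬(f) : 𝒬(H) → 𝒬(V)` induced by an isometry `f : H → V`. -/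
def toColim {H : FinHilb} (f : H →ₗᵢ[ℂ] V) (ω : Q.obj H) : Q.colim V :=
  Quot.mk _ ⟨FinSub.range f, Q.map (K := (FinSub.range f).hilb) f.equivRange.toLinearIsometry ω⟩

/-- The class of `𝒬(f)(ω)` in the set of path components of `𝒬(V)`. -/
def component {H : FinHilb} (f : H →ₗᵢ[ℂ] V) (ω : Q.obj H) : ZerothHomotopy (Q.colim V) :=
  Quotient.mk (pathSetoid _) (Q.toColim f ω)

end Colim

/-- A quantum state type is invertible if for every inner product space `V` of countably infinite
algebraic dimension and every unit vector of `V`, given as an isometry `u : ℂ → V`, the set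
`π₀ 𝒬(V)` is a group under the product `[ω] * [τ] = [𝒬(φ)(ω ⊗ τ)]`, with unit the class of
`𝒬(u)`. Here `φ : V ⊗ V → V` is any isometry with `φ (u ⊗ u) = u`. As `𝒬(V)` is the direct limit
over finite-dimensional spaces, the product is described on points `𝒬(f)(ω)` and `𝒬(g)(τ)`. -/
def IsInvertible : Prop :=
  ∀ (V : Type) [NormedAddCommGroup V] [InnerProductSpace ℂ V],
    Module.rank ℂ V = Cardinal.aleph0 →
    ∀ (u : ℂ →ₗᵢ[ℂ] V) (φ : V ⊗[ℂ] V →ₗᵢ[ℂ] V), φ (u 1 ⊗ₜ[ℂ] u 1) = u 1 →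
      ∃ _ : Group (ZerothHomotopy (Q.colim V)),
        Q.component (H := FinHilb.unit) u (Q.product (1 : ℂ) norm_one) = 1 ∧
        ∀ (K L : FinHilb) (f : K →ₗᵢ[ℂ] V) (g : L →ₗᵢ[ℂ] V) (ω : Q.obj K) (τ : Q.obj L),
          Q.component f ω * Q.component g τ
            = Q.component (H := K.tensor L) (φ.comp (TensorProduct.mapIsometry f g))
                (Q.stack (ω, τ))

end QuantumStateType

/-- A parameter space: a compact Hausdorff space homotopy equivalent to a CW complex. -/
structure IsParameterSpace.{u} (X : Type u) [TopologicalSpace X] : Prop where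
  compact : CompactSpace X
  hausdorff : T2Space X
  cw : ∃ (Y : Type u) (_ : TopologicalSpace Y) (_ : T2Space Y),
    Nonempty (Topology.CWComplex (Set.univ : Set Y)) ∧ Nonempty (ContinuousMap.HomotopyEquiv X Y)

end QState

/-!
Stacking with suitable fixed isometries makes states over site Hilbert spaces an associative and
commutative product up to isometries of the site spaces, and everything homotopical follows from
these formal properties, which are collected in `StackingTheory`.

*From points to families.* Call a class of site spaces good if it is closed under tensor products
and every state over such a space has an inverse, up to a path of states. For a good class, families
over a finite CW complex have inverses up to homotopy, by induction on the number of cells. Let `X`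
arise from `A` by attaching an `n`-cell, let `f` be a family over `X` and `g` an inverse of `f` on
`A`. On the boundary of the cell `f` is homotopic to a constant family, hence so is `g` after
stacking with a trivial state (an inverse of the constant value of `f` is used here); so `g` extends
to `X` (`exists_extension_of_inverse`). By the homotopy extension property `f ⊗ g` is homotopic to a
family which is trivial on `A`, that is, to a map on the cube that is trivial on its boundary. For
`n = 0` its inverse is the one of a point. For `n > 0` the inverse is the composition with a
reflection of the cube (`stackMap_reflection_homotopicRel`): this is the Eckmann-Hilton argument, in
which the two tensor factors are interchanged along a path of unitary operators. Finally a compact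
space `X` homotopy equivalent to a CW complex `Y` is a homotopy retract of a finite subcomplex of
`Y`, as compact subsets of `Y` lie in finite subcomplexes (`HasInverses.of_isParameterSpace`).

*From invertibility to points.* If `H` has dimension one, there is only one state. Otherwise, let
`V` be a space with a countable orthonormal Hamel basis; it is isometric to `V ⊗ V`, so invertibility
applies to it and provides an inverse of any state in `π₀ 𝒬(V)`. The transition maps of the direct
limit `𝒬(V)` are closed embeddings of T1 spaces, hence a path in `𝒬(V)` lies in a finite stage
(`StackingTheory.joined_of_joined_ofStage`). This gives a path in the state space of some
finite-dimensional space `U`. It is transported to a tensor power of `H` by an isometry. The choice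
of isometries does not matter: after the addition of a tensor factor of dimension at least two, any
two of them are connected through a third one with orthogonal range
(`StackingTheory.joined_map_insertRight`).
-/

namespace QState

/-! ### Functoriality of stacking and of product states -/

section StateCalculus
variable {Γ : Type*}
variable {H K L M : Type}
  [NormedAddCommGroup H] [InnerProductSpace ℂ H] [FiniteDimensional ℂ H]
  [NormedAddCommGroup K] [InnerProductSpace ℂ K] [FiniteDimensional ℂ K]
  [NormedAddCommGroup L] [InnerProductSpace ℂ L] [FiniteDimensional ℂ L]
  [NormedAddCommGroup M] [InnerProductSpace ℂ M] [FiniteDimensional ℂ M]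

/-- The compression `f† A f` of an operator along an isometry `f`. -/
def compress (f : H →ₗᵢ[ℂ] K) (A : K →L[ℂ] K) : H →L[ℂ] H :=
  f.toContinuousLinearMap.adjoint ∘L A ∘L f.toContinuousLinearMap

lemma adjoint_comp_self (f : H →ₗᵢ[ℂ] K) :
    f.toContinuousLinearMap.adjoint ∘L f.toContinuousLinearMap = 1 := by
  ext x
  apply ext_inner_left ℂ
  intro y
  simp [ContinuousLinearMap.adjoint_inner_right]

lemma compress_eq_of_intertwines {f : H →ₗᵢ[ℂ] K} {A : K →L[ℂ] K} {B : H →L[ℂ] H}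
    (h : A ∘L f.toContinuousLinearMap = f.toContinuousLinearMap ∘L B) : compress f A = B := by
  rw [compress, h, ← ContinuousLinearMap.comp_assoc, adjoint_comp_self]
  ext; simp

lemma compress_comp (g : K →ₗᵢ[ℂ] L) (f : H →ₗᵢ[ℂ] K) (A : L →L[ℂ] L) :
    compress (g.comp f) A = compress f (compress g A) := by
  have h : (g.comp f).toContinuousLinearMap = g.toContinuousLinearMap ∘L f.toContinuousLinearMap :=
    rfl
  simp only [compress, h, ContinuousLinearMap.adjoint_comp, ContinuousLinearMap.comp_assoc]

lemma compress_mapL (f : H →ₗᵢ[ℂ] L) (g : K →ₗᵢ[ℂ] M) (A : L →L[ℂ] L) (B : M →L[ℂ] M) :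
    compress (TensorProduct.mapIsometry f g) (TensorProduct.mapL A B)
      = TensorProduct.mapL (compress f A) (compress g B) := by
  simp only [compress, TensorProduct.toContinuousLinearMap_mapIsometry, TensorProduct.adjoint_mapL,
    TensorProduct.mapL_comp]

lemma inner_compress (f : H →ₗᵢ[ℂ] K) (A : K →L[ℂ] K) (x y : H) :
    inner ℂ x (compress f A y) = inner ℂ (f x) (A (f y)) := by
  simp [compress, ContinuousLinearMap.adjoint_inner_right]

variable [Nontrivial H] [Nontrivial K] [Nontrivial L] [Nontrivial M]

lemma push_elem_compress (f : H →ₗᵢ[ℂ] K) (ω : State Γ H) (A : Γ → K →L[ℂ] K) (Λ : Finset Γ) :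
    (push f ω).1 (elem Λ A) = ω.1 (elem Λ fun v => compress f (A v)) := push_elem f ω A Λ

/-- A state over `H ⊗ K` is determined by its values on products `⊗ (A v ⊗ B v)`. -/
lemma State.ext_tensor {σ τ : State Γ (H ⊗[ℂ] K)}
    (h : ∀ (A : Γ → H →L[ℂ] H) (B : Γ → K →L[ℂ] K) Λ,
      σ.1 (elem Λ fun v => TensorProduct.mapL (A v) (B v))
        = τ.1 (elem Λ fun v => TensorProduct.mapL (A v) (B v))) : σ = τ := by
  refine State.ext_elem fun C Λ => ?_
  obtain ⟨c, A, B, hC⟩ := elem_tensor_expand Λ C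
  rw [hC, map_sum, map_sum]
  exact Finset.sum_congr rfl fun i _ => by rw [map_smul, map_smul, h]

lemma push_id (ω : State Γ H) : push LinearIsometry.id ω = ω := by
  refine State.ext_elem fun A Λ => ?_
  rw [push_elem_compress]
  congr 2
  funext v
  exact compress_eq_of_intertwines (by ext; simp)

lemma push_push (g : K →ₗᵢ[ℂ] L) (f : H →ₗᵢ[ℂ] K) (ω : State Γ H) :
    push g (push f ω) = push (g.comp f) ω := by
  refine State.ext_elem fun A Λ => ?_
  simp only [push_elem_compress, compress_comp]

lemma tens_push (f : H →ₗᵢ[ℂ] L) (g : K →ₗᵢ[ℂ] M) (ω : State Γ H) (τ : State Γ K) :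
    tens (push f ω) (push g τ) = push (TensorProduct.mapIsometry f g) (tens ω τ) := by
  refine State.ext_tensor fun A B Λ => ?_
  simp only [tens_elem, push_elem_compress, compress_mapL]

lemma State.eq_of_eq_sum {σ τ : State Γ H} {ι : Type*} [Fintype ι] {a : quasiLocal Γ H}
    {c : ι → ℂ} {b : ι → quasiLocal Γ H} (ha : a = ∑ i, c i • b i)
    (h : ∀ i, σ.1 (b i) = τ.1 (b i)) :
    σ.1 a = τ.1 a := by
  rw [ha, map_sum, map_sum]
  exact Finset.sum_congr rfl fun i _ => by rw [map_smul, map_smul, h]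

/-- Every operator on `K ⊗ L` is a linear combination of products from one fixed finite family. -/
lemma exists_mapL_spanning (K L : Type)
    [NormedAddCommGroup K] [InnerProductSpace ℂ K] [FiniteDimensional ℂ K]
    [NormedAddCommGroup L] [InnerProductSpace ℂ L] [FiniteDimensional ℂ L] :
    ∃ (ι : Type) (_ : Fintype ι) (B : ι → K →L[ℂ] K) (D : ι → L →L[ℂ] L),
      ∀ C : (K ⊗[ℂ] L) →L[ℂ] (K ⊗[ℂ] L), ∃ c : ι → ℂ,
        C = ∑ i, c i • TensorProduct.mapL (B i) (D i) := by
  let b₁ := stdOrthonormalBasis ℂ K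
  let b₂ := stdOrthonormalBasis ℂ L
  let b := b₁.tensorProduct b₂
  refine ⟨_, inferInstance, fun p : TensorIndex K L => unitOp (b₁ p.1.1) (b₁ p.2.1),
    fun p => unitOp (b₂ p.1.2) (b₂ p.2.2), fun C => ⟨fun p => inner ℂ (b p.1) (C (b p.2)), ?_⟩⟩
  refine (rankOne_decomp b C).trans (Finset.sum_congr rfl fun p _ => ?_)
  simp only [mapL_unitOp, b, OrthonormalBasis.tensorProduct_apply']

lemma compress_comm (A : H →L[ℂ] H) (B : K →L[ℂ] K) :
    compress (TensorProduct.commIsometry ℂ H K).toLinearIsometry (TensorProduct.mapL B A)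
      = TensorProduct.mapL A B :=
  compress_eq_of_intertwines (ContinuousLinearMap.coe_injective (TensorProduct.ext' fun _ _ => rfl))

lemma push_comm_tens (ω : State Γ H) (τ : State Γ K) :
    push (TensorProduct.commIsometry ℂ H K).toLinearIsometry (tens ω τ) = tens τ ω := by
  refine State.ext_tensor fun A B Λ => ?_
  rw [push_elem_compress, tens_elem, mul_comm, ← tens_elem]
  simp only [compress_comm]

lemma push_factorized (f : H →ₗᵢ[ℂ] K) (u : Γ → H) (hu : ∀ v, ‖u v‖ = 1) :
    push f (factorized u hu) = factorized (fun v => f (u v)) (fun v => by simp [hu]) := by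
  refine State.ext_elem fun A Λ => ?_
  simp only [push_elem_compress, factorized_elem, inner_compress]

lemma tens_factorized (u : Γ → H) (hu : ∀ v, ‖u v‖ = 1) (w : Γ → K) (hw : ∀ v, ‖w v‖ = 1) :
    tens (factorized u hu) (factorized w hw) = factorized (fun v => u v ⊗ₜ[ℂ] w v)
      (fun v => by simp [TensorProduct.norm_tmul, hu, hw]) := by
  refine State.ext_tensor fun A B Λ => ?_
  simp only [tens_elem, factorized_elem, ← Finset.prod_mul_distrib]
  rfl

/-- The isometry `x ↦ u ⊗ x` for a unit vector `u`. -/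
def tensorLeft (u : H) (hu : ‖u‖ = 1) : K →ₗᵢ[ℂ] H ⊗[ℂ] K where
  toLinearMap := TensorProduct.mk ℂ H K u
  norm_map' x := by simp [TensorProduct.norm_tmul, hu]

lemma push_tensorLeft (u : H) (hu : ‖u‖ = 1) (τ : State Γ K) :
    push (tensorLeft u hu) τ = tens (factorized (fun _ => u) fun _ => hu) τ := by
  refine State.ext_tensor fun A B Λ => ?_
  have h : ∀ v, compress (tensorLeft u hu) (TensorProduct.mapL (A v) (B v))
      = (inner ℂ u (A v u) : ℂ) • B v := by
    intro v
    ext y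
    apply ext_inner_left ℂ
    intro x
    rw [inner_compress, ContinuousLinearMap.smul_apply, inner_smul_right]
    rfl
  rw [push_elem_compress, tens_elem, factorized_elem]
  simp only [h]
  rw [← elemM_apply, MultilinearMap.map_smul_univ, elemM_apply, map_smul, smul_eq_mul,
    Finset.prod_coe_sort Λ (fun v => inner ℂ u (A v u))]

/-- The action of isometries on states is jointly continuous. -/
lemma continuous_push_path {T : Type*} [TopologicalSpace T] (f : T → H →ₗᵢ[ℂ] K)
    (hf : ∀ x, Continuous fun t => f t x) :
    Continuous fun p : T × State Γ H => push (f p.1) p.2 := by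
  refine State.continuous_of_elem fun A Λ => ?_
  simp only [push_elem_compress, state_expand (stdOrthonormalBasis ℂ H), inner_compress]
  refine continuous_finsetSum _ fun p _ => continuous_finsetSum _ fun q _ => Continuous.mul ?_ ?_
  · exact (WeakDual.eval_continuous _).comp (continuous_subtype_val.comp continuous_snd)
  · exact continuous_finsetProd _ fun v _ => Continuous.inner ((hf _).comp continuous_fst)
      ((A v.1).continuous.comp ((hf _).comp continuous_fst))

end StateCalculus

/-! ### Associativity of stacking -/

namespace FinHilb

/-- The associativity isometry of site Hilbert spaces. -/
def assoc (H K L : FinHilb) : (H.tensor K).tensor L →ₗᵢ[ℂ] H.tensor (K.tensor L) :=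
  (TensorProduct.assocIsometry ℂ H K L).toLinearIsometry

/-- The inverse of the associativity isometry. -/
def assocSymm (H K L : FinHilb) : H.tensor (K.tensor L) →ₗᵢ[ℂ] (H.tensor K).tensor L :=
  (TensorProduct.assocIsometry ℂ H K L).symm.toLinearIsometry

lemma assocSymm_comp_assoc (H K L : FinHilb) :
    (assocSymm H K L).comp (assoc H K L) = LinearIsometry.id :=
  LinearIsometry.ext fun x => (TensorProduct.assocIsometry ℂ H K L).symm_apply_apply x

/-- The operator `A ⊗ B` on the stacked site space. Like `State.stack` below, this is a name for an
existing notion with the types fixed to site Hilbert spaces, so that nested tensor products carry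
only one form of their inner product structure. -/
def tensorOp {H K : FinHilb} (A : H →L[ℂ] H) (B : K →L[ℂ] K) : H.tensor K →L[ℂ] H.tensor K :=
  TensorProduct.mapL A B

end FinHilb

section Associativity
variable {Γ : Type*} {H K L : FinHilb}
open FinHilb

/-- In an elementary tensor with entries `A v ⊗ C v`, the operators `C v` can be expanded into
products as well. -/
lemma elem_tensor_expand₃ (Λ : Finset Γ) (A : Γ → H →L[ℂ] H)
    (C : Γ → K.tensor L →L[ℂ] K.tensor L) :
    ∃ (ι : Type) (_ : Fintype ι) (c : (Λ → ι) → ℂ) (B : (Λ → ι) → Γ → K →L[ℂ] K)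
      (D : (Λ → ι) → Γ → L →L[ℂ] L),
      elem Λ (fun v => tensorOp (A v) (C v)) = ∑ i, c i • elem Λ fun v =>
        tensorOp (A v) (tensorOp (B i v) (D i v)) := by
  obtain ⟨ι, _, B, D, hBD⟩ := exists_mapL_spanning K L
  choose c hc using fun v => hBD (C v)
  have hC : (fun v => tensorOp (A v) (C v)) = fun v =>
      ∑ i, c v i • tensorOp (A v) (tensorOp (B i) (D i)) := by
    funext v
    refine ContinuousLinearMap.coe_injective (TensorProduct.ext' fun x y => ?_)
    have h : C v y = ∑ i, c v i • tensorOp (B i) (D i) y :=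
      (DFunLike.congr_fun (hc v) y).trans
        (by simp only [ContinuousLinearMap.sum_apply, ContinuousLinearMap.smul_apply]; rfl)
    change A v x ⊗ₜ[ℂ] C v y = _
    rw [h, TensorProduct.tmul_sum]
    simp only [ContinuousLinearMap.coe_coe, ContinuousLinearMap.sum_apply,
      ContinuousLinearMap.smul_apply, TensorProduct.tmul_smul]
    rfl
  refine ⟨ι, inferInstance, fun s => ∏ v : Λ, c v.1 (s v), fun s => extOne fun w => B (s w),
    fun s => extOne fun w => D (s w), ?_⟩
  refine (congrArg (elem Λ) hC).trans ((elem_expand Λ c fun v i =>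
    tensorOp (A v) (tensorOp (B i) (D i))).trans
      (Finset.sum_congr rfl fun s _ => congrArg _ (elem_congr fun v hv => ?_)))
  simp only [extOne, hv, dif_pos]

/-- A state over `H ⊗ (K ⊗ L)` is determined by its values on threefold products. -/
lemma State.ext_tensor₃ {σ τ : State Γ (H.tensor (K.tensor L))}
    (h : ∀ (A : Γ → H →L[ℂ] H) (B : Γ → K →L[ℂ] K) (D : Γ → L →L[ℂ] L) Λ,
      σ.1 (elem Λ fun v => tensorOp (A v) (tensorOp (B v) (D v)))
        = τ.1 (elem Λ fun v => tensorOp (A v) (tensorOp (B v) (D v)))) :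
    σ = τ :=
  State.ext_tensor (H := H) (K := K.tensor L) fun A C Λ =>
    (elem_tensor_expand₃ Λ A C).elim fun _ h₁ => h₁.elim fun _ h₂ => h₂.elim fun _ h₃ =>
      h₃.elim fun B h₄ => h₄.elim fun D hD => State.eq_of_eq_sum hD fun i => h A (B i) (D i) Λ

lemma compress_assoc (A : H →L[ℂ] H) (B : K →L[ℂ] K) (C : L →L[ℂ] L) :
    compress (assoc H K L) (tensorOp A (tensorOp B C)) = tensorOp (tensorOp A B) C :=
  compress_eq_of_intertwines (ContinuousLinearMap.coe_injective
    (TensorProduct.ext_threefold fun _ _ _ => rfl))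

/-- Stacking of states over site Hilbert spaces. -/
def State.stack (ω : State Γ H) (τ : State Γ K) : State Γ (H.tensor K) := tens ω τ

lemma State.stack_elem (ω : State Γ H) (τ : State Γ K) (A : Γ → H →L[ℂ] H) (B : Γ → K →L[ℂ] K)
    (Λ : Finset Γ) :
    (ω.stack τ).1 (elem Λ fun v => tensorOp (A v) (B v)) = ω.1 (elem Λ A) * τ.1 (elem Λ B) :=
  tens_elem ω τ A B Λ

/-- Stacking is associative. -/
lemma push_assoc_stack (ω : State Γ H) (τ : State Γ K) (σ : State Γ L) :
    push (assoc H K L) ((ω.stack τ).stack σ) = ω.stack (τ.stack σ) := by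
  refine State.ext_tensor₃ fun A B C Λ => ?_
  rw [push_elem_compress, State.stack_elem, State.stack_elem, ← mul_assoc, ← State.stack_elem ω τ,
    ← State.stack_elem]
  exact congrArg (fun T => ((ω.stack τ).stack σ).1 (elem Λ T))
    (funext fun v => compress_assoc (A v) (B v) (C v))

end Associativity

/-! ### Attaching a cell -/

section CellTopology
open Metric Topology
open scoped unitInterval

/-- The data of a space `X` obtained from a closed subspace `A` by attaching one `n`-cell. -/
structure CellAttachment (n : ℕ) (A X : Type*) [TopologicalSpace A] [TopologicalSpace X] where
  /-- The inclusion of the subspace. -/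
  incl : C(A, X)
  /-- The characteristic map of the cell. -/
  char : C(closedBall (0 : Fin n → ℝ) 1, X)
  /-- The attaching map. -/
  attach : C(sphere (0 : Fin n → ℝ) 1, A)
  isClosedEmbedding : IsClosedEmbedding incl
  char_sphere : ∀ s : sphere (0 : Fin n → ℝ) 1,
    char ⟨s, sphere_subset_closedBall s.2⟩ = incl (attach s)
  char_injOn : ∀ d d', ‖d.1‖ < 1 → ‖d'.1‖ < 1 → char d = char d' → d = d'
  char_ne : ∀ d y, ‖d.1‖ < 1 → char d ≠ incl y
  exhaust : ∀ x, (∃ y, incl y = x) ∨ ∃ d, char d = x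

/-- A map on the ball of radius one and a homotopy of its restriction to the sphere fit together to
a map on the ball of radius two. -/
lemma exists_collar_extension {E Z : Type*} [NormedAddCommGroup E] [NormedSpace ℝ E]
    [TopologicalSpace Z] (F : C(closedBall (0 : E) 1, Z)) (k : C(I × sphere (0 : E) 1, Z))
    (h : ∀ s : sphere (0 : E) 1, k (0, s) = F ⟨s, sphere_subset_closedBall s.2⟩) :
    ∃ R : C(closedBall (0 : E) 2, Z),
      (∀ (d : closedBall (0 : E) 1) (d' : closedBall (0 : E) 2), d'.1 = d.1 → R d' = F d) ∧
      ∀ (t : I) (s : sphere (0 : E) 1) (d' : closedBall (0 : E) 2),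
        d'.1 = (1 + t.1) • s.1 → R d' = k (t, s) := by
  let D := closedBall (0 : E) 2
  let P : Set D := {d | ‖d.1‖ ≤ 1}
  let N : Set D := {d | 1 ≤ ‖d.1‖}
  have hP : IsClosed P := isClosed_le (by fun_prop) continuous_const
  have hN : IsClosed N := isClosed_le continuous_const (by fun_prop)
  let fP : C(P, Z) := F.comp ⟨fun d => ⟨d.1.1, mem_closedBall_zero_iff.mpr d.2⟩, by fun_prop⟩
  have hne : ∀ d : N, ‖d.1.1‖ ≠ 0 := fun d => (lt_of_lt_of_le one_pos d.2).ne'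
  let fN : C(N, Z) := k.comp ⟨fun d => (⟨‖d.1.1‖ - 1, by
      have h1 : 1 ≤ ‖d.1.1‖ := d.2
      have h2 : ‖d.1.1‖ ≤ 2 := mem_closedBall_zero_iff.mp d.1.2
      constructor <;> linarith⟩, ⟨‖d.1.1‖⁻¹ • d.1.1, by
        rw [mem_sphere_zero_iff_norm, norm_smul, norm_inv, norm_norm, inv_mul_cancel₀ (hne d)]⟩), by
      refine Continuous.prodMk (Continuous.subtype_mk (by fun_prop) _)
        (Continuous.subtype_mk
          (Continuous.smul (Continuous.inv₀ (by fun_prop) hne) (by fun_prop)) _)⟩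
  have hagree : ∀ (d : D) (h₁ : d ∈ P) (h₂ : d ∈ N), fP ⟨d, h₁⟩ = fN ⟨d, h₂⟩ := by
    intro d h₁ h₂
    have h1 : ‖d.1‖ = 1 := le_antisymm h₁ h₂
    have h3 : fN ⟨d, h₂⟩ = k (0, ⟨d.1, mem_sphere_zero_iff_norm.mpr h1⟩) := by
      refine congrArg k (Prod.ext (Subtype.ext ?_) (Subtype.ext ?_))
      · simp [h1]
      · simp [h1]
    rw [h3, h]
    rfl
  let R : D → Z := fun d => if h : d ∈ P then fP ⟨d, h⟩ else
    fN ⟨d, show 1 ≤ ‖d.1‖ from (le_total _ _).resolve_left h⟩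
  have hRP : ∀ d : P, R d = fP d := fun d => dif_pos d.2
  have hRN : ∀ d : N, R d = fN d := by
    intro d
    by_cases hd : d.1 ∈ P
    · exact (dif_pos hd).trans (hagree _ hd d.2)
    · exact dif_neg hd
  have hR : Continuous R := by
    have h1 : ContinuousOn R P := continuousOn_iff_continuous_restrict.mpr
      (fP.continuous.congr fun d => (hRP d).symm)
    have h2 : ContinuousOn R N := continuousOn_iff_continuous_restrict.mpr
      (fN.continuous.congr fun d => (hRN d).symm)
    have h3 := h1.union_of_isClosed h2 hP hN
    rwa [show P ∪ N = Set.univ from Set.eq_univ_of_forall fun d => le_total ‖d.1‖ 1,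
      continuousOn_univ] at h3
  refine ⟨⟨R, hR⟩, fun d d' hd => ?_, fun t s d' hd => ?_⟩
  · have : d' ∈ P := by
      change ‖d'.1‖ ≤ 1
      rw [hd]; exact mem_closedBall_zero_iff.mp d.2
    refine (hRP ⟨d', this⟩).trans (congrArg F (Subtype.ext hd))
  · have hs : ‖s.1‖ = 1 := mem_sphere_zero_iff_norm.mp s.2
    have h0 : (0 : ℝ) < 1 + t.1 := by linarith [t.2.1]
    have hn : ‖d'.1‖ = 1 + t.1 := by rw [hd, norm_smul, hs, mul_one, Real.norm_of_nonneg h0.le]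
    have : d' ∈ N := by
      change 1 ≤ ‖d'.1‖
      linarith [t.2.1]
    refine (hRN ⟨d', this⟩).trans (congrArg k (Prod.ext (Subtype.ext ?_) (Subtype.ext ?_)))
    · change ‖d'.1‖ - 1 = t.1
      linarith
    · change ‖d'.1‖⁻¹ • d'.1 = s.1
      rw [hn, hd, smul_smul, inv_mul_cancel₀ h0.ne', one_smul]

namespace CellAttachment
variable {n : ℕ} {A X Z : Type*} [TopologicalSpace A] [TopologicalSpace X] [TopologicalSpace Z]
  [T2Space X] (c : CellAttachment n A X)

/-- Parametrized maps on the subspace and on the cell that agree on the sphere fit together. -/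
lemma glue_param {T : Type*} [TopologicalSpace T] [CompactSpace T] [T2Space T]
    (hA : C(T × A, Z)) (hD : C(T × closedBall (0 : Fin n → ℝ) 1, Z))
    (h : ∀ t (s : sphere (0 : Fin n → ℝ) 1),
      hA (t, c.attach s) = hD (t, ⟨s, sphere_subset_closedBall s.2⟩)) :
    ∃ k : C(T × X, Z), (∀ t y, k (t, c.incl y) = hA (t, y)) ∧
      ∀ t d, k (t, c.char d) = hD (t, d) := by
  let qA : C(T × A, T × X) := (ContinuousMap.id T).prodMap c.incl
  let qD : C(T × closedBall (0 : Fin n → ℝ) 1, T × X) := (ContinuousMap.id T).prodMap c.char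
  have hqA : IsClosedMap qA :=
    (isProperMap_id.prodMap c.isClosedEmbedding.isProperMap).isClosedMap
  have hqD : IsClosedMap qD := qD.continuous.isClosedMap
  let q : C((T × A) ⊕ (T × closedBall (0 : Fin n → ℝ) 1), T × X) :=
    ⟨Sum.elim qA qD, qA.continuous.sumElim qD.continuous⟩
  have hq : IsQuotientMap q := by
    refine IsClosedMap.isQuotientMap (hqA.sumElim hqD) q.continuous ?_
    rintro ⟨t, x⟩
    rcases c.exhaust x with ⟨y, rfl⟩ | ⟨d, rfl⟩
    · exact ⟨Sum.inl (t, y), rfl⟩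
    · exact ⟨Sum.inr (t, d), rfl⟩
  let f : C((T × A) ⊕ (T × closedBall (0 : Fin n → ℝ) 1), Z) :=
    ⟨Sum.elim hA hD, hA.continuous.sumElim hD.continuous⟩
  have hAA : ∀ y y', c.incl y = c.incl y' → y = y' := fun y y' => (c.isClosedEmbedding.injective ·)
  -- A point of the cell that is glued to another point lies on the sphere.
  have hDs : ∀ t d y, c.char d = c.incl y → hD (t, d) = hA (t, y) := by
    intro t d y hdy
    have hd : ‖d.1‖ = 1 := by
      refine le_antisymm (mem_closedBall_zero_iff.mp d.2) (not_lt.mp fun hlt => ?_)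
      exact c.char_ne d y hlt hdy
    have hs := c.char_sphere ⟨d.1, mem_sphere_zero_iff_norm.mpr hd⟩
    rw [← hAA _ _ (hs.symm.trans hdy), h]
  have hDD : ∀ t d d', c.char d = c.char d' → hD (t, d) = hD (t, d') := by
    intro t d d' hdd
    by_cases h1 : ‖d.1‖ < 1
    · by_cases h2 : ‖d'.1‖ < 1
      · rw [c.char_injOn d d' h1 h2 hdd]
      · have hd : ‖d'.1‖ = 1 := le_antisymm (mem_closedBall_zero_iff.mp d'.2) (not_lt.mp h2)
        have hs := c.char_sphere ⟨d'.1, mem_sphere_zero_iff_norm.mpr hd⟩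
        rw [hDs t d _ (hdd.trans hs), hDs t d' _ hs]
    · have hd : ‖d.1‖ = 1 := le_antisymm (mem_closedBall_zero_iff.mp d.2) (not_lt.mp h1)
      have hs := c.char_sphere ⟨d.1, mem_sphere_zero_iff_norm.mpr hd⟩
      rw [hDs t d _ hs, hDs t d' _ (hdd.symm.trans hs)]
  have hf : ∀ a b, q a = q b → f a = f b := by
    rintro (⟨t, y⟩ | ⟨t, d⟩) (⟨t', y'⟩ | ⟨t', d'⟩) hab <;>
      obtain ⟨rfl, hab⟩ : t = t' ∧ _ := Prod.ext_iff.mp hab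
    · exact congrArg (fun y => hA (t, y)) (hAA _ _ hab)
    · exact (hDs t d' y hab.symm).symm
    · exact hDs t d y' hab
    · exact hDD t d d' hab
  refine ⟨hq.lift f (fun a b => hf a b), fun t y => ?_, fun t d => ?_⟩
  · exact DFunLike.congr_fun (hq.lift_comp f fun a b => hf a b) (Sum.inl (t, y))
  · exact DFunLike.congr_fun (hq.lift_comp f fun a b => hf a b) (Sum.inr (t, d))

lemma glue (hA : C(A, Z)) (hD : C(closedBall (0 : Fin n → ℝ) 1, Z))
    (h : ∀ s : sphere (0 : Fin n → ℝ) 1,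
      hA (c.attach s) = hD ⟨s, sphere_subset_closedBall s.2⟩) :
    ∃ k : C(X, Z), k.comp c.incl = hA ∧ k.comp c.char = hD := by
  obtain ⟨k, h1, h2⟩ := c.glue_param (T := Unit) (hA.comp ContinuousMap.snd)
    (hD.comp ContinuousMap.snd) fun _ s => h s
  exact ⟨k.comp ((ContinuousMap.const X ()).prodMk (ContinuousMap.id X)),
    ContinuousMap.ext (h1 ()), ContinuousMap.ext (h2 ())⟩

/-- Homotopies on the subspace and on the cell that agree on the sphere fit together. -/
lemma exists_homotopy {f : C(X, Z)} {g : C(A, Z)} {g' : C(closedBall (0 : Fin n → ℝ) 1, Z)}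
    (kA : (f.comp c.incl).Homotopy g) (kD : (f.comp c.char).Homotopy g')
    (h : ∀ t (s : sphere (0 : Fin n → ℝ) 1),
      kA (t, c.attach s) = kD (t, ⟨s, sphere_subset_closedBall s.2⟩)) :
    ∃ f' : C(X, Z), f.Homotopic f' ∧ f'.comp c.incl = g ∧ f'.comp c.char = g' := by
  obtain ⟨k, h1, h2⟩ := c.glue_param kA.toContinuousMap kD.toContinuousMap h
  refine ⟨k.comp ((ContinuousMap.const X 1).prodMk (ContinuousMap.id X)),
    ⟨⟨k, fun x => ?_, fun x => rfl⟩⟩, ContinuousMap.ext fun y => ?_, ContinuousMap.ext fun d => ?_⟩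
  · rcases c.exhaust x with ⟨y, rfl⟩ | ⟨d, rfl⟩
    · exact (h1 0 y).trans (kA.apply_zero y)
    · exact (h2 0 d).trans (kD.apply_zero d)
  · exact (h1 1 y).trans (kA.apply_one y)
  · exact (h2 1 d).trans (kD.apply_one d)

/-- Maps that agree on the subspace are homotopic if their restrictions to the cell are homotopic
relative to the sphere. -/
lemma homotopic_of_homotopicRel {f f' : C(X, Z)} (hA : f.comp c.incl = f'.comp c.incl)
    (hD : (f.comp c.char).HomotopicRel (f'.comp c.char) {d | ‖d.1‖ = 1}) : f.Homotopic f' := by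
  obtain ⟨k⟩ := hD
  obtain ⟨f'', h1, h2, h3⟩ := c.exists_homotopy (f := f)
    ((ContinuousMap.Homotopy.refl _).cast rfl hA) k.toHomotopy (fun t s => by
      refine Eq.trans ?_ (k.eq_fst t (mem_sphere_zero_iff_norm.mp s.2)).symm
      exact congrArg f (c.char_sphere s).symm)
  have : f'' = f' := by
    ext x
    rcases c.exhaust x with ⟨y, rfl⟩ | ⟨d, rfl⟩
    · exact DFunLike.congr_fun h2 y
    · exact DFunLike.congr_fun h3 d
  exact this ▸ h1

/-- The homotopy extension property of the attachment of a cell. -/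
lemma homotopy_extension (f : C(X, Z)) {g : C(A, Z)} (h : (f.comp c.incl).Homotopic g) :
    ∃ f' : C(X, Z), f.Homotopic f' ∧ f'.comp c.incl = g := by
  obtain ⟨k⟩ := h
  obtain ⟨R, hR1, hR2⟩ := exists_collar_extension (f.comp c.char)
    (k.toContinuousMap.comp ((ContinuousMap.id I).prodMap c.attach)) (fun s => by
      refine (k.apply_zero _).trans ?_
      exact congrArg f (c.char_sphere s).symm)
  let S : C(I × closedBall (0 : Fin n → ℝ) 1, closedBall (0 : Fin n → ℝ) 2) :=
    ⟨fun p => ⟨(1 + p.1.1) • p.2.1, by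
      have h1 : ‖p.2.1‖ ≤ 1 := mem_closedBall_zero_iff.mp p.2.2
      have h2 := p.1.2.2
      have h3 := p.1.2.1
      rw [mem_closedBall_zero_iff, norm_smul, Real.norm_of_nonneg (by linarith)]
      nlinarith [norm_nonneg p.2.1]⟩, by fun_prop⟩
  obtain ⟨f', h1, h2, -⟩ := c.exists_homotopy (f := f) k
    (g' := (R.comp S).comp ((ContinuousMap.const _ 1).prodMk (ContinuousMap.id _)))
    ⟨R.comp S, fun d => hR1 _ _ (by simp [S]), fun d => rfl⟩
    (fun t s => (hR2 t s _ rfl).symm)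
  exact ⟨f', h1, h2⟩

/-- A map on the subspace extends over the cell if it is null-homotopic on the sphere. -/
lemma exists_extension (g : C(A, Z)) {z : Z}
    (h : (g.comp c.attach).Homotopic (ContinuousMap.const _ z)) :
    ∃ g' : C(X, Z), g'.comp c.incl = g := by
  obtain ⟨k⟩ := h.symm
  obtain ⟨R, -, hR⟩ := exists_collar_extension (ContinuousMap.const _ z) k.toContinuousMap
    fun s => k.apply_zero s
  let S : C(closedBall (0 : Fin n → ℝ) 1, closedBall (0 : Fin n → ℝ) 2) :=
    ⟨fun p => ⟨(2 : ℝ) • p.1, by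
      have h1 : ‖p.1‖ ≤ 1 := mem_closedBall_zero_iff.mp p.2
      rw [mem_closedBall_zero_iff, norm_smul, Real.norm_ofNat]
      linarith⟩, by fun_prop⟩
  obtain ⟨g', h1, -⟩ := c.glue g (R.comp S) fun s => by
    refine ((hR 1 s _ ?_).trans (k.apply_one s)).symm
    simp only [S, ContinuousMap.coe_mk, Set.Icc.coe_one]
    norm_num
  exact ⟨g', h1⟩

end CellAttachment
end CellTopology

/-! ### Stacking theories -/

section Swap
variable {K : Type} [NormedAddCommGroup K] [InnerProductSpace ℂ K]

/-- The rotation `(1 + e^{iπt})/2 + (1 - e^{iπt})/2 · S` from the identity to a self-adjoint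
unitary `S`. -/
def rotation (S : K ≃ₗᵢ[ℂ] K) (hS : ∀ x, S (S x) = x) (t : ℝ) : K →ₗᵢ[ℂ] K where
  toLinearMap := ((1 + Complex.exp (Real.pi * t * Complex.I)) / 2) • LinearMap.id
    + ((1 - Complex.exp (Real.pi * t * Complex.I)) / 2) • S.toLinearEquiv.toLinearMap
  norm_map' x := by
    set w := Complex.exp (Real.pi * t * Complex.I) with hw
    have hn : ‖w‖ = 1 := by
      rw [hw, show (Real.pi * t * Complex.I : ℂ) = ((Real.pi * t : ℝ) : ℂ) * Complex.I by
        push_cast; ring]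
      exact Complex.norm_exp_ofReal_mul_I _
    -- `x = y + z` with `S y = y` and `S z = -z` orthogonal, and `z` is multiplied by a phase.
    obtain ⟨y, hy⟩ : ∃ y, y = (1 / 2 : ℂ) • (x + S x) := ⟨_, rfl⟩
    obtain ⟨z, hz⟩ : ∃ z, z = (1 / 2 : ℂ) • (x - S x) := ⟨_, rfl⟩
    have hSy : S y = y := by simp [hy, hS, add_comm]
    have hSz : S z = -z := by simp only [hz, map_smul, map_sub, hS, ← smul_neg, neg_sub]
    have hyz : inner ℂ y z = 0 := by
      have h := S.inner_map_map y z
      rw [hSy, hSz, inner_neg_right] at h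
      have h2 : (2 : ℂ) * inner ℂ y z = 0 := by linear_combination -h
      simpa using h2
    have hx : x = y + z := by simp only [hy, hz, ← smul_add]; module
    have hU : ((1 + w) / 2) • x + ((1 - w) / 2) • S x = y + w • z := by
      simp only [hy, hz]; module
    change ‖((1 + w) / 2) • x + ((1 - w) / 2) • S x‖ = ‖x‖
    rw [hU, hx]
    have e1 := norm_add_sq_eq_norm_sq_add_norm_sq_of_inner_eq_zero y z hyz
    have e2 := norm_add_sq_eq_norm_sq_add_norm_sq_of_inner_eq_zero y (w • z)
      (by rw [inner_smul_right, hyz, mul_zero])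
    rw [norm_smul, hn, one_mul, ← e1] at e2
    exact (mul_self_inj (norm_nonneg _) (norm_nonneg _)).mp e2

variable (S : K ≃ₗᵢ[ℂ] K) (hS : ∀ x, S (S x) = x)

lemma rotation_apply (t : ℝ) (x : K) :
    rotation S hS t x = ((1 + Complex.exp (Real.pi * t * Complex.I)) / 2) • x
      + ((1 - Complex.exp (Real.pi * t * Complex.I)) / 2) • S x := rfl

lemma rotation_zero : rotation S hS 0 = LinearIsometry.id := by
  ext x; simp [rotation_apply]

lemma rotation_one : rotation S hS 1 = S.toLinearIsometry := by
  ext x; simp [rotation_apply, Complex.exp_pi_mul_I]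

lemma rotation_apply_of_fixed (t : ℝ) {x : K} (hx : S x = x) : rotation S hS t x = x := by
  rw [rotation_apply, hx, ← add_smul]
  convert one_smul ℂ x using 2
  ring

lemma continuous_rotation (x : K) : Continuous fun t => rotation S hS t x := by
  simp only [rotation_apply]
  fun_prop

end Swap

/-- A site Hilbert space with a distinguished unit vector. -/
structure PointedSpace where
  space : FinHilb
  vec : space
  norm_vec : ‖vec‖ = 1

namespace PointedSpace

/-- Stacking of pointed site spaces. -/
def tensor (P R : PointedSpace) : PointedSpace where
  space := P.space.tensor R.space
  vec := P.vec ⊗ₜ[ℂ] R.vec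
  norm_vec := by rw [TensorProduct.norm_tmul, P.norm_vec, R.norm_vec, one_mul]

end PointedSpace

namespace FinHilb

/-- The isometry `x ↦ u ⊗ x` of site Hilbert spaces. -/
def insertLeft {H : FinHilb} (u : H) (hu : ‖u‖ = 1) (K : FinHilb) : K →ₗᵢ[ℂ] H.tensor K :=
  tensorLeft u hu

/-- The flip `H ⊗ K → K ⊗ H`. -/
def comm (H K : FinHilb) : H.tensor K →ₗᵢ[ℂ] K.tensor H :=
  (TensorProduct.commIsometry ℂ H K).toLinearIsometry

/-- Stacking of isometries. -/
def mapTensor {H K H' K' : FinHilb} (f : H →ₗᵢ[ℂ] H') (g : K →ₗᵢ[ℂ] K') :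
    H.tensor K →ₗᵢ[ℂ] H'.tensor K' := TensorProduct.mapIsometry f g

end FinHilb

open FinHilb in
/-- The formal properties of a quantum state type: a functor from site Hilbert spaces and isometries
to spaces, with a stacking operation that is associative and commutative up to the corresponding
isometries, product states, and continuity in the isometry. Everything homotopical below depends on
these properties only. -/
structure StackingTheory where
  obj : FinHilb → Type*
  [top : ∀ H, TopologicalSpace (obj H)]
  map : ∀ {H K : FinHilb}, (H →ₗᵢ[ℂ] K) → C(obj H, obj K)
  stack : ∀ {H K : FinHilb}, C(obj H × obj K, obj (H.tensor K))
  product : ∀ {H : FinHilb} (u : H), ‖u‖ = 1 → obj H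
  t1 : ∀ H, T1Space (obj H)
  isClosedEmbedding : ∀ {H K : FinHilb} (f : H →ₗᵢ[ℂ] K), Topology.IsClosedEmbedding (map f)
  map_id : ∀ {H : FinHilb} (ω : obj H), map LinearIsometry.id ω = ω
  map_map : ∀ {H K L : FinHilb} (g : K →ₗᵢ[ℂ] L) (f : H →ₗᵢ[ℂ] K) (ω : obj H),
    map g (map f ω) = map (g.comp f) ω
  stack_map : ∀ {H K H' K' : FinHilb} (f : H →ₗᵢ[ℂ] H') (g : K →ₗᵢ[ℂ] K') (ω : obj H) (τ : obj K),
    stack (map f ω, map g τ) = map (mapTensor f g) (stack (ω, τ))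
  map_comm_stack : ∀ {H K : FinHilb} (ω : obj H) (τ : obj K),
    map (comm H K) (stack (ω, τ)) = stack (τ, ω)
  map_assoc_stack : ∀ {H K L : FinHilb} (ω : obj H) (τ : obj K) (σ : obj L),
    map (assoc H K L) (stack (stack (ω, τ), σ)) = stack (ω, stack (τ, σ))
  map_product : ∀ {H K : FinHilb} (f : H →ₗᵢ[ℂ] K) (u : H) (hu : ‖u‖ = 1),
    map f (product u hu) = product (f u) ((f.norm_map u).trans hu)
  stack_product : ∀ {H K : FinHilb} (u : H) (hu : ‖u‖ = 1) (w : K) (hw : ‖w‖ = 1),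
    stack (product u hu, product w hw) = product (H := H.tensor K) (u ⊗ₜ[ℂ] w)
      ((TensorProduct.norm_tmul (𝕜 := ℂ) u w).trans (by rw [hu, hw, one_mul]))
  map_insertLeft : ∀ {H K : FinHilb} (u : H) (hu : ‖u‖ = 1) (τ : obj K),
    map (insertLeft u hu K) τ = stack (product u hu, τ)
  continuous_map_path : ∀ {H K : FinHilb} (f : ℝ → H →ₗᵢ[ℂ] K), (∀ x, Continuous fun t => f t x) →
    Continuous fun p : ℝ × obj H => map (f p.1) p.2

attribute [instance] StackingTheory.top StackingTheory.t1

-- The two sides carry the inner product space structure of a threefold tensor product in different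
-- but definitionally equal forms, which is slow to check.
set_option maxHeartbeats 1000000 in
open FinHilb in
lemma QuantumStateType.map_assoc_stack {Γ : Type*} (Q : QuantumStateType Γ) {H K L : FinHilb}
    (ω : Q.obj H) (τ : Q.obj K) (σ : Q.obj L) :
    Q.map (assoc H K L) (Q.stack (Q.stack (ω, τ), σ)) = Q.stack (ω, Q.stack (τ, σ)) :=
  Subtype.ext (push_assoc_stack ω.1 τ.1 σ.1)

/-- The stacking theory of a quantum state type. -/
def QuantumStateType.theory {Γ : Type*} (Q : QuantumStateType Γ) : StackingTheory where
  obj := fun H => Q.obj H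
  top := fun _ => inferInstance
  map := Q.map
  stack := Q.stack
  product := Q.product
  t1 := fun _ => inferInstance
  isClosedEmbedding := Q.isClosedEmbedding
  map_id ω := Subtype.ext (push_id ω.1)
  map_map g f ω := Subtype.ext (push_push g f ω.1)
  stack_map f g ω τ := Subtype.ext (tens_push f g ω.1 τ.1)
  map_comm_stack ω τ := Subtype.ext (push_comm_tens ω.1 τ.1)
  map_assoc_stack ω τ σ := Q.map_assoc_stack ω τ σ
  map_product f u hu := Subtype.ext (push_factorized f (fun _ => u) fun _ => hu)
  stack_product u hu w hw :=
    Subtype.ext (tens_factorized (fun _ => u) (fun _ => hu) (fun _ => w) fun _ => hw)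
  map_insertLeft u hu τ := Subtype.ext (push_tensorLeft u hu τ.1)
  continuous_map_path f hf := ((continuous_push_path f hf).comp
    (continuous_fst.prodMk (continuous_subtype_val.comp continuous_snd))).subtype_mk _

/-! ### Families of states and the reflection argument -/

namespace StackingTheory
open FinHilb Metric
open scoped unitInterval

variable (T : StackingTheory)

/-- The product state of the distinguished vector. -/
def base (P : PointedSpace) : T.obj P.space := T.product P.vec P.norm_vec

lemma product_congr {H : FinHilb} {u w : H} (h : u = w) (hu : ‖u‖ = 1) (hw : ‖w‖ = 1) :
    T.product u hu = T.product w hw := by subst h; rfl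

lemma map_base {P R : PointedSpace} (f : P.space →ₗᵢ[ℂ] R.space) (h : f P.vec = R.vec) :
    T.map f (T.base P) = T.base R :=
  (T.map_product f P.vec P.norm_vec).trans (T.product_congr h _ _)

lemma stack_base (P R : PointedSpace) : T.stack (T.base P, T.base R) = T.base (P.tensor R) :=
  T.stack_product _ _ _ _

lemma map_assocSymm_stack {H K L : FinHilb} (ω : T.obj H) (τ : T.obj K) (κ : T.obj L) :
    T.map (assocSymm H K L) (T.stack (ω, T.stack (τ, κ))) = T.stack (T.stack (ω, τ), κ) := by
  rw [← map_assoc_stack, map_map, assocSymm_comp_assoc, map_id]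

lemma comm_comm {K : FinHilb} (x : K.tensor K) :
    (TensorProduct.commIsometry ℂ K K) ((TensorProduct.commIsometry ℂ K K) x) = x :=
  TensorProduct.comm_comm ℂ K K x

/-- The path of isometries of `K ⊗ K` from the identity to the flip. -/
def flipPath (K : FinHilb) (t : ℝ) : K.tensor K →ₗᵢ[ℂ] K.tensor K :=
  rotation (TensorProduct.commIsometry ℂ K K) comm_comm t

lemma flipPath_zero (K : FinHilb) : flipPath K 0 = LinearIsometry.id := rotation_zero _ _

lemma flipPath_one (K : FinHilb) : flipPath K 1 = comm K K := rotation_one _ _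

lemma flipPath_base (P : PointedSpace) (t : ℝ) :
    T.map (flipPath P.space t) (T.stack (T.base P, T.base P)) = T.stack (T.base P, T.base P) := by
  rw [stack_base]
  exact T.map_base (P := P.tensor P) (R := P.tensor P) (flipPath P.space t)
    (rotation_apply_of_fixed (TensorProduct.commIsometry ℂ P.space P.space) comm_comm t rfl)

lemma continuous_map_flipPath (K : FinHilb) :
    Continuous fun p : ℝ × T.obj (K.tensor K) => T.map (flipPath K p.1) p.2 :=
  T.continuous_map_path (flipPath K) (continuous_rotation _ _)

section Maps
variable {X Y : Type*} [TopologicalSpace X] [TopologicalSpace Y]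

/-- Pointwise stacking of families of states. -/
def stackMap {H K : FinHilb} (f : C(X, T.obj H)) (g : C(X, T.obj K)) : C(X, T.obj (H.tensor K)) :=
  T.stack.comp (f.prodMk g)

variable {T} in
lemma homotopic_stackMap {H K : FinHilb} {f f' : C(X, T.obj H)} {g g' : C(X, T.obj K)}
    (hf : f.Homotopic f') (hg : g.Homotopic g') :
    (T.stackMap f g).Homotopic (T.stackMap f' g') :=
  (ContinuousMap.Homotopic.refl T.stack).comp (hf.prodMk hg)

lemma homotopic_const {Z : Type*} [TopologicalSpace Z] {z z' : Z} (h : Joined z z') :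
    (ContinuousMap.const X z).Homotopic (ContinuousMap.const X z') := by
  obtain ⟨p⟩ := h
  exact ⟨⟨p.toContinuousMap.comp ContinuousMap.fst, fun x => p.source, fun x => p.target⟩⟩

lemma joined_map {Z W : Type*} [TopologicalSpace Z] [TopologicalSpace W] (f : C(Z, W)) {z z' : Z}
    (h : Joined z z') : Joined (f z) (f z') := ⟨h.somePath.map f.continuous⟩

/-- Every family of states over `X` on a site space of the class `𝒞` can be stacked with another one
so that the result is homotopic to the constant family at the trivial product state. -/
def HasInverses (𝒞 : Set PointedSpace) (X : Type*) [TopologicalSpace X] : Prop :=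
  ∀ P ∈ 𝒞, ∀ f : C(X, T.obj P.space), ∃ R ∈ 𝒞, ∃ g : C(X, T.obj R.space),
    (T.stackMap f g).Homotopic (ContinuousMap.const X (T.base (P.tensor R)))

/-- Every single state on a site space of the class `𝒞` has an inverse up to a path. -/
def HasPointInverses (𝒞 : Set PointedSpace) : Prop :=
  ∀ P ∈ 𝒞, ∀ ω : T.obj P.space, ∃ R ∈ 𝒞, ∃ τ : T.obj R.space,
    Joined (T.stack (ω, τ)) (T.base (P.tensor R))

variable {T} {𝒞 : Set PointedSpace}

lemma HasInverses.of_retract (h : T.HasInverses 𝒞 Y) (i : C(X, Y)) (r : C(Y, X))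
    (hri : (r.comp i).Homotopic (ContinuousMap.id X)) : T.HasInverses 𝒞 X := by
  intro P hP f
  obtain ⟨R, hR, g, hg⟩ := h P hP (f.comp r)
  refine ⟨R, hR, g.comp i, ?_⟩
  have h1 : f.Homotopic ((f.comp r).comp i) :=
    ((ContinuousMap.Homotopic.refl f).comp hri).symm
  exact (homotopic_stackMap h1 (.refl _)).trans (hg.comp (.refl i))

lemma HasInverses.of_isEmpty [IsEmpty X] {P : PointedSpace} (hP : P ∈ 𝒞) : T.HasInverses 𝒞 X := by
  intro P' _ f
  refine ⟨P, hP, ContinuousMap.const X (T.base P), ?_⟩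
  have : T.stackMap f (ContinuousMap.const X (T.base P))
      = ContinuousMap.const X (T.base (P'.tensor P)) := ContinuousMap.ext isEmptyElim
  exact this ▸ .refl _

end Maps

section Reflection
variable {n : ℕ} (i : Fin n)

/-- Replace the coordinate `i` of a point of the cube by `x`, cut off to the interval `[-1, 1]`. -/
def setCoord (p : ℝ × closedBall (0 : Fin n → ℝ) 1) : closedBall (0 : Fin n → ℝ) 1 :=
  ⟨Function.update p.2.1 i (Set.projIcc (-1 : ℝ) 1 (by norm_num) p.1), by
    rw [mem_closedBall_zero_iff, pi_norm_le_iff_of_nonneg zero_le_one]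
    intro j
    by_cases hj : j = i
    · subst hj
      rw [Function.update_self, Real.norm_eq_abs, abs_le]
      exact (Set.projIcc (-1 : ℝ) 1 (by norm_num) p.1).2
    · rw [Function.update_of_ne hj]
      exact (norm_le_pi_norm p.2.1 j).trans (mem_closedBall_zero_iff.mp p.2.2)⟩

lemma continuous_setCoord : Continuous (setCoord i) := by
  refine Continuous.subtype_mk (Continuous.update (by fun_prop) i ?_) _
  exact continuous_subtype_val.comp (continuous_projIcc.comp continuous_fst)

lemma abs_coord_le (d : closedBall (0 : Fin n → ℝ) 1) : |d.1 i| ≤ 1 :=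
  (norm_le_pi_norm d.1 i).trans (mem_closedBall_zero_iff.mp d.2)

lemma continuous_coordinate : Continuous fun d : closedBall (0 : Fin n → ℝ) 1 => d.1 i :=
  (continuous_apply i).comp continuous_subtype_val

lemma setCoord_self (d : closedBall (0 : Fin n → ℝ) 1) : setCoord i (d.1 i, d) = d := by
  refine Subtype.ext ?_
  change Function.update d.1 i _ = d.1
  rw [Set.projIcc_of_mem _ (abs_le.mp (abs_coord_le i d)), Function.update_eq_self]

lemma norm_eq_one_of_coord {j : Fin n} {d : closedBall (0 : Fin n → ℝ) 1} (hj : |d.1 j| = 1) :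
    ‖d.1‖ = 1 := by
  exact le_antisymm (mem_closedBall_zero_iff.mp d.2) (hj.symm.le.trans (norm_le_pi_norm d.1 j))

lemma norm_setCoord_of_one_le {x : ℝ} (hx : 1 ≤ x) (d : closedBall (0 : Fin n → ℝ) 1) :
    ‖(setCoord i (x, d)).1‖ = 1 := by
  refine norm_eq_one_of_coord (j := i) ?_
  change |Function.update d.1 i _ i| = 1
  rw [Function.update_self, Set.projIcc_of_right_le _ hx]
  norm_num

lemma norm_setCoord_of_le_neg_one {x : ℝ} (hx : x ≤ -1) (d : closedBall (0 : Fin n → ℝ) 1) :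
    ‖(setCoord i (x, d)).1‖ = 1 := by
  refine norm_eq_one_of_coord (j := i) ?_
  change |Function.update d.1 i _ i| = 1
  rw [Function.update_self, Set.projIcc_of_le_left _ hx]
  norm_num

/-- A point of the boundary of the cube stays on the boundary when its coordinate `i` is changed,
unless it lies on one of the two faces orthogonal to this coordinate. -/
lemma norm_setCoord_of_norm {d : closedBall (0 : Fin n → ℝ) 1} (hd : ‖d.1‖ = 1)
    (hi : |d.1 i| ≠ 1) (x : ℝ) : ‖(setCoord i (x, d)).1‖ = 1 := by
  obtain ⟨j, hj⟩ : ∃ j, |d.1 j| = 1 := by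
    by_contra! h
    have : ‖d.1‖ < 1 := (pi_norm_lt_iff one_pos).mpr fun j =>
      lt_of_le_of_ne (abs_coord_le j d) (h j)
    exact this.ne hd
  have hji : j ≠ i := by rintro rfl; exact hi hj
  refine norm_eq_one_of_coord (j := j) ?_
  change |Function.update d.1 i _ j| = 1
  rwa [Function.update_of_ne hji]

variable {T} {P : PointedSpace} (α : C(closedBall (0 : Fin n → ℝ) 1, T.obj P.space))

/-- The family of states used for all homotopies of the reflection argument: the coordinate `i` is
set to `a` in the first factor and to `b` in the second one, and the two factors are rotated into
each other by the time `τ`. -/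
def rotated (a b τ : ℝ) (d : closedBall (0 : Fin n → ℝ) 1) : T.obj (P.space.tensor P.space) :=
  T.map (flipPath P.space τ) (T.stack (α (setCoord i (a, d)), α (setCoord i (b, d))))

lemma continuous_rotated {Y : Type*} [TopologicalSpace Y] {a b τ : Y → ℝ}
    {d : Y → closedBall (0 : Fin n → ℝ) 1} (ha : Continuous a) (hb : Continuous b)
    (hτ : Continuous τ) (hd : Continuous d) :
    Continuous fun y => rotated i α (a y) (b y) (τ y) (d y) := by
  have h := continuous_setCoord i
  have h1 : Continuous fun y => T.stack (α (setCoord i (a y, d y)), α (setCoord i (b y, d y))) :=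
    T.stack.continuous.comp ((α.continuous.comp (h.comp (ha.prodMk hd))).prodMk
      (α.continuous.comp (h.comp (hb.prodMk hd))))
  exact Continuous.comp (g := fun p : ℝ × T.obj (P.space.tensor P.space) =>
    T.map (flipPath P.space p.1) p.2) (f := fun y =>
      (τ y, T.stack (α (setCoord i (a y, d y)), α (setCoord i (b y, d y)))))
    (T.continuous_map_flipPath P.space) (hτ.prodMk h1)

variable {α}

lemma rotated_eq_base (hα : ∀ d, ‖d.1‖ = 1 → α d = T.base P) {a b : ℝ} (τ : ℝ)
    {d : closedBall (0 : Fin n → ℝ) 1} (ha : ‖(setCoord i (a, d)).1‖ = 1)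
    (hb : ‖(setCoord i (b, d)).1‖ = 1) :
    rotated i α a b τ d = T.base (P.tensor P) := by
  have h : T.stack (α (setCoord i (a, d)), α (setCoord i (b, d))) = T.stack (T.base P, T.base P) :=
    congrArg T.stack (Prod.ext (hα _ ha) (hα _ hb))
  exact (congrArg (T.map (flipPath P.space τ)) h).trans
    ((T.flipPath_base P τ).trans (T.stack_base P P))

/-- A deformation of the parameters that keeps the two faces of the cube fixed is a homotopy
relative to the boundary of the cube. -/
lemma homotopicRel_of_rotated (hα : ∀ d, ‖d.1‖ = 1 → α d = T.base P) (a b τ : ℝ → ℝ → ℝ)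
    (ha : Continuous fun p : ℝ × ℝ => a p.1 p.2) (hb : Continuous fun p : ℝ × ℝ => b p.1 p.2)
    (hτ : Continuous fun p : ℝ × ℝ => τ p.1 p.2)
    (ha' : ∀ t s, 0 ≤ t → t ≤ 1 → |s| = 1 → 1 ≤ a t s ∨ a t s ≤ -1)
    (hb' : ∀ t s, 0 ≤ t → t ≤ 1 → |s| = 1 → 1 ≤ b t s ∨ b t s ≤ -1)
    {f₀ f₁ : C(closedBall (0 : Fin n → ℝ) 1, T.obj (P.space.tensor P.space))}
    (h₀ : ∀ d, rotated i α (a 0 (d.1 i)) (b 0 (d.1 i)) (τ 0 (d.1 i)) d = f₀ d)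
    (h₁ : ∀ d, rotated i α (a 1 (d.1 i)) (b 1 (d.1 i)) (τ 1 (d.1 i)) d = f₁ d) :
    f₀.HomotopicRel f₁ {d | ‖d.1‖ = 1} := by
  have hc : Continuous fun p : I × closedBall (0 : Fin n → ℝ) 1 => ((p.1.1, p.2.1 i) : ℝ × ℝ) :=
    (continuous_subtype_val.comp continuous_fst).prodMk
      ((continuous_coordinate i).comp continuous_snd)
  have hface : ∀ (c : ℝ → ℝ → ℝ), (∀ t s, 0 ≤ t → t ≤ 1 → |s| = 1 → 1 ≤ c t s ∨ c t s ≤ -1) →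
      ∀ (t : I) (d : closedBall (0 : Fin n → ℝ) 1), ‖d.1‖ = 1 →
        ‖(setCoord i (c t (d.1 i), d)).1‖ = 1 := by
    intro c hc t d hd
    by_cases hi : |d.1 i| = 1
    · rcases hc t _ t.2.1 t.2.2 hi with h | h
      · exact norm_setCoord_of_one_le i h d
      · exact norm_setCoord_of_le_neg_one i h d
    · exact norm_setCoord_of_norm i hd hi _
  have hbase : ∀ (t : I) (d : closedBall (0 : Fin n → ℝ) 1), ‖d.1‖ = 1 →
      rotated i α (a t (d.1 i)) (b t (d.1 i)) (τ t (d.1 i)) d = T.base (P.tensor P) :=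
    fun t d hd => rotated_eq_base i hα _ (hface a ha' t d hd) (hface b hb' t d hd)
  refine ⟨⟨⟨⟨fun p => rotated i α (a p.1 (p.2.1 i)) (b p.1 (p.2.1 i)) (τ p.1 (p.2.1 i)) p.2,
    continuous_rotated i α (ha.comp hc) (hb.comp hc) (hτ.comp hc) continuous_snd⟩, h₀, h₁⟩, ?_⟩⟩
  intro t d hd
  exact (hbase t d hd).trans ((hbase 0 d hd).symm.trans (h₀ d))

/-- In a family over the cube that is trivial on the boundary, reflecting one coordinate yields an
inverse. The pair of states at the coordinates `s` and `-s` is first moved along the boundary of the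
square so that one of the two factors is always trivial; then the half on which the first factor is
trivial is rotated so that the second one is; then the remaining loop is traced back. -/
lemma stackMap_reflection_homotopicRel (hα : ∀ d, ‖d.1‖ = 1 → α d = T.base P) :
    (T.stackMap α (α.comp ⟨fun d => setCoord i (-d.1 i, d),
      (continuous_setCoord i).comp
        ((continuous_coordinate i).neg.prodMk continuous_id)⟩)).HomotopicRel
      (ContinuousMap.const _ (T.base (P.tensor P))) {d | ‖d.1‖ = 1} := by
  let ρ : ℝ → ℝ := fun s => min (max ((3 * s + 1) / 2) 0) 1
  have hρc : Continuous ρ := by fun_prop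
  have hc := continuous_coordinate i
  have h₁ : Continuous fun s : ℝ => 3 * s + 2 := by fun_prop
  have h₂ : Continuous fun s : ℝ => 2 - 3 * s := by fun_prop
  let F₁ : C(closedBall (0 : Fin n → ℝ) 1, T.obj (P.space.tensor P.space)) :=
    ⟨fun d => rotated i α (3 * d.1 i + 2) (2 - 3 * d.1 i) 0 d,
      continuous_rotated i α (h₁.comp hc) (h₂.comp hc) continuous_const continuous_id⟩
  let F₂ : C(closedBall (0 : Fin n → ℝ) 1, T.obj (P.space.tensor P.space)) :=
    ⟨fun d => rotated i α (3 * d.1 i + 2) (2 - 3 * d.1 i) (ρ (d.1 i)) d,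
      continuous_rotated i α (h₁.comp hc) (h₂.comp hc) (hρc.comp hc) continuous_id⟩
  have hs : ∀ {s : ℝ}, |s| = 1 → s = 1 ∨ s = -1 := fun h => (abs_eq zero_le_one).mp h
  -- The parameters `(s, -s)` move linearly to `(3 s + 2, 2 - 3 s)`, which after truncation to
  -- `[-1, 1]` runs along two sides of the square: one of the entries is always `1`.
  have H₁ : (T.stackMap α (α.comp ⟨fun d => setCoord i (-d.1 i, d),
      (continuous_setCoord i).comp
        ((continuous_coordinate i).neg.prodMk continuous_id)⟩)).HomotopicRel F₁ {d | ‖d.1‖ = 1} := by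
    refine homotopicRel_of_rotated i hα (fun t s => s + t * (2 * s + 2))
      (fun t s => -s + t * (2 - 2 * s)) (fun _ _ => 0) (by fun_prop) (by fun_prop) (by fun_prop)
      ?_ ?_ ?_ ?_
    · intro t s h0 h1 h
      rcases hs h with rfl | rfl
      · left; linarith
      · right; linarith
    · intro t s h0 h1 h
      rcases hs h with rfl | rfl
      · right; linarith
      · left; linarith
    · intro d
      simp only [rotated, zero_mul, add_zero, setCoord_self, flipPath_zero]
      exact T.map_id (H := P.space.tensor P.space) _
    · intro d
      change _ = rotated i α (3 * d.1 i + 2) (2 - 3 * d.1 i) 0 d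
      congr 1 <;> ring
  -- The time `ρ s` of the rotation is `0` for `s ≤ -1/3` and `1` for `1/3 ≤ s`; in between both
  -- factors are trivial.
  have H₂ : F₁.HomotopicRel F₂ {d | ‖d.1‖ = 1} := by
    refine homotopicRel_of_rotated i hα (fun _ s => 3 * s + 2) (fun _ s => 2 - 3 * s)
      (fun t s => t * ρ s) (by fun_prop) (by fun_prop) (by fun_prop) ?_ ?_ ?_ ?_
    · intro t s h0 h1 h
      rcases hs h with rfl | rfl
      · left; norm_num
      · right; norm_num
    · intro t s h0 h1 h
      rcases hs h with rfl | rfl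
      · right; norm_num
      · left; norm_num
    · intro d; simp only [zero_mul]; rfl
    · intro d; simp only [one_mul]; rfl
  -- After the rotation the second factor is trivial everywhere.
  have h₂₃ : ∀ d : closedBall (0 : Fin n → ℝ) 1,
      rotated i α (min (3 * d.1 i + 2) (2 - 3 * d.1 i)) 1 0 d = F₂ d := by
    intro d
    change _ = rotated i α (3 * d.1 i + 2) (2 - 3 * d.1 i) (ρ (d.1 i)) d
    have hone : α (setCoord i (1, d)) = T.base P := hα _ (norm_setCoord_of_one_le i le_rfl d)
    rcases le_total (d.1 i) (-1 / 3) with h | h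
    · have hρ : ρ (d.1 i) = 0 := by
        simp only [ρ]
        rw [max_eq_right (by linarith), min_eq_left zero_le_one]
      rw [hρ, min_eq_left (a := 3 * d.1 i + 2) (by linarith), rotated, rotated, hone,
        hα _ (norm_setCoord_of_one_le i (x := 2 - 3 * d.1 i) (by linarith) d)]
    · have ha := norm_setCoord_of_one_le i (x := 3 * d.1 i + 2) (by linarith) d
      rcases le_total (d.1 i) (1 / 3) with h' | h'
      · rw [rotated_eq_base i hα _ ha
          (norm_setCoord_of_one_le i (x := 2 - 3 * d.1 i) (by linarith) d)]
        exact rotated_eq_base i hα _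
          (norm_setCoord_of_one_le i (le_min (by linarith) (by linarith)) d)
          (norm_setCoord_of_one_le i le_rfl d)
      · have hρ : ρ (d.1 i) = 1 := by
          simp only [ρ]
          rw [max_eq_left (by linarith), min_eq_right (by linarith)]
        rw [hρ, min_eq_right (b := 2 - 3 * d.1 i) (by linarith), rotated, rotated, hone,
          hα _ ha, flipPath_one, map_comm_stack, flipPath_zero, map_id]
  -- The remaining first entry is bounded from above by a number that decreases from `5`, where it
  -- has no effect, to `-1`, where the state is trivial.
  have H₃ : F₂.HomotopicRel (ContinuousMap.const _ (T.base (P.tensor P))) {d | ‖d.1‖ = 1} := by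
    refine homotopicRel_of_rotated i hα
      (fun t s => min (min (3 * s + 2) (2 - 3 * s)) (1 - 2 * t + 4 * (1 - t))) (fun _ _ => 1)
      (fun _ _ => 0) (by fun_prop) (by fun_prop) (by fun_prop) ?_ ?_ ?_ ?_
    · intro t s h0 h1 h
      right
      rcases hs h with rfl | rfl
      · exact (min_le_left _ _).trans ((min_le_right _ _).trans (by norm_num))
      · exact (min_le_left _ _).trans ((min_le_left _ _).trans (by norm_num))
    · exact fun _ _ _ _ _ => Or.inl le_rfl
    · intro d
      have hd := abs_le.mp (abs_coord_le i d)
      rw [min_eq_left ((min_le_left _ _).trans (by linarith))]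
      exact h₂₃ d
    · intro d
      exact rotated_eq_base i hα _
        (norm_setCoord_of_le_neg_one i ((min_le_right _ _).trans (by norm_num)) d)
        (norm_setCoord_of_one_le i le_rfl d)
  exact (H₁.trans H₂).trans H₃

end Reflection
end StackingTheory

/-! ### Inverses of families over an attached cell -/

namespace StackingTheory
open FinHilb Metric
open scoped unitInterval

variable {T : StackingTheory} {𝒞 : Set PointedSpace} {n : ℕ} {A X : Type*} [TopologicalSpace A]
  [TopologicalSpace X] [T2Space X]

lemma homotopic_of_eq {Z W : Type*} [TopologicalSpace Z] [TopologicalSpace W] {f g : C(Z, W)}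
    (h : f = g) : f.Homotopic g := h ▸ .refl f

/-- A family over `X` that is trivial on `A` has an inverse: on a cell of positive dimension,
reflect one coordinate of the cube. -/
lemma exists_inverse_of_trivial (c : CellAttachment n A X) (h𝒞 : T.HasPointInverses 𝒞)
    {P : PointedSpace} (hP : P ∈ 𝒞) (f : C(X, T.obj P.space))
    (hf : f.comp c.incl = ContinuousMap.const A (T.base P)) :
    ∃ R ∈ 𝒞, ∃ g : C(X, T.obj R.space),
      (T.stackMap f g).Homotopic (ContinuousMap.const X (T.base (P.tensor R))) := by
  have hfA : ∀ y, f (c.incl y) = T.base P := DFunLike.congr_fun hf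
  rcases Nat.eq_zero_or_pos n with rfl | hn
  · -- The cell is a point, and its boundary is empty.
    obtain ⟨R, hR, τ, hτ⟩ := h𝒞 P hP (f (c.char ⟨0, by simp⟩))
    obtain ⟨g, hgA, hgD⟩ := c.glue (ContinuousMap.const A (T.base R)) (ContinuousMap.const _ τ)
      (fun s => by
        have h := mem_sphere_zero_iff_norm.mp s.2
        rw [Subsingleton.elim s.1 0, norm_zero] at h
        exact absurd h zero_ne_one)
    refine ⟨R, hR, g, c.homotopic_of_homotopicRel (ContinuousMap.ext fun y => ?_) ?_⟩
    · have h1 : g (c.incl y) = T.base R := DFunLike.congr_fun hgA y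
      exact (congrArg T.stack (Prod.ext (hfA y) h1)).trans (T.stack_base P R)
    · have hD : (T.stackMap f g).comp c.char
          = ContinuousMap.const _ (T.stack (f (c.char ⟨0, by simp⟩), τ)) := by
        refine ContinuousMap.ext fun d => ?_
        have hd : d = ⟨0, by simp⟩ := Subtype.ext (Subsingleton.elim _ _)
        subst hd
        exact congrArg T.stack (Prod.ext rfl (DFunLike.congr_fun hgD _))
      rw [hD]
      obtain ⟨k⟩ := homotopic_const (X := closedBall (0 : Fin 0 → ℝ) 1) hτ
      refine ⟨⟨k, fun t d hd => ?_⟩⟩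
      have hd' : ‖d.1‖ = 1 := hd
      rw [Subsingleton.elim d.1 0, norm_zero] at hd'
      exact absurd hd' zero_ne_one
  · let i : Fin n := ⟨0, hn⟩
    have hα : ∀ d, ‖d.1‖ = 1 → (f.comp c.char) d = T.base P := fun d hd =>
      (congrArg f (c.char_sphere ⟨d.1, mem_sphere_zero_iff_norm.mpr hd⟩)).trans (hfA _)
    let r : C(closedBall (0 : Fin n → ℝ) 1, closedBall (0 : Fin n → ℝ) 1) :=
      ⟨fun d => setCoord i (-d.1 i, d),
        (continuous_setCoord i).comp ((continuous_coordinate i).neg.prodMk continuous_id)⟩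
    have hr : ∀ d, ‖d.1‖ = 1 → ‖(r d).1‖ = 1 := by
      intro d hd
      by_cases hi : |d.1 i| = 1
      · rcases (abs_eq zero_le_one).mp hi with h | h
        · exact norm_setCoord_of_le_neg_one i (by linarith) d
        · exact norm_setCoord_of_one_le i (by linarith) d
      · exact norm_setCoord_of_norm i hd hi _
    obtain ⟨g, hgA, hgD⟩ := c.glue (ContinuousMap.const A (T.base P)) ((f.comp c.char).comp r)
      (fun s => (hα _ (hr _ (mem_sphere_zero_iff_norm.mp s.2))).symm)
    refine ⟨P, hP, g, c.homotopic_of_homotopicRel (ContinuousMap.ext fun y => ?_) ?_⟩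
    · have h1 : g (c.incl y) = T.base P := DFunLike.congr_fun hgA y
      exact (congrArg T.stack (Prod.ext (hfA y) h1)).trans (T.stack_base P P)
    · have hD : (T.stackMap f g).comp c.char
          = T.stackMap (f.comp c.char) ((f.comp c.char).comp r) :=
        ContinuousMap.ext fun d => congrArg T.stack (Prod.ext rfl (DFunLike.congr_fun hgD d))
      rw [hD]
      exact stackMap_reflection_homotopicRel i hα

/-- If `g` is an inverse of the family `f` on `A`, then `g` extends to `X` after stacking with a
trivial state: on the boundary of the cell `f` is homotopic to a constant, hence so is `g`. -/
lemma exists_extension_of_inverse (c : CellAttachment n A X)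
    (h𝒞 : T.HasPointInverses 𝒞) {P R : PointedSpace} (hP : P ∈ 𝒞)
    (f : C(X, T.obj P.space)) (g : C(A, T.obj R.space))
    (hg : (T.stackMap (f.comp c.incl) g).Homotopic
      (ContinuousMap.const A (T.base (P.tensor R)))) :
    ∃ R' ∈ 𝒞, ∃ g' : C(X, T.obj ((R'.tensor P).tensor R).space),
      g'.comp c.incl
        = (T.map (insertLeft (R'.tensor P).vec (R'.tensor P).norm_vec R.space)).comp g := by
  let x₀ : closedBall (0 : Fin n → ℝ) 1 := ⟨0, by simp⟩
  obtain ⟨R', hR', ν, hν⟩ := h𝒞 P hP (f (c.char x₀))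
  refine ⟨R', hR', c.exists_extension _ (z := T.map (assocSymm R'.space P.space R.space)
    (T.stack (ν, T.base (P.tensor R)))) ?_⟩
  have hν' : Joined (T.base (R'.tensor P)) (T.stack (ν, f (c.char x₀))) := by
    have h := joined_map (T.map (comm P.space R'.space)) hν
    rw [map_comm_stack] at h
    exact ((T.map_base (P := P.tensor R') (R := R'.tensor P) (comm P.space R'.space) rfl) ▸ h).symm
  -- On the sphere, `ν` being an inverse of `f x₀`, the map `1 ⊗ g` is homotopic to
  -- `(ν ⊗ f x₀) ⊗ g`, hence to `ν ⊗ (f ⊗ g)`, which is homotopic to a constant.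
  let gs := g.comp c.attach
  have h1 : ((T.map (insertLeft (R'.tensor P).vec (R'.tensor P).norm_vec R.space)).comp g).comp
      c.attach = T.stackMap (ContinuousMap.const _ (T.base (R'.tensor P))) gs :=
    ContinuousMap.ext fun s => T.map_insertLeft _ _ _
  have h2 : T.stackMap (ContinuousMap.const _ (T.stack (ν, f (c.char x₀)))) gs
      = (T.map (assocSymm R'.space P.space R.space)).comp (T.stackMap (ContinuousMap.const _ ν)
        (T.stackMap (ContinuousMap.const _ (f (c.char x₀))) gs)) :=
    ContinuousMap.ext fun s => (T.map_assocSymm_stack _ _ _).symm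
  have hball : ∀ (t : I) (s : sphere (0 : Fin n → ℝ) 1),
      t.1 • s.1 ∈ closedBall (0 : Fin n → ℝ) 1 := by
    intro t s
    rw [mem_closedBall_zero_iff, norm_smul, mem_sphere_zero_iff_norm.mp s.2, mul_one,
      Real.norm_of_nonneg t.2.1]
    exact t.2.2
  have h3 : (ContinuousMap.const _ (f (c.char x₀))).Homotopic ((f.comp c.incl).comp c.attach) := by
    refine ⟨⟨(f.comp c.char).comp ⟨fun p : I × sphere (0 : Fin n → ℝ) 1 =>
      ⟨p.1.1 • p.2.1, hball p.1 p.2⟩,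
      ((continuous_subtype_val.comp continuous_fst).smul
        (continuous_subtype_val.comp continuous_snd)).subtype_mk _⟩, fun s => ?_, fun s => ?_⟩⟩
    · exact congrArg (fun d => f (c.char d)) (Subtype.ext (zero_smul ℝ s.1))
    · exact (congrArg (fun d => f (c.char d)) (Subtype.ext (one_smul ℝ s.1))).trans
        (congrArg f (c.char_sphere s))
  have h4 : T.stackMap ((f.comp c.incl).comp c.attach) gs
      = (T.stackMap (f.comp c.incl) g).comp c.attach := rfl
  have h5 : (T.stackMap (ContinuousMap.const _ (f (c.char x₀))) gs).Homotopic
      (ContinuousMap.const _ (T.base (P.tensor R))) :=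
    (homotopic_stackMap h3 (.refl gs)).trans (h4 ▸ hg.comp (.refl c.attach))
  refine (homotopic_of_eq h1).trans ((homotopic_stackMap (homotopic_const hν') (.refl gs)).trans ?_)
  exact (homotopic_of_eq h2).trans <|
    (ContinuousMap.Homotopic.refl _).comp (homotopic_stackMap (.refl (.const _ ν)) h5)

/-- Attaching a cell preserves the existence of inverses: an inverse on `A` extends to `X` after
stacking with a trivial state, the stacked family is deformed to one that is trivial on `A` by the
homotopy extension property, and such a family has an inverse. -/
lemma HasInverses.attach_cell (c : CellAttachment n A X) (h𝒞 : T.HasPointInverses 𝒞)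
    (hten : ∀ P ∈ 𝒞, ∀ R ∈ 𝒞, P.tensor R ∈ 𝒞) (hA : T.HasInverses 𝒞 A) : T.HasInverses 𝒞 X := by
  intro P hP f
  obtain ⟨R, hR, g, hg⟩ := hA P hP (f.comp c.incl)
  obtain ⟨R', hR', g', hg'⟩ := exists_extension_of_inverse c h𝒞 hP f g hg
  let N := (R'.tensor P).tensor R
  have hN : N ∈ 𝒞 := hten _ (hten _ hR' _ hP) _ hR
  let ℓ := insertLeft (R'.tensor P).vec (R'.tensor P).norm_vec R.space
  have h1 : (T.stackMap f g').comp c.incl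
      = (T.map (mapTensor LinearIsometry.id ℓ)).comp (T.stackMap (f.comp c.incl) g) := by
    refine ContinuousMap.ext fun y => ?_
    have h : g' (c.incl y) = T.map ℓ (g y) := DFunLike.congr_fun hg' y
    exact (congrArg T.stack (Prod.ext (T.map_id _).symm h)).trans (T.stack_map _ _ _ _)
  have h2 : ((T.stackMap f g').comp c.incl).Homotopic
      (ContinuousMap.const A (T.base (P.tensor N))) := by
    rw [h1]
    have h := (ContinuousMap.Homotopic.refl (T.map (mapTensor LinearIsometry.id ℓ))).comp hg
    have h' : (T.map (mapTensor LinearIsometry.id ℓ)).comp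
        (ContinuousMap.const A (T.base (P.tensor R)))
        = ContinuousMap.const A (T.base (P.tensor N)) :=
      ContinuousMap.ext fun _ => T.map_base (P := P.tensor R) (R := P.tensor N) _ rfl
    exact h' ▸ h
  obtain ⟨f'', hf, hf'⟩ := c.homotopy_extension (T.stackMap f g') h2
  obtain ⟨R'', hR'', g'', hg''⟩ := exists_inverse_of_trivial c h𝒞 (hten _ hP _ hN) f'' hf'
  refine ⟨N.tensor R'', hten _ hN _ hR'', T.stackMap g' g'', ?_⟩
  have h3 : T.stackMap f (T.stackMap g' g'') = (T.map (assoc P.space N.space R''.space)).comp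
      (T.stackMap (T.stackMap f g') g'') :=
    ContinuousMap.ext fun x => (T.map_assoc_stack _ _ _).symm
  have h4 : (T.map (assoc P.space N.space R''.space)).comp
      (ContinuousMap.const X (T.base ((P.tensor N).tensor R'')))
      = ContinuousMap.const X (T.base (P.tensor (N.tensor R''))) :=
    ContinuousMap.ext fun x =>
      T.map_base (P := (P.tensor N).tensor R'') (R := P.tensor (N.tensor R'')) _ rfl
  exact ((homotopic_of_eq h3).trans ((ContinuousMap.Homotopic.refl _).comp
    ((homotopic_stackMap hf (.refl g'')).trans hg''))).trans (homotopic_of_eq h4)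

end StackingTheory

/-! ### Finite subcomplexes -/

/-- A subset of a compact set is finite if it is closed and discrete. -/
lemma _root_.IsCompact.finite_of_forall_isClosed {Z : Type*} [TopologicalSpace Z] {K S : Set Z}
    (hK : IsCompact K) (hSK : S ⊆ K) (h : ∀ B ⊆ S, IsClosed B) : S.Finite := by
  refine (hK.of_isClosed_subset (h S subset_rfl) hSK).finite ?_
  rw [isDiscrete_iff_discreteTopology]
  refine discreteTopology_iff_forall_isClosed.mpr fun s => ?_
  have := (h (Subtype.val '' s) (by rintro _ ⟨x, _, rfl⟩; exact x.2)).preimage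
    (continuous_subtype_val (p := (· ∈ S)))
  rwa [Set.preimage_image_eq _ Subtype.val_injective] at this

section FiniteSubcomplex
open Topology Metric Set RelCWComplex

variable {Y : Type*} [TopologicalSpace Y] [CWComplex (univ : Set Y)]

variable (Y) in
/-- The cells of a CW complex. -/
abbrev Cell : Type _ := Σ n, RelCWComplex.cell (univ : Set Y) n

/-- The union of a finite set of open cells. -/
def carrier (F : Finset (Cell Y)) : Set Y := ⋃ c ∈ F, openCell c.1 c.2

/-- A finite set of cells that contains with each cell the finitely many cells of smaller dimension
that its frontier meets: the set of cells of a finite subcomplex. -/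
def IsFrontierClosed (F : Finset (Cell Y)) : Prop :=
  ∀ c ∈ F, cellFrontier c.1 c.2 ⊆ carrier (F.filter fun c' => c'.1 < c.1)

lemma carrier_mono {F F' : Finset (Cell Y)} (h : F ⊆ F') : carrier F ⊆ carrier F' :=
  biUnion_subset_biUnion_left h

lemma openCell_subset_carrier {F : Finset (Cell Y)} {c : Cell Y} (hc : c ∈ F) :
    openCell c.1 c.2 ⊆ carrier F :=
  subset_biUnion_of_mem (u := fun c : Cell Y => openCell c.1 c.2) (Finset.mem_coe.mpr hc)

lemma IsFrontierClosed.closedCell_subset {F : Finset (Cell Y)} (hF : IsFrontierClosed F)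
    {c : Cell Y} (hc : c ∈ F) : closedCell c.1 c.2 ⊆ carrier F := by
  rw [← cellFrontier_union_openCell_eq_closedCell]
  exact union_subset ((hF c hc).trans (carrier_mono (Finset.filter_subset _ _)))
    (openCell_subset_carrier hc)

lemma IsFrontierClosed.isCompact {F : Finset (Cell Y)} (hF : IsFrontierClosed F) :
    IsCompact (carrier F) := by
  have h : carrier F = ⋃ c ∈ F, closedCell c.1 c.2 :=
    (iUnion₂_mono fun (c : Cell Y) _ => openCell_subset_closedCell c.1 c.2).antisymm
      (iUnion₂_subset fun _ hc => hF.closedCell_subset hc)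
  rw [h]
  exact F.isCompact_biUnion fun c _ => isCompact_closedCell

lemma IsFrontierClosed.biUnion {ι : Type*} {s : Finset ι} {F : ι → Finset (Cell Y)}
    (h : ∀ i ∈ s, IsFrontierClosed (F i)) : IsFrontierClosed (s.biUnion F) := by
  intro c hc
  obtain ⟨i, hi, hci⟩ := Finset.mem_biUnion.mp hc
  exact (h i hi c hci).trans (carrier_mono
    (Finset.filter_subset_filter _ (Finset.subset_biUnion_of_mem F hi)))

lemma exists_isFrontierClosed_mem (c : Cell Y) : ∃ F, IsFrontierClosed F ∧ c ∈ F := by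
  obtain ⟨n, e⟩ := c
  induction n using Nat.strong_induction_on with
  | _ n ih =>
    obtain ⟨J, hJ⟩ := CWComplex.cellFrontier_subset_finite_openCell n e
    let S : Finset (Cell Y) := (Finset.range n).sigma J
    have hS : ∀ c ∈ S, ∃ F, IsFrontierClosed F ∧ c ∈ F := fun c hc =>
      ih c.1 (Finset.mem_range.mp (Finset.mem_sigma.mp hc).1) c.2
    choose! F hF hcF using hS
    have hsub : S ⊆ S.biUnion F := fun c hc => Finset.mem_biUnion.mpr ⟨c, hc, hcF c hc⟩
    refine ⟨insert ⟨n, e⟩ (S.biUnion F), fun c hc => ?_, Finset.mem_insert_self _ _⟩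
    rcases Finset.mem_insert.mp hc with rfl | hc
    · refine hJ.trans (iUnion₂_subset fun m hm => iUnion₂_subset fun j hj => ?_)
      have hmS : (⟨m, j⟩ : Cell Y) ∈ S := Finset.mem_sigma.mpr ⟨Finset.mem_range.mpr hm, hj⟩
      exact openCell_subset_carrier (c := ⟨m, j⟩)
        (Finset.mem_filter.mpr ⟨Finset.mem_insert_of_mem (hsub hmS), hm⟩)
    · exact (IsFrontierClosed.biUnion hF c hc).trans
        (carrier_mono (Finset.filter_subset_filter _ (Finset.subset_insert _ _)))

lemma IsFrontierClosed.of_insert {F : Finset (Cell Y)} {c : Cell Y}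
    (h : IsFrontierClosed (insert c F)) (hmax : ∀ c' ∈ F, c'.1 ≤ c.1) : IsFrontierClosed F := by
  intro c' hc'
  refine (h c' (Finset.mem_insert_of_mem hc')).trans (carrier_mono fun d hd => ?_)
  obtain ⟨hd, hlt⟩ := Finset.mem_filter.mp hd
  rcases Finset.mem_insert.mp hd with rfl | hd
  · exact absurd hlt (hmax c' hc').not_gt
  · exact Finset.mem_filter.mpr ⟨hd, hlt⟩

variable [T2Space Y]

/-- A compact subset of a CW complex meets only finitely many open cells: a set with one point in
each open cell is closed and discrete. -/
lemma exists_subset_carrier {K : Set Y} (hK : IsCompact K) :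
    ∃ F : Finset (Cell Y), K ⊆ carrier F := by
  let M : Set (Cell Y) := {c | (K ∩ openCell c.1 c.2).Nonempty}
  have hne : ∀ c : Cell Y, ∃ x, c ∈ M → x ∈ K ∩ openCell c.1 c.2 := fun c =>
    (openCell_nonempty c.1 c.2).elim fun y _ => by
      by_cases hc : c ∈ M
      · exact ⟨hc.some, fun _ => hc.some_mem⟩
      · exact ⟨y, fun h => absurd h hc⟩
  choose p hp using hne
  have hpK : p '' M ⊆ K := by rintro _ ⟨c, hc, rfl⟩; exact (hp c hc).1
  have hfin : ∀ c : Cell Y, (p '' M ∩ closedCell c.1 c.2).Finite := by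
    intro c
    obtain ⟨F, hF, hcF⟩ := exists_isFrontierClosed_mem c
    refine (F.finite_toSet.image p).subset ?_
    rintro _ ⟨⟨c', hc', rfl⟩, h⟩
    obtain ⟨d, hd, h'⟩ := mem_iUnion₂.mp (hF.closedCell_subset hcF h)
    have : c' = d := eq_of_not_disjoint_openCell (not_disjoint_iff.mpr ⟨_, (hp c' hc').2, h'⟩)
    exact ⟨d, hd, by rw [this]⟩
  have hclosed : ∀ B ⊆ p '' M, IsClosed B := fun B hB =>
    (CWComplex.closed univ B (subset_univ B)).mpr fun n j =>
      ((hfin ⟨n, j⟩).subset (inter_subset_inter_left _ hB)).isClosed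
  have hM : (p '' M).Finite := hK.finite_of_forall_isClosed hpK hclosed
  have hinj : InjOn p M := fun c hc c' hc' h =>
    eq_of_not_disjoint_openCell (not_disjoint_iff.mpr ⟨_, (hp c hc).2, h ▸ (hp c' hc').2⟩)
  refine ⟨(hM.of_finite_image hinj).toFinset, fun x hx => ?_⟩
  have hx' : x ∈ ⋃ (n : ℕ) (j : RelCWComplex.cell (univ : Set Y) n), openCell n j := by
    rw [CWComplex.iUnion_openCell_eq_complex]; exact mem_univ x
  obtain ⟨n, j, hxj⟩ := mem_iUnion₂.mp hx'
  exact openCell_subset_carrier (c := ⟨n, j⟩) (by simpa using ⟨x, hx, hxj⟩) hxj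

/-- A compact subset of a CW complex lies in a finite subcomplex. -/
lemma exists_isFrontierClosed_subset {K : Set Y} (hK : IsCompact K) :
    ∃ F : Finset (Cell Y), IsFrontierClosed F ∧ K ⊆ carrier F := by
  obtain ⟨S, hS⟩ := exists_subset_carrier hK
  choose F hF hcF using fun c : Cell Y => exists_isFrontierClosed_mem c
  exact ⟨S.biUnion F, .biUnion fun c _ => hF c,
    hS.trans (carrier_mono fun c hc => Finset.mem_biUnion.mpr ⟨c, hc, hcF c⟩)⟩

/-- A finite subcomplex is obtained from a smaller one by attaching a cell of maximal dimension. -/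
def cellAttachment {F : Finset (Cell Y)} {c : Cell Y} (hc : c ∉ F)
    (h : IsFrontierClosed (insert c F)) (hmax : ∀ c' ∈ F, c'.1 ≤ c.1) :
    CellAttachment c.1 (carrier F) (carrier (insert c F)) :=
  have hc' : c ∈ insert c F := Finset.mem_insert_self c F
  have hF : carrier F ⊆ carrier (insert c F) := carrier_mono (Finset.subset_insert c F)
  have hcont := RelCWComplex.continuousOn (C := (univ : Set Y)) c.1 c.2
  have hfr : cellFrontier c.1 c.2 ⊆ carrier F := (h c hc').trans (carrier_mono fun d hd => by
    obtain ⟨hd, hlt⟩ := Finset.mem_filter.mp hd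
    rcases Finset.mem_insert.mp hd with rfl | hd
    · exact absurd hlt (lt_irrefl _)
    · exact hd)
  { incl := ⟨inclusion hF, continuous_inclusion hF⟩
    char := ⟨fun d =>
      ⟨RelCWComplex.map c.1 c.2 d.1, h.closedCell_subset hc' (mem_image_of_mem _ d.2)⟩,
      hcont.restrict.subtype_mk _⟩
    attach := ⟨fun s => ⟨RelCWComplex.map c.1 c.2 s.1, hfr (mem_image_of_mem _ s.2)⟩,
      (hcont.mono sphere_subset_closedBall).restrict.subtype_mk _⟩
    isClosedEmbedding := by
      have := isCompact_iff_compactSpace.mp (h.of_insert hmax).isCompact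
      exact (continuous_inclusion hF).isClosedEmbedding (inclusion_injective hF)
    char_sphere := fun _ => rfl
    char_injOn := fun d d' hd hd' hdd' => by
      have hs := RelCWComplex.source_eq (C := (univ : Set Y)) c.1 c.2
      exact Subtype.ext ((RelCWComplex.map c.1 c.2).injOn (hs ▸ mem_ball_zero_iff.mpr hd)
        (hs ▸ mem_ball_zero_iff.mpr hd') (congrArg Subtype.val hdd'))
    char_ne := fun d y hd hdy => by
      have h1 : RelCWComplex.map c.1 c.2 d.1 ∈ openCell c.1 c.2 :=
        mem_image_of_mem _ (mem_ball_zero_iff.mpr hd)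
      rw [show RelCWComplex.map c.1 c.2 d.1 = y.1 from congrArg Subtype.val hdy] at h1
      obtain ⟨c', hcF, h2⟩ := mem_iUnion₂.mp y.2
      have : c = c' := eq_of_not_disjoint_openCell (not_disjoint_iff.mpr ⟨_, h1, h2⟩)
      exact hc (this ▸ hcF)
    exhaust := fun x => by
      obtain ⟨c', hcF, h2⟩ := mem_iUnion₂.mp x.2
      rcases Finset.mem_insert.mp hcF with rfl | hcF
      · obtain ⟨d, hd, hdx⟩ := h2
        exact .inr ⟨⟨d, ball_subset_closedBall hd⟩, Subtype.ext hdx⟩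
      · exact .inl ⟨⟨x.1, openCell_subset_carrier hcF h2⟩, rfl⟩ }

end FiniteSubcomplex

namespace StackingTheory
variable {T : StackingTheory} {𝒞 : Set PointedSpace}

lemma hasInverses_carrier {Y : Type*} [TopologicalSpace Y] [Topology.CWComplex (Set.univ : Set Y)]
    [T2Space Y] (h𝒞 : T.HasPointInverses 𝒞) (hten : ∀ P ∈ 𝒞, ∀ R ∈ 𝒞, P.tensor R ∈ 𝒞)
    {P₀ : PointedSpace} (hP₀ : P₀ ∈ 𝒞) (F : Finset (Cell Y)) (hF : IsFrontierClosed F) :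
    T.HasInverses 𝒞 (carrier F) := by
  induction F using Finset.induction_on_max_value (fun c : Cell Y => c.1) with
  | empty =>
    have : IsEmpty (carrier (∅ : Finset (Cell Y))) := ⟨fun x => by simpa [carrier] using x.2⟩
    exact .of_isEmpty hP₀
  | insert c F hc hmax ih =>
    exact .attach_cell (cellAttachment hc hF hmax) h𝒞 hten (ih (hF.of_insert hmax))

/-- Over a compact space of the homotopy type of a CW complex all families have inverses, as soon as
all points have: up to homotopy the space is a retract of a finite complex. -/
lemma HasInverses.of_isParameterSpace {X : Type*} [TopologicalSpace X] (hX : IsParameterSpace X)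
    (h𝒞 : T.HasPointInverses 𝒞) (hten : ∀ P ∈ 𝒞, ∀ R ∈ 𝒞, P.tensor R ∈ 𝒞)
    {P₀ : PointedSpace} (hP₀ : P₀ ∈ 𝒞) : T.HasInverses 𝒞 X := by
  have := hX.compact
  obtain ⟨Y, _, _, ⟨_⟩, ⟨e⟩⟩ := hX.cw
  obtain ⟨F, hF, hXF⟩ := exists_isFrontierClosed_subset (isCompact_range e.toFun.continuous)
  refine (hasInverses_carrier h𝒞 hten hP₀ F hF).of_retract
    ⟨fun x => ⟨e.toFun x, hXF ⟨x, rfl⟩⟩, e.toFun.continuous.subtype_mk _⟩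
    (e.invFun.comp ⟨Subtype.val, continuous_subtype_val⟩) ?_
  exact e.left_inv

end StackingTheory

/-! ### Paths in the direct limit -/

namespace StackingTheory
open QuantumStateType Topology
open scoped unitInterval

section Colimit
variable (T : StackingTheory) (V : Type) [NormedAddCommGroup V] [InnerProductSpace ℂ V]

/-- The direct limit of the spaces of states over the finite-dimensional subspaces of `V`. -/
def colim : Type _ :=
  Quot fun p q : Σ W : FinSub V, T.obj W.hilb =>
    ∃ h : p.1.space ≤ q.1.space, T.map (FinSub.incl h) p.2 = q.2

instance : TopologicalSpace (T.colim V) :=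
  inferInstanceAs (TopologicalSpace (Quot _))

variable {V}

/-- The canonical map of a stage to the direct limit. -/
def ofStage (W : FinSub V) (ω : T.obj W.hilb) : T.colim V := Quot.mk _ ⟨W, ω⟩

variable {T}

lemma ofStage_map {W U : FinSub V} (h : W.space ≤ U.space) (ω : T.obj W.hilb) :
    T.ofStage U (T.map (FinSub.incl h) ω) = T.ofStage W ω := (Quot.sound ⟨h, rfl⟩).symm

lemma map_incl_incl {W U U' : FinSub V} (h : W.space ≤ U.space) (h' : U.space ≤ U'.space)
    (ω : T.obj W.hilb) :
    T.map (FinSub.incl h') (T.map (FinSub.incl h) ω) = T.map (FinSub.incl (h.trans h')) ω :=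
  T.map_map _ _ ω

lemma map_injective {H K : FinHilb} (f : H →ₗᵢ[ℂ] K) : Function.Injective (T.map f) :=
  (T.isClosedEmbedding f).injective

/-- The join of two finite-dimensional subspaces. -/
def sup (W U : FinSub V) : FinSub V :=
  have := W.finite
  have := U.finite
  { space := W.space ⊔ U.space
    nontrivial := @Function.Injective.nontrivial _ _ W.nontrivial _
      (Submodule.inclusion_injective (_root_.le_sup_left (a := W.space) (b := U.space))) }

lemma le_sup_left (W U : FinSub V) : W.space ≤ (sup W U).space := _root_.le_sup_left

lemma le_sup_right (W U : FinSub V) : U.space ≤ (sup W U).space := _root_.le_sup_right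

/-- Points of two stages agree in the direct limit if and only if they agree in the join. -/
lemma ofStage_eq_iff {W U : FinSub V} {ω : T.obj W.hilb} {τ : T.obj U.hilb} :
    T.ofStage W ω = T.ofStage U τ ↔
      T.map (FinSub.incl (le_sup_left W U)) ω = T.map (FinSub.incl (le_sup_right W U)) τ := by
  constructor
  · intro h
    let S : (Σ W : FinSub V, T.obj W.hilb) → (Σ W : FinSub V, T.obj W.hilb) → Prop := fun p q =>
      ∃ (Z : FinSub V) (hp : p.1.space ≤ Z.space) (hq : q.1.space ≤ Z.space),
        T.map (FinSub.incl hp) p.2 = T.map (FinSub.incl hq) q.2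
    have hS : ∀ p q, Relation.EqvGen (fun p q : Σ W : FinSub V, T.obj W.hilb =>
        ∃ h : p.1.space ≤ q.1.space, T.map (FinSub.incl h) p.2 = q.2) p q → S p q := by
      intro p q hpq
      induction hpq with
      | rel p q hpq => exact ⟨q.1, hpq.1, le_rfl, hpq.2.trans (T.map_id q.2).symm⟩
      | refl p => exact ⟨p.1, le_rfl, le_rfl, rfl⟩
      | symm p q _ ih =>
        obtain ⟨Z, hp, hq, h1⟩ := ih
        exact ⟨Z, hq, hp, h1.symm⟩
      | trans p q r _ _ ih ih' =>
        obtain ⟨Z, hp, hq, h1⟩ := ih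
        obtain ⟨Z', hq', hr, h2⟩ := ih'
        refine ⟨sup Z Z', hp.trans (le_sup_left Z Z'), hr.trans (le_sup_right Z Z'), ?_⟩
        rw [← map_incl_incl hp (le_sup_left Z Z'), h1, map_incl_incl,
          ← map_incl_incl hr (le_sup_right Z Z'), ← h2, map_incl_incl]
    obtain ⟨Z, hW, hU, hZ⟩ := hS _ _ (Quot.eqvGen_exact h)
    have hsup : (sup W U).space ≤ Z.space := sup_le hW hU
    refine map_injective (FinSub.incl hsup) ?_
    exact (map_incl_incl _ hsup ω).trans (hZ.trans (map_incl_incl _ hsup τ).symm)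
  · intro h
    rw [← ofStage_map (le_sup_left W U), h, ofStage_map]

lemma ofStage_injective (W : FinSub V) : Function.Injective (T.ofStage W) := fun _ _ h =>
  map_injective _ (ofStage_eq_iff.mp h)

lemma isClosed_iff_preimage_ofStage {B : Set (T.colim V)} :
    IsClosed B ↔ ∀ W : FinSub V, IsClosed (T.ofStage W ⁻¹' B) := by
  refine isQuotientMap_quot_mk.isClosed_preimage.symm.trans ?_
  exact isClosed_sigma_iff

/-- The stages are closed subspaces of the direct limit, as the maps between them are closed
embeddings. -/
lemma isClosedEmbedding_ofStage (W : FinSub V) : IsClosedEmbedding (T.ofStage W) := by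
  refine .of_continuous_injective_isClosedMap
    (isQuotientMap_quot_mk.continuous.comp continuous_sigmaMk) (ofStage_injective W) fun B hB => ?_
  refine isClosed_iff_preimage_ofStage.mpr fun U => ?_
  have h : T.ofStage U ⁻¹' (T.ofStage W '' B) = T.map (FinSub.incl (le_sup_right W U)) ⁻¹'
      (T.map (FinSub.incl (le_sup_left W U)) '' B) := by
    ext τ
    exact exists_congr fun ω => and_congr_right fun _ => ofStage_eq_iff
  rw [h]
  exact ((T.isClosedEmbedding _).isClosedMap _ hB).preimage (T.map _).continuous

lemma range_ofStage_mono {W U : FinSub V} (h : W.space ≤ U.space) :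
    Set.range (T.ofStage W) ⊆ Set.range (T.ofStage U) := by
  rintro _ ⟨ω, rfl⟩
  exact ⟨_, ofStage_map h ω⟩

/-- A space of countable dimension is exhausted by a sequence of finite-dimensional subspaces. -/
lemma exists_cofinal (b : Module.Basis ℕ ℂ V) : ∃ W : ℕ → FinSub V,
    Monotone (fun n => (W n).space) ∧ ∀ U : FinSub V, ∃ n, U.space ≤ (W n).space := by
  have hmono : Monotone fun n => Submodule.span ℂ (b '' Set.Iic n) := fun m n h =>
    Submodule.span_mono (Set.image_mono (Set.Iic_subset_Iic.mpr h))
  refine ⟨fun n =>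
    { space := Submodule.span ℂ (b '' Set.Iic n)
      finite := FiniteDimensional.span_of_finite ℂ ((Set.finite_Iic n).image b)
      nontrivial := ⟨⟨b 0, Submodule.subset_span ⟨0, Nat.zero_le n, rfl⟩⟩, 0, fun h =>
        b.ne_zero 0 (congrArg Subtype.val h)⟩ }, hmono, fun U => ?_⟩
  have := U.finite
  obtain ⟨s, hs⟩ := (Module.Finite.iff_fg (N := U.space)).mp inferInstance
  have h : ∀ x : V, ∃ n, x ∈ Submodule.span ℂ (b '' Set.Iic n) := fun x =>
    ⟨(b.repr x).support.sup id, by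
      have := Submodule.span_mono (Set.image_mono (f := b) fun k hk =>
        Set.mem_Iic.mpr (Finset.le_sup (f := id) (Finset.mem_coe.mp hk)))
          (b.mem_span_repr_support x)
      exact this⟩
  choose n hn using h
  refine ⟨s.sup n, hs ▸ Submodule.span_le.mpr fun x hx => hmono (Finset.le_sup hx) (hn x)⟩

/-- A compact subset of the direct limit lies in a stage. -/
lemma exists_subset_range_ofStage (b : Module.Basis ℕ ℂ V) {K : Set (T.colim V)}
    (hK : IsCompact K) : ∃ W : FinSub V, K ⊆ Set.range (T.ofStage W) := by
  obtain ⟨W, hW, hcof⟩ := exists_cofinal b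
  have hmono : Monotone fun n => Set.range (T.ofStage (W n)) := fun m n h =>
    range_ofStage_mono (hW h)
  have hex : ∀ x : T.colim V, ∃ n, x ∈ Set.range (T.ofStage (W n)) := by
    rintro ⟨U, ω⟩
    obtain ⟨n, hn⟩ := hcof U
    exact ⟨n, range_ofStage_mono hn ⟨ω, rfl⟩⟩
  by_contra! hnot
  -- A sequence of points that leaves every stage is closed and discrete.
  choose x hxK hx using fun n => Set.not_subset.mp (hnot (W n))
  have hfin : (Set.range x).Finite := by
    refine hK.finite_of_forall_isClosed (Set.range_subset_iff.mpr hxK) fun B hB => ?_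
    refine isClosed_iff_preimage_ofStage.mpr fun U => ?_
    obtain ⟨m, hm⟩ := hcof U
    refine (((Set.finite_Iio m).image x).preimage (ofStage_injective U).injOn).subset ?_ |>.isClosed
    intro ω hω
    obtain ⟨k, hk⟩ := hB hω
    refine ⟨k, Set.mem_Iio.mpr (lt_of_not_ge fun hmk => hx k ?_), hk⟩
    exact hk ▸ range_ofStage_mono (hm.trans (hW hmk)) ⟨ω, rfl⟩
  choose n hn using hex
  obtain ⟨N, hN⟩ := (hfin.image n).bddAbove
  exact hx N (hmono (hN ⟨x N, ⟨N, rfl⟩, rfl⟩) (hn (x N)))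

/-- A path in the direct limit lies in a stage. -/
lemma joined_of_joined_ofStage (b : Module.Basis ℕ ℂ V) {W U : FinSub V} {ω : T.obj W.hilb}
    {τ : T.obj U.hilb} (h : Joined (T.ofStage W ω) (T.ofStage U τ)) :
    ∃ (Z : FinSub V) (hW : W.space ≤ Z.space) (hU : U.space ≤ Z.space),
      Joined (T.map (FinSub.incl hW) ω) (T.map (FinSub.incl hU) τ) := by
  obtain ⟨p⟩ := h
  obtain ⟨Z', hZ'⟩ := exists_subset_range_ofStage b (isCompact_range p.continuous)
  let Z := sup (sup W U) Z'
  have hW : W.space ≤ Z.space := (le_sup_left W U).trans (le_sup_left _ _)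
  have hU : U.space ≤ Z.space := (le_sup_right W U).trans (le_sup_left _ _)
  have hZ := hZ'.trans (range_ofStage_mono (le_sup_right (sup W U) Z'))
  choose q hq using fun t => hZ ⟨t, rfl⟩
  have hqc : Continuous q := (isClosedEmbedding_ofStage Z).isEmbedding.continuous_iff.mpr
    (p.continuous.congr fun t => (hq t).symm)
  refine ⟨Z, hW, hU, ⟨⟨⟨q, hqc⟩, ?_, ?_⟩⟩⟩
  · exact ofStage_injective Z ((hq 0).trans (p.source.trans (ofStage_map hW ω).symm))
  · exact ofStage_injective Z ((hq 1).trans (p.target.trans (ofStage_map hU τ).symm))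

end Colimit
end StackingTheory

/-! ### Inverses in invertible quantum state types -/

section Isometries
variable {E F : Type*} [NormedAddCommGroup E] [InnerProductSpace ℂ E] [FiniteDimensional ℂ E]
  [NormedAddCommGroup F] [InnerProductSpace ℂ F]

/-- There is an isometry to any space with sufficiently many orthonormal vectors. -/
lemma exists_isometry_of_orthonormal {e : Fin (Module.finrank ℂ E) → F} (he : Orthonormal ℂ e) :
    Nonempty (E →ₗᵢ[ℂ] F) := by
  let b := stdOrthonormalBasis ℂ E
  refine ⟨(b.toBasis.constr ℂ e).isometryOfOrthonormal (v := b.toBasis) ?_ ?_⟩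
  · rw [b.coe_toBasis]; exact b.orthonormal
  · have h : (b.toBasis.constr ℂ e) ∘ b.toBasis = e := by
      ext i; simp only [Function.comp_apply, Module.Basis.constr_basis]
    rwa [h]

/-- Between finite-dimensional spaces of suitable dimensions there is an isometry that sends a given
unit vector to a given unit vector. -/
lemma exists_isometry_apply_eq [FiniteDimensional ℂ F]
    (h : Module.finrank ℂ E ≤ Module.finrank ℂ F) {x : E} {y : F} (hx : ‖x‖ = 1) (hy : ‖y‖ = 1) :
    ∃ f : E →ₗᵢ[ℂ] F, f x = y := by
  obtain ⟨f⟩ := exists_isometry_of_orthonormal (E := E) ((stdOrthonormalBasis ℂ F).orthonormal.comp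
    (Fin.castLE h) (Fin.castLE_injective h))
  have hfx : ‖f x‖ = 1 := (f.norm_map x).trans hx
  let L : (ℂ ∙ f x) →ₗᵢ[ℂ] F := (LinearIsometry.toSpanSingleton ℂ F hy).comp
    (LinearIsometryEquiv.toSpanUnitSingleton (𝕜 := ℂ) (f x) hfx).symm.toLinearIsometry
  refine ⟨L.extend.comp f, ?_⟩
  have h1 := L.extend_apply (LinearIsometryEquiv.toSpanUnitSingleton (𝕜 := ℂ) (f x) hfx 1)
  have h2 : ((LinearIsometryEquiv.toSpanUnitSingleton (𝕜 := ℂ) (f x) hfx 1 : (ℂ ∙ f x)) : F)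
      = f x := by simp
  have h3 : L (LinearIsometryEquiv.toSpanUnitSingleton (𝕜 := ℂ) (f x) hfx 1) = y := by
    change LinearIsometry.toSpanSingleton ℂ F hy ((LinearIsometryEquiv.toSpanUnitSingleton (f x)
      hfx).symm (LinearIsometryEquiv.toSpanUnitSingleton (f x) hfx 1)) = y
    rw [LinearIsometryEquiv.symm_apply_apply]
    simp
  rw [h2, h3] at h1
  exact h1

/-- A space of countably infinite dimension with an orthonormal Hamel basis. -/
lemma exists_orthonormal_basis_nat : ∃ (V : Type) (_ : NormedAddCommGroup V)
    (_ : InnerProductSpace ℂ V) (b : Module.Basis ℕ ℂ V), Orthonormal ℂ b := by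
  let e : ℕ → lp (fun _ : ℕ => ℂ) 2 := fun n => lp.single 2 n 1
  have he : Orthonormal ℂ e := by
    rw [orthonormal_iff_ite]
    intro i j
    simp only [e, lp.inner_single_left, lp.single_apply]
    simp [Pi.single_apply]
  refine ⟨Submodule.span ℂ (Set.range e), inferInstance, inferInstance,
    .span he.linearIndependent, ?_⟩
  rw [orthonormal_iff_ite] at he ⊢
  intro i j
  rw [← he i j, Submodule.coe_inner, Module.Basis.span_apply, Module.Basis.span_apply]

/-- A space with a countable orthonormal Hamel basis is isometric to its tensor square, with the
first basis vector as the distinguished vector. -/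
lemma exists_isometry_tensor_self (b : Module.Basis ℕ ℂ F) (hb : Orthonormal ℂ b) :
    ∃ φ : F ⊗[ℂ] F →ₗᵢ[ℂ] F, φ (b 0 ⊗ₜ[ℂ] b 0) = b 0 := by
  have hbb : Orthonormal ℂ (b.tensorProduct b) := by
    rw [orthonormal_iff_ite] at hb ⊢
    rintro ⟨i, j⟩ ⟨k, l⟩
    rw [Module.Basis.tensorProduct_apply, Module.Basis.tensorProduct_apply,
      TensorProduct.inner_tmul, hb, hb]
    simp only [Prod.mk.injEq]
    split_ifs <;> simp_all
  let g := (b.tensorProduct b).constr ℂ fun p : ℕ × ℕ => b (Nat.pairEquiv p)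
  have hg : g ∘ (b.tensorProduct b) = fun p => b (Nat.pairEquiv p) := by
    ext p; simp only [g, Function.comp_apply, Module.Basis.constr_basis]
  refine ⟨g.isometryOfOrthonormal hbb (hg ▸ hb.comp _ Nat.pairEquiv.injective), ?_⟩
  have h := congrFun hg (0, 0)
  rw [Function.comp_apply, Module.Basis.tensorProduct_apply] at h
  exact h

/-- The path of isometries `cos t • f + sin t • g` between isometries with orthogonal ranges. -/
def orthogonalPath {f g : E →ₗᵢ[ℂ] F} (h : ∀ x y, inner ℂ (f x) (g y) = 0) (t : ℝ) :
    E →ₗᵢ[ℂ] F where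
  toLinearMap := (Real.cos t : ℂ) • f.toLinearMap + (Real.sin t : ℂ) • g.toLinearMap
  norm_map' x := by
    have h1 := norm_add_sq_eq_norm_sq_add_norm_sq_of_inner_eq_zero ((Real.cos t : ℂ) • f x)
      ((Real.sin t : ℂ) • g x) (by rw [inner_smul_left, inner_smul_right, h]; simp)
    rw [norm_smul, norm_smul, f.norm_map, g.norm_map, Complex.norm_real, Complex.norm_real,
      Real.norm_eq_abs, Real.norm_eq_abs] at h1
    rw [mul_mul_mul_comm, mul_mul_mul_comm |Real.sin t|, abs_mul_abs_self, abs_mul_abs_self,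
      ← add_mul, ← sq (Real.cos t), ← sq (Real.sin t), Real.cos_sq_add_sin_sq, one_mul] at h1
    exact (mul_self_inj (norm_nonneg _) (norm_nonneg _)).mp h1

end Isometries

namespace StackingTheory
open QuantumStateType FinHilb
variable {T : StackingTheory}

lemma joined_map_of_orthogonal {H K : FinHilb} {f g : H →ₗᵢ[ℂ] K}
    (h : ∀ x y, inner ℂ (f x) (g y) = 0) (ω : T.obj H) : Joined (T.map f ω) (T.map g ω) := by
  have hc' : ∀ x, Continuous fun t : ℝ => orthogonalPath h t x := fun x =>
    ((Complex.continuous_ofReal.comp Real.continuous_cos).smul continuous_const).add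
      ((Complex.continuous_ofReal.comp Real.continuous_sin).smul continuous_const)
  have hc : Continuous fun t : ℝ => T.map (orthogonalPath h t) ω :=
    Continuous.comp (g := fun p : ℝ × T.obj H => T.map (orthogonalPath h p.1) p.2)
      (f := fun t : ℝ => (t, ω)) (T.continuous_map_path _ hc')
      (continuous_id.prodMk continuous_const)
  have h0 : orthogonalPath h 0 = f := by
    ext x
    change (Real.cos 0 : ℂ) • f x + (Real.sin 0 : ℂ) • g x = f x
    simp
  have h1 : orthogonalPath h (Real.pi / 2) = g := by
    ext x
    change (Real.cos (Real.pi / 2) : ℂ) • f x + (Real.sin (Real.pi / 2) : ℂ) • g x = g x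
    rw [Real.cos_pi_div_two, Real.sin_pi_div_two]
    simp
  refine ⟨⟨⟨fun s => T.map (orthogonalPath h (s.1 * (Real.pi / 2))) ω,
    hc.comp (by fun_prop)⟩, ?_, ?_⟩⟩
  · exact congrArg (fun k => T.map k ω) ((congrArg (orthogonalPath h) (zero_mul _)).trans h0)
  · exact congrArg (fun k => T.map k ω) ((congrArg (orthogonalPath h) (one_mul _)).trans h1)

/-- The isometry `x ↦ x ⊗ u`. -/
def insertRight (H : FinHilb) {K : FinHilb} (u : K) (hu : ‖u‖ = 1) : H →ₗᵢ[ℂ] H.tensor K :=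
  (comm K H).comp (insertLeft u hu H)

/-- Any two isometries act in the same way up to a path, after the addition of a tensor factor of
dimension at least two: both can be rotated into a third one that uses an orthogonal vector of the
new factor. -/
lemma joined_map_insertRight {H K L : FinHilb} (f g : H →ₗᵢ[ℂ] K) {u w : L} (hu : ‖u‖ = 1)
    (hw : ‖w‖ = 1) (huw : inner ℂ u w = 0) (ω : T.obj H) :
    Joined (T.map ((insertRight K u hu).comp f) ω) (T.map ((insertRight K u hu).comp g) ω) := by
  have h : ∀ f : H →ₗᵢ[ℂ] K, Joined (T.map ((insertRight K u hu).comp f) ω)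
      (T.map ((insertRight K w hw).comp g) ω) := fun f =>
    joined_map_of_orthogonal (fun x y => by
      change inner ℂ (f x ⊗ₜ[ℂ] u : K ⊗[ℂ] L) (g y ⊗ₜ[ℂ] w) = 0
      rw [TensorProduct.inner_tmul, huw, mul_zero]) ω
  exact (h f).trans (h g).symm

end StackingTheory

namespace QuantumStateType
open StackingTheory
variable {Γ : Type*} (Q : QuantumStateType Γ)

variable {Q} {V : Type} [NormedAddCommGroup V] [InnerProductSpace ℂ V]

/-- The inclusion of a finite-dimensional subspace. -/
def FinSub.inclusion (W : FinSub V) : W.hilb →ₗᵢ[ℂ] V := ⟨W.space.subtype, fun _ => rfl⟩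

lemma exists_component_eq (y : ZerothHomotopy (Q.colim V)) :
    ∃ (W : FinSub V) (τ : Q.obj W.hilb), Q.component W.inclusion τ = y := by
  obtain ⟨⟨W, τ⟩, rfl⟩ := Quotient.exists_rep y
  refine ⟨W, τ, congrArg (Quotient.mk (pathSetoid (Q.colim V))) ?_⟩
  exact (Quot.sound ⟨fun x hx => ⟨⟨x, hx⟩, rfl⟩, rfl⟩).symm

/-- If two states agree in `π₀ 𝒬(V)`, then they are connected by a path in a finite stage. -/
lemma exists_joined_of_component_eq (b : Module.Basis ℕ ℂ V) {H K : FinHilb} {f : H →ₗᵢ[ℂ] V}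
    {g : K →ₗᵢ[ℂ] V} {ω : Q.theory.obj H} {τ : Q.theory.obj K}
    (h : Q.component f ω = Q.component g τ) : ∃ (U : FinHilb) (a : H →ₗᵢ[ℂ] U) (c : K →ₗᵢ[ℂ] U),
      Joined (Q.theory.map a ω) (Q.theory.map c τ) := by
  let f' : H →ₗᵢ[ℂ] (FinSub.range f).hilb := f.equivRange.toLinearIsometry
  let g' : K →ₗᵢ[ℂ] (FinSub.range g).hilb := g.equivRange.toLinearIsometry
  have h' : Joined (Q.theory.ofStage _ (Q.theory.map f' ω))
      (Q.theory.ofStage _ (Q.theory.map g' τ)) :=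
    Quotient.exact h
  obtain ⟨Z, hW, hU, hZ⟩ := joined_of_joined_ofStage b h'
  rw [StackingTheory.map_map, StackingTheory.map_map] at hZ
  exact ⟨Z.hilb, _, _, hZ⟩

variable (Q) in
/-- In an invertible quantum state type every state `ω` has an inverse `τ`, up to a path in some
larger site space. -/
lemma IsInvertible.exists_joined (hQ : Q.IsInvertible) {K : FinHilb} (ω : Q.theory.obj K) :
    ∃ (L U : FinHilb) (τ : Q.theory.obj L) (a : K.tensor L →ₗᵢ[ℂ] U) (v : U) (hv : ‖v‖ = 1),
      Joined (Q.theory.map a (Q.theory.stack (ω, τ))) (Q.theory.product v hv) := by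
  obtain ⟨V, _, _, b, hb⟩ := exists_orthonormal_basis_nat
  obtain ⟨φ, hφ⟩ := exists_isometry_tensor_self b hb
  obtain ⟨f⟩ := exists_isometry_of_orthonormal (E := K) (hb.comp Fin.val Fin.val_injective)
  let u : ℂ →ₗᵢ[ℂ] V := LinearIsometry.toSpanSingleton ℂ V (hb.1 0)
  have hu : u 1 = b 0 := by simp [u]
  have hrank : Module.rank ℂ V = Cardinal.aleph0 := by
    rw [← b.mk_eq_rank'', Cardinal.mk_nat]
  obtain ⟨_, h1, hmul⟩ := hQ V hrank u φ (by rw [hu, hφ])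
  obtain ⟨y, hy⟩ : ∃ y, Q.component f ω * y = 1 := ⟨_, mul_inv_cancel _⟩
  obtain ⟨W, τ, rfl⟩ := exists_component_eq y
  have h2 : Q.component (H := FinHilb.unit) u (Q.product (1 : ℂ) norm_one) = Q.component
      (H := K.tensor W.hilb) (φ.comp (TensorProduct.mapIsometry f W.inclusion)) (Q.stack (ω, τ)) :=
    h1.trans (hy.symm.trans (hmul K W.hilb f W.inclusion ω τ))
  obtain ⟨U, a, c, h⟩ := exists_joined_of_component_eq b h2
  exact ⟨W.hilb, U, τ, c, a (1 : ℂ), (a.norm_map (1 : ℂ)).trans norm_one,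
    ((Q.theory.map_product a (1 : ℂ) norm_one) ▸ h).symm⟩

end QuantumStateType

/-! ### Tensor powers of a site space -/

section OneDimensional
variable {Γ : Type*}

/-- If the site space is one-dimensional, then there is only one state. -/
lemma State.eq_of_finrank_eq_one {H : Type} [NormedAddCommGroup H] [InnerProductSpace ℂ H]
    [FiniteDimensional ℂ H] (hH : Module.finrank ℂ H = 1) (ω τ : State Γ H) : ω = τ := by
  refine State.ext_elem fun A Λ => ?_
  have hA : ∀ v, ∃ c : ℂ, A v = c • 1 := fun v => by
    have : Nontrivial H := Module.nontrivial_of_finrank_pos (R := ℂ) (hH ▸ one_pos)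
    obtain ⟨x, hx⟩ := exists_ne (0 : H)
    have hspan := (finrank_eq_one_iff_of_nonzero' x hx).mp hH
    obtain ⟨c, hc⟩ := hspan (A v x)
    refine ⟨c, ContinuousLinearMap.ext fun y => ?_⟩
    obtain ⟨d, rfl⟩ := hspan y
    rw [map_smul, ← hc, smul_comm]
    rfl
  choose c hc using hA
  have h : ∀ ω : State Γ H, ω.1 (elem Λ A) = ∏ v ∈ Λ, c v := fun ω => by
    induction Λ using Finset.induction_on with
    | empty => exact ω.one
    | insert v Λ hv ih =>
      rw [elem_insert hv, hc v, siteElem_smul, siteElem_one, smul_mul_assoc, one_mul, map_smul, ih,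
        Finset.prod_insert hv, smul_eq_mul]
  rw [h, h]

end OneDimensional

namespace FinHilb
variable {H : FinHilb}

lemma finrank_pow (H : FinHilb) : ∀ n, Module.finrank ℂ (H.pow n) = Module.finrank ℂ H ^ n
  | 0 => Module.finrank_self ℂ
  | n + 1 => (Module.finrank_tensorProduct (R := ℂ) (S := ℂ) (M := H.pow n) (M' := H)).trans
      (by rw [finrank_pow H n, pow_succ])

lemma powIso_vecPow (ψ : H) (i : ℕ) :
    ∀ j, H.powIso i j (vecPow ψ i ⊗ₜ[ℂ] vecPow ψ j) = vecPow ψ (i + j)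
  | 0 => one_smul ℂ (vecPow ψ i)
  | j + 1 => congrArg (fun x : H.pow (i + j) => (x ⊗ₜ[ℂ] ψ : H.pow (i + j) ⊗[ℂ] H))
      (powIso_vecPow ψ i j)

end FinHilb

namespace PointedSpace
open FinHilb
variable {H : FinHilb} {ψ : H} (hψ : ‖ψ‖ = 1)

/-- The tensor powers of a site space with the corresponding power of a unit vector. -/
def pow (n : ℕ) : PointedSpace := ⟨H.pow n, vecPow ψ n, norm_vecPow hψ n⟩

/-- The pointed site spaces that are isometric to a tensor power of `H`. This class is closed under
tensor products, the tensor powers themselves only up to isometries. -/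
def powers : Set PointedSpace :=
  {P | ∃ (n : ℕ) (e : P.space ≃ₗᵢ[ℂ] H.pow n), e P.vec = vecPow ψ n}

lemma pow_mem_powers (n : ℕ) : pow hψ n ∈ powers (ψ := ψ) :=
  ⟨n, LinearIsometryEquiv.refl ℂ (H.pow n), rfl⟩

lemma tensor_mem_powers : ∀ P ∈ powers (ψ := ψ), ∀ R ∈ powers (ψ := ψ),
    P.tensor R ∈ powers (ψ := ψ) := by
  rintro P ⟨i, e, he⟩ R ⟨j, e', he'⟩
  refine ⟨i + j, (TensorProduct.congrIsometry e e').trans (H.powIso i j), ?_⟩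
  refine Eq.trans ?_ (powIso_vecPow ψ i j)
  exact congrArg (H.powIso i j) (congrArg₂ (fun x y => (x ⊗ₜ[ℂ] y : H.pow i ⊗[ℂ] H.pow j)) he he')

end PointedSpace

namespace StackingTheory
open FinHilb PointedSpace
variable {T : StackingTheory} {H : FinHilb} {ψ : H} (hψ : ‖ψ‖ = 1)

lemma hasPointInverses_powers (h : ∀ (i : ℕ) (ω : T.obj (H.pow i)),
      ∃ (j : ℕ) (τ : T.obj (H.pow j)),
        Joined (T.stack (ω, τ)) (T.base ((pow hψ i).tensor (pow hψ j)))) :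
    T.HasPointInverses (powers (ψ := ψ)) := by
  rintro P ⟨i, e, he⟩ ω
  obtain ⟨j, τ, hτ⟩ := h i (T.map e.toLinearIsometry ω)
  refine ⟨pow hψ j, pow_mem_powers hψ j, τ, ?_⟩
  let c : (pow hψ i).space →ₗᵢ[ℂ] P.space := e.symm.toLinearIsometry
  have h1 := joined_map (T.map (mapTensor c (LinearIsometry.id (E := H.pow j)))) hτ
  have hc : T.map c (T.map e.toLinearIsometry ω) = ω := by
    refine (T.map_map _ _ _).trans ((congrArg (fun k => T.map k ω) ?_).trans (T.map_id ω))
    exact LinearIsometry.ext fun x => e.symm_apply_apply x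
  have h2 : T.map (mapTensor c (LinearIsometry.id (E := H.pow j)))
      (T.stack (T.map e.toLinearIsometry ω, τ)) = T.stack (ω, τ) :=
    (T.stack_map _ _ _ _).symm.trans (congrArg T.stack (Prod.ext hc (T.map_id τ)))
  have h3 : T.map (mapTensor c (LinearIsometry.id (E := H.pow j)))
      (T.base ((pow hψ i).tensor (pow hψ j))) = T.base (P.tensor (pow hψ j)) :=
    T.map_base (P := (pow hψ i).tensor (pow hψ j)) (R := P.tensor (pow hψ j)) _
      (congrArg (fun x : P.space => (x ⊗ₜ[ℂ] vecPow ψ j : P.space ⊗[ℂ] H.pow j))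
        ((congrArg e.symm he).symm.trans (e.symm_apply_apply _)))
  exact h3 ▸ h2 ▸ h1

/-- If the states over the tensor powers of `H` have inverses up to paths, then families of such
states over `X` have inverses up to homotopies. -/
lemma exists_family_inverse {X : Type*} [TopologicalSpace X] (hX : IsParameterSpace X)
    (h : ∀ (i : ℕ) (ω : T.obj (H.pow i)), ∃ (j : ℕ) (τ : T.obj (H.pow j)),
      Joined (T.stack (ω, τ)) (T.base ((pow hψ i).tensor (pow hψ j))))
    (i : ℕ) (f : C(X, T.obj (H.pow i))) : ∃ (j : ℕ) (g : C(X, T.obj (H.pow j))),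
      ((T.map (K := H.pow (i + j)) (H := (H.pow i).tensor (H.pow j))
        (H.powIso i j).toLinearIsometry).comp (T.stackMap f g)).Homotopic
        (ContinuousMap.const X (T.base (pow hψ (i + j)))) := by
  obtain ⟨R, ⟨j, e, he⟩, g, hg⟩ := HasInverses.of_isParameterSpace hX
    (hasPointInverses_powers hψ h) tensor_mem_powers (pow_mem_powers hψ 0)
    (pow hψ i) (pow_mem_powers hψ i) f
  refine ⟨j, (T.map e.toLinearIsometry).comp g, ?_⟩
  let k : ((pow hψ i).tensor R).space →ₗᵢ[ℂ] (pow hψ (i + j)).space :=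
    (H.powIso i j).toLinearIsometry.comp
      (mapTensor (LinearIsometry.id (E := H.pow i)) e.toLinearIsometry)
  have h1 : (T.map (K := H.pow (i + j)) (H := (H.pow i).tensor (H.pow j))
        (H.powIso i j).toLinearIsometry).comp (T.stackMap f ((T.map e.toLinearIsometry).comp g))
      = (T.map k).comp (T.stackMap f g) := by
    refine ContinuousMap.ext fun x => ?_
    have hx : T.stack (f x, T.map e.toLinearIsometry (g x)) = T.map (mapTensor
        (LinearIsometry.id (E := H.pow i)) e.toLinearIsometry) (T.stack (f x, g x)) :=
      (congrArg (fun η => T.stack (η, T.map e.toLinearIsometry (g x))) (T.map_id (f x)).symm).trans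
        (T.stack_map (LinearIsometry.id (E := H.pow i)) e.toLinearIsometry (f x) (g x))
    exact (congrArg (T.map (K := H.pow (i + j)) (H := (H.pow i).tensor (H.pow j))
      (H.powIso i j).toLinearIsometry) hx).trans (T.map_map _ _ _)
  have h2 : (T.map k).comp (ContinuousMap.const X (T.base ((pow hψ i).tensor R)))
      = ContinuousMap.const X (T.base (pow hψ (i + j))) :=
    ContinuousMap.ext fun _ => T.map_base (P := (pow hψ i).tensor R) (R := pow hψ (i + j)) k
      ((congrArg (fun y : H.pow j => H.powIso i j (vecPow ψ i ⊗ₜ[ℂ] y)) he).trans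
        (powIso_vecPow ψ i j))
  exact ((homotopic_of_eq h1).trans ((ContinuousMap.Homotopic.refl (T.map k)).comp hg)).trans
    (homotopic_of_eq h2)

end StackingTheory

namespace QuantumStateType
open FinHilb StackingTheory
variable {Γ : Type*} {Q : QuantumStateType Γ} {H : FinHilb} {ψ : H} (hψ : ‖ψ‖ = 1)

/-- An inverse in some site space can be moved to a tensor power of `H`. -/
lemma IsInvertible.exists_joined_pow (hQ : Q.IsInvertible) (hH : 2 ≤ Module.finrank ℂ H) (i : ℕ)
    (ω : Q.theory.obj (H.pow i)) : ∃ (j : ℕ) (τ : Q.theory.obj (H.pow j)),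
      Joined (Q.theory.stack (ω, τ))
        (Q.theory.base ((PointedSpace.pow hψ i).tensor (PointedSpace.pow hψ j))) := by
  obtain ⟨L, U, τ, a, v, hv, h⟩ := hQ.exists_joined Q ω
  -- Both the site space of the inverse and the one of the path fit into `H^{⊗ j}`, as `j ≤ 2 ^ j`.
  let j := max (Module.finrank ℂ L) (Module.finrank ℂ U)
  let B : PointedSpace := (PointedSpace.pow hψ i).tensor (PointedSpace.pow hψ j)
  have hj : j ≤ Module.finrank ℂ (H.pow j) :=
    (finrank_pow H j).symm ▸ (Nat.lt_pow_self hH).le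
  have hB : j ≤ Module.finrank ℂ B.space := by
    have h1 : Module.finrank ℂ B.space = Module.finrank ℂ (H.pow i) * Module.finrank ℂ (H.pow j) :=
      Module.finrank_tensorProduct
    rw [h1]
    exact hj.trans (Nat.le_mul_of_pos_left _ Module.finrank_pos)
  obtain ⟨g⟩ := exists_isometry_of_orthonormal (E := L)
    ((stdOrthonormalBasis ℂ (H.pow j)).orthonormal.comp (Fin.castLE ((le_max_left _ _).trans hj))
      (Fin.castLE_injective _))
  obtain ⟨c, hc⟩ := exists_isometry_apply_eq (E := U) (F := B.space)
    ((le_max_right _ _).trans hB) hv B.norm_vec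
  -- A second unit vector, orthogonal to `ψ`.
  obtain ⟨w, hw, hψw⟩ : ∃ w : H, ‖w‖ = 1 ∧ inner ℂ ψ w = 0 := by
    let e := (EuclideanSpace.basisFun (Fin 2) ℂ)
    obtain ⟨f, hf⟩ := exists_isometry_apply_eq (F := H) (finrank_euclideanSpace_fin.trans_le hH)
      (e.orthonormal.1 0) hψ
    exact ⟨f (e 1), (f.norm_map _).trans (e.orthonormal.1 1),
      hf ▸ (f.inner_map_map _ _).trans (e.orthonormal.2 zero_ne_one)⟩
  refine ⟨j + 1, Q.theory.map ((insertRight (H.pow j) ψ hψ).comp g) τ, ?_⟩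
  let b : ((H.pow i).tensor L) →ₗᵢ[ℂ] B.space := mapTensor LinearIsometry.id g
  have h1 := joined_map_insertRight (c.comp a) b hψ hw hψw (Q.theory.stack (ω, τ))
  let α : B.space.tensor H →ₗᵢ[ℂ] (H.pow i).tensor (H.pow (j + 1)) := assoc (H.pow i) (H.pow j) H
  let k : U →ₗᵢ[ℂ] (H.pow i).tensor (H.pow (j + 1)) := α.comp ((insertRight B.space ψ hψ).comp c)
  have e1 : Q.theory.map α (Q.theory.map ((insertRight B.space ψ hψ).comp (c.comp a))
      (Q.theory.stack (ω, τ))) = Q.theory.map k (Q.theory.map a (Q.theory.stack (ω, τ))) :=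
    (Q.theory.map_map _ _ _).trans (Q.theory.map_map k a _).symm
  have e2 : Q.theory.map α (Q.theory.map ((insertRight B.space ψ hψ).comp b)
      (Q.theory.stack (ω, τ)))
      = Q.theory.stack (ω, Q.theory.map ((insertRight (H.pow j) ψ hψ).comp g) τ) := by
    refine ((Q.theory.map_map _ _ _).trans (congrArg (fun l => Q.theory.map l _) ?_)).trans
      ((Q.theory.stack_map LinearIsometry.id ((insertRight (H.pow j) ψ hψ).comp g) ω τ).symm.trans
        (congrArg Q.theory.stack (Prod.ext (Q.theory.map_id ω) rfl)))
    exact LinearIsometry.toLinearMap_injective (TensorProduct.ext' fun x y => rfl)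
  have e3 : Q.theory.map k (Q.theory.product v hv)
      = Q.theory.base ((PointedSpace.pow hψ i).tensor (PointedSpace.pow hψ (j + 1))) :=
    (Q.theory.map_product k v hv).trans (Q.theory.product_congr
      (congrArg (fun x => α (insertRight B.space ψ hψ x)) hc) _ _)
  have h2 := joined_map (Q.theory.map α) h1
  have h3 := joined_map (Q.theory.map k) h
  rw [e1, e2] at h2
  rw [e3] at h3
  exact h2.symm.trans h3

/-- Over a one-dimensional site space there is nothing to prove, as all states agree. -/
lemma joined_of_finrank_eq_one (hH : Module.finrank ℂ H = 1) (i j : ℕ)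
    (ω : Q.theory.obj (H.pow i)) (τ : Q.theory.obj (H.pow j)) : Joined (Q.theory.stack (ω, τ))
      (Q.theory.base ((PointedSpace.pow hψ i).tensor (PointedSpace.pow hψ j))) := by
  have h1 : Module.finrank ℂ ((H.pow i).tensor (H.pow j)) = 1 := by
    refine (Module.finrank_tensorProduct (R := ℂ) (S := ℂ) (M := H.pow i) (M' := H.pow j)).trans ?_
    rw [finrank_pow, finrank_pow, hH, one_pow, one_pow, one_mul]
  have h2 : Q.theory.stack (ω, τ)
      = Q.theory.base ((PointedSpace.pow hψ i).tensor (PointedSpace.pow hψ j)) :=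
    Subtype.ext (State.eq_of_finrank_eq_one h1 _ _)
  exact h2 ▸ .refl _

/-- The identification `H^{⊗ i} ⊗ H^{⊗ j} = H^{⊗ (i + j)}` does not affect the existence
of paths. -/
lemma joined_stack_of_joined_stackPow {i j : ℕ} (ω : Q.obj (H.pow i)) (τ : Q.obj (H.pow j))
    (h : Joined (Q.stackPow H i j (ω, τ)) (Q.trivialState ψ hψ (i + j))) :
    Joined (Q.theory.stack (ω, τ))
      (Q.theory.base ((PointedSpace.pow hψ i).tensor (PointedSpace.pow hψ j))) := by
  let e : (H.pow i).tensor (H.pow j) →ₗᵢ[ℂ] H.pow (i + j) := (H.powIso i j).toLinearIsometry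
  let e' : H.pow (i + j) →ₗᵢ[ℂ] (H.pow i).tensor (H.pow j) := (H.powIso i j).symm.toLinearIsometry
  have h0 : Joined (Q.theory.map e (Q.theory.stack (ω, τ)))
    (Q.theory.base (PointedSpace.pow hψ (i + j))) := h
  have h1 := joined_map (Q.theory.map e') h0
  have h2 : Q.theory.map e' (Q.theory.map e (Q.theory.stack (ω, τ))) = Q.theory.stack (ω, τ) := by
    refine (Q.theory.map_map _ _ _).trans
      ((congrArg (fun k => Q.theory.map k _) ?_).trans (Q.theory.map_id _))
    exact LinearIsometry.ext fun x => (H.powIso i j).symm_apply_apply x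
  have h3 : Q.theory.map e' (Q.theory.base (PointedSpace.pow hψ (i + j)))
      = Q.theory.base ((PointedSpace.pow hψ i).tensor (PointedSpace.pow hψ j)) :=
    Q.theory.map_base (P := PointedSpace.pow hψ (i + j))
      (R := (PointedSpace.pow hψ i).tensor (PointedSpace.pow hψ j)) e'
      ((congrArg (H.powIso i j).symm (powIso_vecPow ψ i j)).symm.trans
        ((H.powIso i j).symm_apply_apply _))
  exact h3 ▸ h2 ▸ h1

lemma exists_family_inverse_of_pointwise {X : Type*} [TopologicalSpace X] (hX : IsParameterSpace X)
    (h : ∀ (i : ℕ) (ω : Q.theory.obj (H.pow i)), ∃ (j : ℕ) (τ : Q.theory.obj (H.pow j)),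
      Joined (Q.theory.stack (ω, τ))
        (Q.theory.base ((PointedSpace.pow hψ i).tensor (PointedSpace.pow hψ j))))
    (i : ℕ) (f : C(X, Q.obj (H.pow i))) : ∃ (j : ℕ) (g : C(X, Q.obj (H.pow j))),
      ((Q.stackPow H i j).comp (f.prodMk g)).Homotopic
        (ContinuousMap.const X (Q.trivialState ψ hψ (i + j))) :=
  StackingTheory.exists_family_inverse (T := Q.theory) hψ hX h i f

end QuantumStateType

end QState

theorem mainTheorem8 {Γ : Type*} [Countable Γ] (Q : QState.QuantumStateType Γ)
    (H : QState.FinHilb) (ψ : H) (hψ : ‖ψ‖ = 1)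
    {X : Type*} [TopologicalSpace X] (hX : QState.IsParameterSpace X) :
    (Q.IsInvertible →
      ∀ (i : ℕ) (f : C(X, Q.obj (H.pow i))), ∃ (j : ℕ) (g : C(X, Q.obj (H.pow j))),
        ((Q.stackPow H i j).comp (f.prodMk g)).Homotopic
          (ContinuousMap.const X (Q.trivialState ψ hψ (i + j)))) ∧
    ((∀ (i : ℕ) (ω : Q.obj (H.pow i)), ∃ (j : ℕ) (τ : Q.obj (H.pow j)),
        Joined (Q.stackPow H i j (ω, τ)) (Q.trivialState ψ hψ (i + j))) →
      ∀ (i : ℕ) (f : C(X, Q.obj (H.pow i))), ∃ (j : ℕ) (g : C(X, Q.obj (H.pow j))),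
        ((Q.stackPow H i j).comp (f.prodMk g)).Homotopic
          (ContinuousMap.const X (Q.trivialState ψ hψ (i + j)))) := by
  refine ⟨fun hQ => QState.QuantumStateType.exists_family_inverse_of_pointwise hψ hX ?_,
    fun h => QState.QuantumStateType.exists_family_inverse_of_pointwise hψ hX fun i ω => ?_⟩
  · rcases (Nat.succ_le_of_lt (Module.finrank_pos (R := ℂ) (M := H))).eq_or_lt with h1 | h2
    · exact fun i ω => ⟨0, Q.product (QState.FinHilb.vecPow ψ 0) (QState.FinHilb.norm_vecPow hψ 0),
        QState.QuantumStateType.joined_of_finrank_eq_one hψ h1.symm i 0 ω _⟩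
    · exact fun i ω => hQ.exists_joined_pow hψ h2 i ω
  · obtain ⟨j, τ, hτ⟩ := h i ω
    exact ⟨j, τ, QState.QuantumStateType.joined_stack_of_joined_stackPow hψ ω τ hτ⟩
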